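/- **Definitions.** A *plane drawing* of a graph places its vertices at distinct points of $\mathbb R^2$ and draws its edges as straight segments that meet only at common end points. A (2-dimensional) *truss* $\mathcal T=\langle n,\{v_i\}_{i=1}^n,E,\gamma\rangle$ with face set $F$ is a planar graph $([n],E)$ with weights $\gamma:E\to\mathbb R_{>0}$ and points $v_i\in\mathbb R^2$ such that $v_i\ne v_j$ for $(i,j)\in E$. Several vertices may be at the same point, so planarity and faces are understood up to arbitrarily small distortion: for every $\varepsilon>0$ there is a plane drawing of $([n],E)$, with vertex $i$ within distance $\varepsilon$ of $v_i$ for all $i$, such that $F$ is the set of the triples $\{i,j,k\}$ of pairwise adjacent vertices with no vertex in the interior of the triangle $ijk$ of that drawing. (If the points $v_i$ themselves give a plane drawing, $F$ is the set of such triples for that drawing.) Every edge must be contained in some face. The *rigidity graph* $Q_{\mathcal T}$ has vertex set $F$; two different faces are adjacent if they share an edge. $\mathcal T$ is *stiffly-connected* if $Q_{\mathcal T}$ is connected and, for each $i\in[n]$, the subgraph induced by $Q_{\mathcal T}$ on the faces containing $i$ is connected (both graphs being nonempty). Let $\mathcal T'=\langle m,\{v'_i\}_{i=1}^m,E',\gamma'\rangle$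 be a truss with face set $F'$ and $m\ge n$, let $\rho:F'\to F$ be a bijection and $\pi:[m]\to[n]$ a surjection with $\pi(i)=i$ for all $i\in[n]$. $\mathcal T'$ is the *$(\rho,\pi)$-fretsaw extension* of $\mathcal T$ if $v'_i=v_{\pi(i)}$ for all $i\in[m]$, $\rho(\{i,j,k\})=\{\pi(i),\pi(j),\pi(k)\}$ for all $\{i,j,k\}\in F'$, and $\gamma'(i,j)=\gamma(\pi(i),\pi(j))$ for all $(i,j)\in E'$. **Lemma.** There is a linear-time algorithm $\langle\mathcal T',\rho\rangle=\mathtt{fretsaw}(\mathcal T,H,\tau)$ that takes a stiffly-connected truss $\mathcal T=\langle n,\{v_i\},E,\gamma\rangle$ with face set $F$, a connected spanning subgraph $H$ of $Q_{\mathcal T}$, and a map $\tau:[n]\to F$ from each vertex to a face containing it, and returns a stiffly-connected truss $\mathcal T'$ that is, for some $\pi$, a $(\rho,\pi)$-fretsaw extension of $\mathcal T$. Write $Q'=Q_{\mathcal T'}$ and $H'=\rho^{-1}(H)=\{(f_1,f_2): (\rho(f_1),\rho(f_2))\in H\}$. Then 1. for all $i\in[n]$, $i\in\rho^{-1}(\tau(i))$;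 2. $H'\subseteq Q'$; 3. for every $k\ge 0$, if $|H'|=|F|-1+k$ (i.e. $H'$ is a spanning tree plus $k$ additional edges), then $|Q'\setminus H'|\le k$. Here the input is given by lists of the point coordinates, the edges with their weights, the faces, the edges of $H$ and the values of $\tau$; the output lists $\mathcal T'$ in the same way, its faces being in the order of their images under $\rho$. *Linear-time* means $O(n+|E|+|F|+|H|)$ steps of a unit-cost random access machine that adds, subtracts and compares integers of $O(\log(n+|E|+|F|+|H|))$ bits and copies real numbers. -/

import Mathlib

namespace Fretsaw

/-! ### Trusses -/

/-- The Euclidean plane. -/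
abbrev Plane : Type := EuclideanSpace ℝ (Fin 2)

/-- The vertices of `G`, placed at the points `w`, and its edges, drawn as straight segments,
form a plane drawing: edges meet only at common end points. -/
structure IsPlaneDrawing {V : Type} (G : SimpleGraph V) (w : V → Plane) : Prop where
  injective : Function.Injective w
  vertex_notMem : ∀ i j k, G.Adj i j → k ≠ i → k ≠ j → w k ∉ segment ℝ (w i) (w j)
  edges_disjoint : ∀ i j k l, G.Adj i j → G.Adj k l → s(i, j) ≠ s(k, l) →
    Disjoint (openSegment ℝ (w i) (w j)) (openSegment ℝ (w k) (w l))

/-- The triples of pairwise adjacent vertices such that no vertex lies in the interior of the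
triangle that they span in the drawing `w`. -/
def emptyTriangles {V : Type} [DecidableEq V] (G : SimpleGraph V) (w : V → Plane) :
    Set (Finset V) :=
  {f | ∃ i j k, G.Adj i j ∧ G.Adj i k ∧ G.Adj j k ∧ f = {i, j, k} ∧
    ∀ l, w l ∉ interior (convexHull ℝ {w i, w j, w k})}

/-- A 2-dimensional truss with vertex set `Fin n`: a weighted planar graph drawn with straight
edges, vertex `i` being at the point `pos i`. Several vertices may be at the same point, so `pos`
itself need not be a plane drawing; planarity means that arbitrarily small displacements of the
vertices give a plane drawing, and the truss faces are the triangles of the graph that contain no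
vertex in that drawing. (If `pos` is a plane drawing already, these are the triangles
without a vertex in the interior, in the drawing `pos`.) -/
structure Truss (n : ℕ) where
  pos : Fin n → Plane
  graph : SimpleGraph (Fin n)
  /-- Only the values at edges matter. -/
  weight : Sym2 (Fin n) → ℝ
  faces : Finset (Finset (Fin n))
  weight_pos : ∀ e ∈ graph.edgeSet, 0 < weight e
  pos_ne : ∀ i j, graph.Adj i j → pos i ≠ pos j
  planar : ∀ ε : ℝ, 0 < ε → ∃ w : Fin n → Plane, (∀ i, dist (w i) (pos i) < ε) ∧
    IsPlaneDrawing graph w ∧ emptyTriangles graph w = (faces : Set (Finset (Fin n)))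
  edge_mem_face : ∀ i j, graph.Adj i j → ∃ f ∈ faces, i ∈ f ∧ j ∈ f

/-- The type of truss faces. -/
abbrev Truss.Face {n : ℕ} (T : Truss n) : Type := {f : Finset (Fin n) // f ∈ T.faces}

/-- The rigidity graph: its vertices are the truss faces, and two different faces are adjacent
if they share an edge. -/
def Truss.rigidityGraph {n : ℕ} (T : Truss n) : SimpleGraph T.Face where
  Adj f g := f ≠ g ∧ ∃ i j, T.graph.Adj i j ∧ i ∈ f.1 ∧ j ∈ f.1 ∧ i ∈ g.1 ∧ j ∈ g.1
  symm := ⟨fun _ _ ⟨hne, i, j, hij, h1, h2, h3, h4⟩ => ⟨hne.symm, i, j, hij, h3, h4, h1, h2⟩⟩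
  loopless := ⟨fun _ h => h.1 rfl⟩

/-- The rigidity graph is connected, and so is, for every vertex `i`, the subgraph that it
induces on the faces containing `i`. -/
def Truss.StifflyConnected {n : ℕ} (T : Truss n) : Prop :=
  T.rigidityGraph.Connected ∧
    ∀ i : Fin n, (T.rigidityGraph.induce {f : T.Face | i ∈ f.1}).Connected

/-- `T'` is the `(ρ, π)`-fretsaw extension of `T`; vertex `i` of `T'`, for `i < n`, is the
original copy of vertex `i` of `T`. -/
structure IsFretsawExtension {n m : ℕ} (T : Truss n) (T' : Truss m) (ρ : T'.Face ≃ T.Face)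
    (π : Fin m → Fin n) : Prop where
  le : n ≤ m
  surjective : Function.Surjective π
  pos_eq : ∀ i, T'.pos i = T.pos (π i)
  face_eq : ∀ f : T'.Face, (ρ f).1 = f.1.image π
  weight_eq : ∀ i j, T'.graph.Adj i j → T'.weight s(i, j) = T.weight s(π i, π j)
  original : ∀ i : Fin n, π (Fin.castLE le i) = i

/-! ### A random access machine

A program works on finitely many arrays of natural numbers and finitely many arrays of real
numbers (those that it names), and is charged one unit for each elementary operation.
Natural numbers can be added, subtracted and compared, and used as addresses;
real numbers can only be copied. The words that a program stores are
bounded by a word bound `W`: storing a larger number, or storing beyond address `W`, is not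
possible. -/

/-- The memory contents: `word a i` and `real a i` are the entries at index `i` of the `a`-th
array of natural numbers and of the `a`-th array of real numbers. -/
structure Store where
  word : ℕ → ℕ → ℕ
  real : ℕ → ℕ → ℝ

inductive Term where
  | const (c : ℕ)
  | read (a : ℕ) (idx : Term)
  | add (x y : Term)
  | sub (x y : Term)
  | lt (x y : Term)

def Term.eval (s : Store) : Term → ℕ
  | .const c => c
  | .read a idx => s.word a (idx.eval s)
  | .add x y => x.eval s + y.eval s
  | .sub x y => x.eval s - y.eval s
  | .lt x y => if x.eval s < y.eval s then 1 else 0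

/-- The number of operations in the evaluation of a term. -/
def Term.cost : Term → ℕ
  | .const _ => 1
  | .read _ idx => idx.cost + 1
  | .add x y => x.cost + y.cost + 1
  | .sub x y => x.cost + y.cost + 1
  | .lt x y => x.cost + y.cost + 1

/-- `set a idx val` stores the value of `val` in entry `idx` of word array `a`;
`copy a idx b idx'` copies entry `idx'` of real array `b` to entry `idx` of real array `a`;
tests succeed if their value is not `0`. -/
inductive Prog where
  | skip
  | set (a : ℕ) (idx val : Term)
  | copy (a : ℕ) (idx : Term) (b : ℕ) (idx' : Term)
  | seq (p q : Prog)
  | ite (test : Term) (p q : Prog)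
  | loop (test : Term) (p : Prog)

/-- Store `x` in entry `i` of word array `a`. -/
def Store.setWord (s : Store) (a i x : ℕ) : Store :=
  { s with word := Function.update s.word a (Function.update (s.word a) i x) }

/-- Store `x` in entry `i` of real array `a`. -/
def Store.setReal (s : Store) (a i : ℕ) (x : ℝ) : Store :=
  { s with real := Function.update s.real a (Function.update (s.real a) i x) }

/-- `Exec W p s t s'`: with word bound `W`, the program `p`, started with memory contents `s`,
halts after exactly `t` steps with memory contents `s'`. -/
inductive Exec (W : ℕ) : Prog → Store → ℕ → Store → Prop where
  | skip (s : Store) : Exec W .skip s 1 s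
  | set (a : ℕ) (idx val : Term) (s : Store) (hi : idx.eval s ≤ W) (hv : val.eval s ≤ W) :
      Exec W (.set a idx val) s (idx.cost + val.cost + 1)
        (s.setWord a (idx.eval s) (val.eval s))
  | copy (a : ℕ) (idx : Term) (b : ℕ) (idx' : Term) (s : Store) (hi : idx.eval s ≤ W) :
      Exec W (.copy a idx b idx') s (idx.cost + idx'.cost + 1)
        (s.setReal a (idx.eval s) (s.real b (idx'.eval s)))
  | seq {p q : Prog} {s s' s'' : Store} {t t' : ℕ} (hp : Exec W p s t s')
      (hq : Exec W q s' t' s'') : Exec W (.seq p q) s (t + t') s''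
  | ite_true {test : Term} {p q : Prog} {s s' : Store} {t : ℕ} (h : test.eval s ≠ 0)
      (hp : Exec W p s t s') : Exec W (.ite test p q) s (test.cost + t + 1) s'
  | ite_false {test : Term} {p q : Prog} {s s' : Store} {t : ℕ} (h : test.eval s = 0)
      (hq : Exec W q s t s') : Exec W (.ite test p q) s (test.cost + t + 1) s'
  | loop_true {test : Term} {p : Prog} {s s' s'' : Store} {t t' : ℕ} (h : test.eval s ≠ 0)
      (hp : Exec W p s t s') (hl : Exec W (.loop test p) s' t' s'') :
      Exec W (.loop test p) s (test.cost + t + t' + 1) s''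
  | loop_false {test : Term} {p : Prog} {s : Store} (h : test.eval s = 0) :
      Exec W (.loop test p) s (test.cost + 1) s

/-! ### Input and output of the machine -/

/-- A listing of the edges of a truss, each once and with its end points in some order, and of
its faces, each once and with its corners in some order. -/
structure Truss.Listing {n : ℕ} (T : Truss n) where
  numEdges : ℕ
  edge : Fin numEdges → Fin n × Fin n
  edge_injective : Function.Injective fun a => s((edge a).1, (edge a).2)
  range_edge : Set.range (fun a => s((edge a).1, (edge a).2)) = T.graph.edgeSet
  numFaces : ℕ
  face : Fin numFaces ≃ T.Face
  corner : Fin numFaces → Fin 3 → Fin n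
  face_eq : ∀ t, (face t).1 = Finset.univ.image (corner t)

/-- A listing of a truss and of the edges of a graph on its faces, each once. -/
structure InputListing {n : ℕ} (T : Truss n) (H : SimpleGraph T.Face) extends T.Listing where
  numLinks : ℕ
  link : Fin numLinks → Fin numFaces × Fin numFaces
  link_injective : Function.Injective fun a => s((link a).1, (link a).2)
  range_link : Set.range (fun a => s(face (link a).1, face (link a).2)) = H.edgeSet

/-- The size of the input, up to a constant factor. -/
def InputListing.size {n : ℕ} {T : Truss n} {H : SimpleGraph T.Face}
    (L : InputListing T H) : ℕ :=
  n + L.numEdges + L.numFaces + L.numLinks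

/-- The array with the given entries, followed by zeros. -/
def pad {α : Type} [Zero α] {k : ℕ} (f : Fin k → α) (i : ℕ) : α :=
  if h : i < k then f ⟨i, h⟩ else 0

/-- The memory contents at the start: the truss `T` (numbers of vertices, edges, faces; end points
of the edges; corners of the faces; coordinates of the vertices; weights of the edges), the
graph `H`, the map `τ`, and zeros elsewhere. -/
noncomputable def InputListing.initialStore {n : ℕ} {T : Truss n} {H : SimpleGraph T.Face}
    (L : InputListing T H) (τ : Fin n → T.Face) : Store where
  word
    | 0 => pad ![n, L.numEdges, L.numFaces, L.numLinks]
    | 1 => pad fun a => ((L.edge a).1 : ℕ)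
    | 2 => pad fun a => ((L.edge a).2 : ℕ)
    | 3 => pad fun t => (L.corner t 0 : ℕ)
    | 4 => pad fun t => (L.corner t 1 : ℕ)
    | 5 => pad fun t => (L.corner t 2 : ℕ)
    | 6 => pad fun a => ((L.link a).1 : ℕ)
    | 7 => pad fun a => ((L.link a).2 : ℕ)
    | 8 => pad fun i => (L.face.symm (τ i) : ℕ)
    | _ => 0
  real
    | 0 => pad fun i => T.pos i 0
    | 1 => pad fun i => T.pos i 1
    | 2 => pad fun a => T.weight s((L.edge a).1, (L.edge a).2)
    | _ => 0

/-- The output arrays (word arrays 9 to 14 and real arrays 3 to 5) contain the listing of the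
truss `T'`. -/
structure Truss.Listing.IsOutput {m : ℕ} {T' : Truss m} (L : T'.Listing) (s : Store) : Prop where
  num_vertices : s.word 9 0 = m
  num_edges : s.word 9 1 = L.numEdges
  num_faces : s.word 9 2 = L.numFaces
  edge_fst : ∀ a : Fin L.numEdges, s.word 10 a = (L.edge a).1
  edge_snd : ∀ a : Fin L.numEdges, s.word 11 a = (L.edge a).2
  corner_zero : ∀ t : Fin L.numFaces, s.word 12 t = L.corner t 0
  corner_one : ∀ t : Fin L.numFaces, s.word 13 t = L.corner t 1
  corner_two : ∀ t : Fin L.numFaces, s.word 14 t = L.corner t 2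
  pos_zero : ∀ i : Fin m, s.real 3 i = T'.pos i 0
  pos_one : ∀ i : Fin m, s.real 4 i = T'.pos i 1
  weight : ∀ a : Fin L.numEdges, s.real 5 a = T'.weight s((L.edge a).1, (L.edge a).2)

end Fretsaw

/-! The truss `T'` is `T` cut open along the links of the rigidity graph outside `H`. The faces at a
vertex `i` fall into components under the links of `H` between them (`Conn`), and each component
gets its own copy of `i`, at the same point. Every face of `T` thus has exactly one copy. Links of
`H` survive, since their two faces stay connected at both ends of the common edge. The faces at a
copy of `i` are one component of `H` at `i`, so `T'` is stiffly-connected.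

Planarity has to be shown for arbitrarily small displacements. In a plane drawing of `T` the faces
at `i` span disjoint open cones, and a component of `H` at `i` fills an arc of directions
(`exists_arc`). If the arc fits into a half-plane, its copy of `i` moves a little into the arc;
otherwise it stays where it is, and this happens to at most one component. Any two faces in
different arcs are then pushed apart at `i` by a line through `i` (`exists_separating_inward`). Two
faces of a plane drawing can be separated by a line that contains only their common corners
(`sep_faces`); combining both facts, after a small displacement any two faces are separated by a
line that contains only the corners at which they are connected (`eventually_sep`). Everything
required of a plane drawing follows from such lines. A triangle of the cut graph that is not a copy
of a face contains a vertex: this is inherited from the old drawing if the triangle below is not a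
face, and is `false_of_not_lift` otherwise.

For the count, let an extra link be a pair of faces that share an edge of `T'` without being linked
by `H`. If `{f, g}` is extra and `i` is an end of the common edge, then `f` and `g` are connected by
`H` around `i`, so the faces at `i` form a full cycle all of whose links but `{f, g}` are in `H`
(`cycle_at_vertex`). The two paths from `f` to `g` around the two ends of the edge add up, modulo 2,
to an element of the cycle space of `H`; these elements are the columns of `cycleMatrix`. They are
independent (`cycleMatrix_injective`): a linear relation yields a function on the vertices whose
nonzero values would spread over the whole truss, although they can occur only where the faces close
up around a vertex; an outer edge contradicts this. The cycle space of a connected `H` with `|F| - 1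
+ k` edges has dimension `k`, so there are at most `k` extra links.

The algorithm treats the `3 |F|` corners of faces as nodes of a graph, joined if they are at the
same vertex and their faces are linked by `H`. Each node has at most two neighbours. A breadth-first
search numbers the components, starting from the corners chosen by `τ` so that these get the
original numbers. Coordinates are copied corner by corner. Edges are collected without repetition
with the help of a square table, addressed through a multiplication table and initially zero, of
which only linearly many entries are used. The program logic is in `Runs`; `Raw.Result` describes
the output, and `Raw.Labels.labeling` translates it back into the geometric construction. -/

namespace Fretsaw
open Set Filter Topology

/-! ### Signed areas, triangles and plane drawings -/

/-- The cross product of two plane vectors. -/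
def cr (x y : Plane) : ℝ := x 0 * y 1 - x 1 * y 0

/-- Twice the signed area of a triangle. -/
def ori (a b c : Plane) : ℝ := cr (b - a) (c - a)

lemma plane_ext {x y : Plane} (h0 : x 0 = y 0) (h1 : x 1 = y 1) : x = y := by
  ext i; fin_cases i <;> assumption

lemma ori_eq (a b c : Plane) :
    ori a b c = (b 0 - a 0) * (c 1 - a 1) - (b 1 - a 1) * (c 0 - a 0) := by
  simp [ori, cr]

lemma mem_triangle {a b c x : Plane} : x ∈ convexHull ℝ {a, b, c} ↔
    ∃ α β γ : ℝ, 0 ≤ α ∧ 0 ≤ β ∧ 0 ≤ γ ∧ α + β + γ = 1 ∧ x = α • a + β • b + γ • c := by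
  rw [convexHull_insert (by simp), convexHull_pair]
  simp only [convexJoin_singleton_left, mem_iUnion, segment, mem_ofPred_eq]
  constructor
  · rintro ⟨y, ⟨s, t, hs, ht, hst, rfl⟩, p, q, hp, hq, hpq, rfl⟩
    refine ⟨p, q * s, q * t, hp, by positivity, by positivity, ?_, ?_⟩
    · rw [add_assoc, ← mul_add, hst, mul_one, hpq]
    · simp [smul_add, smul_smul, add_assoc]
  · rintro ⟨α, β, γ, hα, hβ, hγ, h, rfl⟩
    by_cases h0 : β + γ = 0
    · have hb : β = 0 := by linarith
      have hc : γ = 0 := by linarith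
      subst hb hc
      exact ⟨b, ⟨1, 0, by simp⟩, α, 0, hα, le_rfl, by linarith, by simp⟩
    · have hp : 0 < β + γ := lt_of_le_of_ne (by positivity) (Ne.symm h0)
      refine ⟨(β / (β + γ)) • b + (γ / (β + γ)) • c, ⟨_, _, by positivity, by positivity, ?_, rfl⟩,
        α, β + γ, hα, hp.le, by linarith, ?_⟩
      · field_simp
      · rw [smul_add, smul_smul, smul_smul, mul_div_cancel₀ _ h0, mul_div_cancel₀ _ h0, add_assoc]

lemma ori_comb {a b c : Plane} {α β γ : ℝ} (h : α + β + γ = 1) :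
    ori (α • a + β • b + γ • c) b c = α * ori a b c ∧
    ori a (α • a + β • b + γ • c) c = β * ori a b c ∧
    ori a b (α • a + β • b + γ • c) = γ * ori a b c := by
  obtain rfl : α = 1 - β - γ := by linarith
  simp only [ori_eq, PiLp.add_apply, PiLp.smul_apply, smul_eq_mul]
  refine ⟨?_, ?_, ?_⟩ <;> ring

lemma ori_sum (a b c x : Plane) : ori x b c + ori a x c + ori a b x = ori a b c := by
  simp only [ori_eq]; ring

/-- Cramer's rule: after clearing the denominator this is a polynomial identity in the coordinates.
-/
lemma barycentric {a b c : Plane} (h : ori a b c ≠ 0) (x : Plane) :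
    x = (ori x b c / ori a b c) • a + (ori a x c / ori a b c) • b +
      (ori a b x / ori a b c) • c := by
  have key : ori a b c • x = ori x b c • a + ori a x c • b + ori a b x • c := by
    apply plane_ext <;> simp only [ori_eq, PiLp.add_apply, PiLp.smul_apply, smul_eq_mul] <;> ring
  rw [div_eq_inv_mul, div_eq_inv_mul, div_eq_inv_mul, mul_smul, mul_smul, mul_smul, ← smul_add,
    ← smul_add, ← key, inv_smul_smul₀ h]

lemma continuous_ori {X : Type*} [TopologicalSpace X] {f g h : X → Plane} (hf : Continuous f)
    (hg : Continuous g) (hh : Continuous h) : Continuous fun x => ori (f x) (g x) (h x) := by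
  simp only [ori_eq]; fun_prop

lemma ori_self_left (a b : Plane) : ori a a b = 0 := by simp [ori_eq]
lemma ori_self_outer (a b : Plane) : ori a b a = 0 := by simp [ori_eq]
lemma ori_swap (a b c : Plane) : ori a c b = -ori a b c := by simp only [ori_eq]; ring
lemma ori_swap_left (a b c : Plane) : ori b a c = -ori a b c := by simp only [ori_eq]; ring

lemma eventually_line_mem {s : Set Plane} {x : Plane} (hx : x ∈ interior s) (v : Plane) :
    ∀ᶠ η : ℝ in 𝓝 0, x + η • v ∈ s := by
  have : Tendsto (fun η : ℝ => x + η • v) (𝓝 0) (𝓝 (x + (0 : ℝ) • v)) :=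
    (by fun_prop : Continuous fun η : ℝ => x + η • v).tendsto 0
  simp only [zero_smul, add_zero] at this
  exact this (mem_interior_iff_mem_nhds.1 hx)

lemma exists_pos_line_mem {s : Set Plane} {x : Plane} (hx : x ∈ interior s) (v : Plane) :
    ∃ η : ℝ, 0 < η ∧ x + η • v ∈ s := by
  have h := (eventually_line_mem hx v).filter_mono (nhdsWithin_le_nhds (s := Ioi 0))
  obtain ⟨η, h1, h2⟩ := (h.and self_mem_nhdsWithin).exists
  exact ⟨η, h2, h1⟩

/-- The three strict inequalities define an open set, contained in the triangle by `barycentric`.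
Conversely an interior point can be pushed a little towards each side within the triangle, so no
barycentric coordinate vanishes. Multiplying by `ori a b c` treats both orientations at once. -/
lemma interior_triangle {a b c x : Plane} (h : ori a b c ≠ 0) :
    x ∈ interior (convexHull ℝ {a, b, c}) ↔
      0 < ori x b c * ori a b c ∧ 0 < ori a x c * ori a b c ∧ 0 < ori a b x * ori a b c := by
  constructor
  · intro hx
    have key : ∀ v : Plane, ∃ η : ℝ, 0 < η ∧ 0 ≤ ori (x + η • v) b c * ori a b c ∧
        0 ≤ ori a (x + η • v) c * ori a b c ∧ 0 ≤ ori a b (x + η • v) * ori a b c := by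
      intro v
      obtain ⟨η, hη, hm⟩ := exists_pos_line_mem hx v
      obtain ⟨α, β, γ, hα, hβ, hγ, hs, he⟩ := mem_triangle.1 hm
      obtain ⟨h1, h2, h3⟩ := ori_comb (a := a) (b := b) (c := c) hs
      rw [← he] at h1 h2 h3
      refine ⟨η, hη, ?_⟩
      rw [h1, h2, h3, mul_assoc, mul_assoc, mul_assoc]
      have := mul_self_nonneg (ori a b c)
      exact ⟨by positivity, by positivity, by positivity⟩
    have hpos := mul_self_pos.2 h
    -- A move along `b - a` lowers the area opposite to `a` by `η * ori a b c`. It is still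
    -- nonnegative afterwards, up to the common sign, and hence was positive. The other two
    -- directions are obtained by rotating the corners.
    obtain ⟨η, hη, h1, -⟩ := key (b - a)
    obtain ⟨η', hη', -, h2, -⟩ := key (c - b)
    obtain ⟨η'', hη'', -, -, h3⟩ := key (a - c)
    have e1 : ori (x + η • (b - a)) b c = ori x b c - η * ori a b c := by
      simp only [ori_eq, PiLp.add_apply, PiLp.smul_apply, PiLp.sub_apply, smul_eq_mul]; ring
    have e2 : ori a (x + η' • (c - b)) c = ori a x c - η' * ori a b c := by
      simp only [ori_eq, PiLp.add_apply, PiLp.smul_apply, PiLp.sub_apply, smul_eq_mul]; ring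
    have e3 : ori a b (x + η'' • (a - c)) = ori a b x - η'' * ori a b c := by
      simp only [ori_eq, PiLp.add_apply, PiLp.smul_apply, PiLp.sub_apply, smul_eq_mul]; ring
    rw [e1] at h1; rw [e2] at h2; rw [e3] at h3
    have := mul_pos hη hpos
    have := mul_pos hη' hpos
    have := mul_pos hη'' hpos
    exact ⟨by linarith, by linarith, by linarith⟩
  · rintro ⟨h1, h2, h3⟩
    have hopen : IsOpen {x : Plane | 0 < ori x b c * ori a b c ∧ 0 < ori a x c * ori a b c ∧
        0 < ori a b x * ori a b c} := by
      have c1 : Continuous fun x : Plane => ori x b c * ori a b c :=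
        (continuous_ori continuous_id continuous_const continuous_const).mul continuous_const
      have c2 : Continuous fun x : Plane => ori a x c * ori a b c :=
        (continuous_ori continuous_const continuous_id continuous_const).mul continuous_const
      have c3 : Continuous fun x : Plane => ori a b x * ori a b c :=
        (continuous_ori continuous_const continuous_const continuous_id).mul continuous_const
      exact (isOpen_lt continuous_const c1).inter
        ((isOpen_lt continuous_const c2).inter (isOpen_lt continuous_const c3))
    refine mem_interior.2 ⟨_, ?_, hopen, h1, h2, h3⟩
    rintro y ⟨g1, g2, g3⟩
    have hpos := mul_self_pos.2 h
    have hd : ∀ t, 0 < t * ori a b c → 0 ≤ t / ori a b c := by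
      intro t ht
      rw [show t / ori a b c = (t * ori a b c) / (ori a b c * ori a b c) by field_simp]
      positivity
    refine mem_triangle.2 ⟨_, _, _, hd _ g1, hd _ g2, hd _ g3, ?_, barycentric h y⟩
    rw [← add_div, ← add_div, ori_sum, div_self h]

lemma exists_comb_of_ori_eq_zero {a b c : Plane} (h : ori a b c = 0) (hab : a ≠ b) :
    ∃ t : ℝ, c = a + t • (b - a) := by
  rw [ori_eq] at h
  by_cases h0 : b 0 - a 0 = 0
  · have h1 : b 1 - a 1 ≠ 0 := fun h1 => hab (plane_ext (by linarith) (by linarith))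
    have h2 : c 0 - a 0 = 0 := by
      rw [h0] at h; simpa [h1] using h
    refine ⟨(c 1 - a 1) / (b 1 - a 1), plane_ext ?_ ?_⟩
    · simp [h0]; linarith
    · simp; field_simp; ring
  · refine ⟨(c 0 - a 0) / (b 0 - a 0), plane_ext ?_ ?_⟩
    · simp; field_simp; ring
    · simp; field_simp; linarith

variable {V : Type} {G : SimpleGraph V} {w : V → Plane}

/-- If the three points were collinear, one of them would lie on the segment between the other two,
which is an edge. The ranges of the parameter `t` of `w k` on the line through `w i` and `w j` tell
which one. -/
lemma IsPlaneDrawing.ori_ne_zero (hw : IsPlaneDrawing G w) {i j k : V} (hij : G.Adj i j)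
    (hik : G.Adj i k) (hjk : G.Adj j k) : ori (w i) (w j) (w k) ≠ 0 := by
  intro h
  have hne : w i ≠ w j := fun h' => hij.ne (hw.injective h')
  obtain ⟨t, ht⟩ := exists_comb_of_ori_eq_zero h hne
  rcases le_or_gt t 0 with h0 | h0
  · refine hw.vertex_notMem j k i hjk hij.ne hik.ne ?_
    have : (0:ℝ) < 1 - t := by linarith
    refine ⟨-t / (1 - t), 1 / (1 - t), div_nonneg (by linarith) this.le, by positivity,
      by field_simp; ring, ?_⟩
    rw [ht]
    apply plane_ext <;> simp <;> field_simp <;> ring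
  rcases le_or_gt t 1 with h1 | h1
  · refine hw.vertex_notMem i j k hij hik.ne' hjk.ne' ⟨1 - t, t, by linarith, by linarith, by ring, ?_⟩
    rw [ht]
    apply plane_ext <;> simp <;> ring
  · refine hw.vertex_notMem i k j hik hij.ne' hjk.ne ?_
    refine ⟨1 - 1 / t, 1 / t, ?_, by positivity, by ring, ?_⟩
    · rw [sub_nonneg, div_le_one (by linarith)]; exact h1.le
    · rw [ht]
      apply plane_ext <;> simp <;> field_simp <;> ring

/-- A point of a triangle is a corner, on an open side or in the interior. -/
lemma triangle_cases {a b c x : Plane} (h : ori a b c ≠ 0) (hx : x ∈ convexHull ℝ {a, b, c}) :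
    (x = a ∨ x = b ∨ x = c) ∨
    (x ∈ openSegment ℝ a b ∨ x ∈ openSegment ℝ a c ∨ x ∈ openSegment ℝ b c) ∨
    x ∈ interior (convexHull ℝ {a, b, c}) := by
  obtain ⟨α, β, γ, hα, hβ, hγ, hs, he⟩ := mem_triangle.1 hx
  rcases hα.eq_or_lt with rfl | hα' <;> rcases hβ.eq_or_lt with rfl | hβ' <;>
    rcases hγ.eq_or_lt with rfl | hγ'
  · norm_num at hs
  · left; right; right; rw [he]; simp at hs; simp [hs]
  · left; right; left; rw [he]; simp at hs; simp [hs]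
  · right; left; right; right
    exact ⟨β, γ, hβ', hγ', by linarith, by rw [he]; simp⟩
  · left; left; rw [he]; simp at hs; simp [hs]
  · right; left; right; left
    exact ⟨α, γ, hα', hγ', by linarith, by rw [he]; simp⟩
  · right; left; left
    exact ⟨α, β, hα', hβ', by linarith, by rw [he]; simp⟩
  · right; right
    obtain ⟨h1, h2, h3⟩ := ori_comb (a := a) (b := b) (c := c) hs
    rw [← he] at h1 h2 h3
    have hpos := mul_self_pos.2 h
    rw [interior_triangle h, h1, h2, h3, mul_assoc, mul_assoc, mul_assoc]
    exact ⟨by positivity, by positivity, by positivity⟩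

lemma not_extreme_of_line {s : Set Plane} {x v : Plane} (hv : v ≠ 0)
    (h : ∀ᶠ η : ℝ in 𝓝 0, x + η • v ∈ s) : x ∉ s.extremePoints ℝ := by
  intro hx
  have h' : ∀ᶠ η : ℝ in 𝓝 0, x + (-η) • v ∈ s := by
    have : Tendsto (fun η : ℝ => -η) (𝓝 0) (𝓝 0) := by simpa using (continuous_neg (G := ℝ)).tendsto 0
    exact this.eventually h
  obtain ⟨η, ⟨h1, h2⟩, h3⟩ :=
    (((h.and h').filter_mono (nhdsWithin_le_nhds (s := Ioi 0))).and self_mem_nhdsWithin).exists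
  have := (mem_extremePoints.1 hx).2 _ h1 _ h2
    ⟨1/2, 1/2, by norm_num, by norm_num, by norm_num, by
      apply plane_ext <;> simp <;> ring⟩
  have h4 : η • v = 0 := by simpa using this.1
  rcases smul_eq_zero.1 h4 with h5 | h5
  · exact absurd h5 (ne_of_gt h3)
  · exact hv h5

lemma eventually_openSegment {a b x : Plane} (hx : x ∈ openSegment ℝ a b) {s : Set Plane}
    (hs : Convex ℝ s) (ha : a ∈ s) (hb : b ∈ s) : ∀ᶠ η : ℝ in 𝓝 0, x + η • (b - a) ∈ s := by
  obtain ⟨p, q, hp, hq, hpq, rfl⟩ := hx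
  have h1 : ∀ᶠ η : ℝ in 𝓝 0, η < p := gt_mem_nhds hp
  have h2 : ∀ᶠ η : ℝ in 𝓝 0, -q < η := lt_mem_nhds (by linarith)
  filter_upwards [h1, h2] with η h1 h2
  have := hs ha hb (a := p - η) (b := q + η) (by linarith) (by linarith) (by linarith)
  convert this using 1
  apply plane_ext <;> simp <;> ring

/-! ### Intersections of faces and separating lines -/

section faces
variable {V : Type} {G : SimpleGraph V} {w : V → Plane} {F : Finset (Finset V)}

/-- The triangle spanned by the corners of `f` in the drawing `w`. -/
def tri (w : V → Plane) (f : Finset V) : Set Plane := convexHull ℝ (w '' (f : Set V))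

lemma convex_tri (w : V → Plane) (f : Finset V) : Convex ℝ (tri w f) := convex_convexHull _ _

lemma isCompact_tri (w : V → Plane) (f : Finset V) : IsCompact (tri w f) :=
  (f.finite_toSet.image w).isCompact_convexHull ℝ

lemma mem_tri {w : V → Plane} {f : Finset V} {i : V} (hi : i ∈ f) : w i ∈ tri w f :=
  subset_convexHull _ _ (mem_image_of_mem _ hi)

variable [DecidableEq V]

lemma tri_triple (w : V → Plane) (i j k : V) :
    tri w {i, j, k} = convexHull ℝ {w i, w j, w k} := by
  simp [tri, image_insert_eq]

lemma face_spec (hF : emptyTriangles G w = F) {f : Finset V} (hf : f ∈ F) :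
    ∃ i j k, G.Adj i j ∧ G.Adj i k ∧ G.Adj j k ∧ f = {i, j, k} ∧ ∀ l, w l ∉ interior (tri w f) := by
  have : f ∈ emptyTriangles G w := by rw [hF]; exact hf
  obtain ⟨i, j, k, h1, h2, h3, h4, h5⟩ := this
  refine ⟨i, j, k, h1, h2, h3, h4, ?_⟩
  rw [h4, tri_triple]; exact h5

lemma face_card (hF : emptyTriangles G w = F) {f : Finset V} (hf : f ∈ F) : f.card = 3 := by
  obtain ⟨i, j, k, h1, h2, h3, rfl, -⟩ := face_spec hF hf
  rw [Finset.card_eq_three]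
  exact ⟨i, j, k, h1.ne, h2.ne, h3.ne, rfl⟩

lemma face_adj (hF : emptyTriangles G w = F) {f : Finset V} (hf : f ∈ F) {i j : V} (hi : i ∈ f)
    (hj : j ∈ f) (hij : i ≠ j) : G.Adj i j := by
  obtain ⟨a, b, c, h1, h2, h3, rfl, -⟩ := face_spec hF hf
  simp only [Finset.mem_insert, Finset.mem_singleton] at hi hj
  rcases hi with rfl | rfl | rfl <;> rcases hj with rfl | rfl | rfl <;>
    first | exact absurd rfl hij | assumption | (apply SimpleGraph.Adj.symm; assumption)

lemma exists_third {f : Finset V} (hf : f.card = 3) {i j : V} (hi : i ∈ f) (hj : j ∈ f)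
    (hij : i ≠ j) : ∃ k, k ≠ i ∧ k ≠ j ∧ f = {i, j, k} := by
  have h2 : ({i, j} : Finset V).card = 2 := Finset.card_pair hij
  have hsub : ({i, j} : Finset V) ⊆ f := by
    intro x hx; simp only [Finset.mem_insert, Finset.mem_singleton] at hx
    rcases hx with rfl | rfl <;> assumption
  obtain ⟨k, hk, hk'⟩ := Finset.exists_mem_notMem_of_card_lt_card (s := {i, j}) (t := f) (by omega)
  simp only [Finset.mem_insert, Finset.mem_singleton, not_or] at hk'
  refine ⟨k, hk'.1, hk'.2, (Finset.eq_of_subset_of_card_le ?_ ?_).symm⟩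
  · intro x hx; simp only [Finset.mem_insert, Finset.mem_singleton] at hx
    rcases hx with rfl | rfl | rfl <;> assumption
  · rw [hf, Finset.card_eq_three.2 ⟨i, j, k, hij, Ne.symm hk'.1, Ne.symm hk'.2, rfl⟩]

lemma exists_triple {f : Finset V} (hf : f.card = 3) {i : V} (hi : i ∈ f) :
    ∃ j k, j ≠ i ∧ k ≠ i ∧ k ≠ j ∧ f = {i, j, k} := by
  obtain ⟨j, hj, hji⟩ := Finset.exists_mem_ne (by omega : 1 < f.card) i
  obtain ⟨k, h1, h2, h3⟩ := exists_third hf hi hj hji.symm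
  exact ⟨j, k, hji, h1, h2, h3⟩

lemma face_ori_ne_zero (hw : IsPlaneDrawing G w) (hF : emptyTriangles G w = F) {f : Finset V}
    (hf : f ∈ F) {i j k : V} (hi : i ∈ f) (hj : j ∈ f) (hk : k ∈ f) (hij : i ≠ j) (hik : i ≠ k)
    (hjk : j ≠ k) : ori (w i) (w j) (w k) ≠ 0 :=
  hw.ori_ne_zero (face_adj hF hf hi hj hij) (face_adj hF hf hi hk hik) (face_adj hF hf hj hk hjk)

lemma face_cases (hw : IsPlaneDrawing G w) (hF : emptyTriangles G w = F) {f : Finset V}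
    (hf : f ∈ F) {x : Plane} (hx : x ∈ tri w f) :
    (∃ a ∈ f, x = w a) ∨ (∃ a ∈ f, ∃ b ∈ f, G.Adj a b ∧ x ∈ openSegment ℝ (w a) (w b)) ∨
      x ∈ interior (tri w f) := by
  obtain ⟨a, b, c, h1, h2, h3, rfl, -⟩ := face_spec hF hf
  rw [tri_triple] at hx ⊢
  rcases triangle_cases (hw.ori_ne_zero h1 h2 h3) hx with (h | h | h) | (h | h | h) | h
  · exact Or.inl ⟨a, by simp, h⟩
  · exact Or.inl ⟨b, by simp, h⟩
  · exact Or.inl ⟨c, by simp, h⟩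
  · exact Or.inr (Or.inl ⟨a, by simp, b, by simp, h1, h⟩)
  · exact Or.inr (Or.inl ⟨a, by simp, c, by simp, h2, h⟩)
  · exact Or.inr (Or.inl ⟨b, by simp, c, by simp, h3, h⟩)
  · exact Or.inr (Or.inr h)

/-- In each of the two triangles the point is a corner, on an open side or in the interior. Of the
nine combinations, some are excluded by planarity; in others a short segment through the point,
along an edge, stays in both triangles, against extremality. Only common corners remain. -/
lemma extremePoints_inter_faces (hw : IsPlaneDrawing G w) (hF : emptyTriangles G w = F)
    {f g : Finset V} (hf : f ∈ F) (hg : g ∈ F) :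
    (tri w f ∩ tri w g).extremePoints ℝ ⊆ w '' ((f ∩ g : Finset V) : Set V) := by
  intro x hx
  have hxm := (mem_extremePoints.1 hx).1
  obtain ⟨_, _, _, _, _, _, -, hfe⟩ := face_spec hF hf
  obtain ⟨_, _, _, _, _, _, -, hge⟩ := face_spec hF hg
  have hne : ∀ {a b}, G.Adj a b → w b - w a ≠ 0 := fun h h' =>
    h.ne (hw.injective (sub_eq_zero.1 h')).symm
  have hvert : ∀ {a b c}, G.Adj b c → w a ∉ openSegment ℝ (w b) (w c) := by
    intro a b c h hm
    by_cases hb : a = b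
    · subst hb
      rw [left_mem_openSegment_iff] at hm
      exact h.ne (hw.injective hm)
    by_cases hc : a = c
    · subst hc
      rw [right_mem_openSegment_iff] at hm
      exact h.ne (hw.injective hm)
    exact hw.vertex_notMem b c a h hb hc (openSegment_subset_segment _ _ _ hm)
  rcases face_cases hw hF hf hxm.1 with ⟨a, ha, h1⟩ | ⟨a, ha, b, hb, hab, h1⟩ | h1 <;>
    rcases face_cases hw hF hg hxm.2 with ⟨c, hc, h2⟩ | ⟨c, hc, d, hd, hcd, h2⟩ | h2
  · have : a = c := hw.injective (h1.symm.trans h2)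
    subst this
    exact ⟨a, by simp [ha, hc], h1.symm⟩
  · rw [h1] at h2; exact absurd h2 (hvert hcd)
  · rw [h1] at h2; exact absurd h2 (hge a)
  · rw [h2] at h1; exact absurd h1 (hvert hab)
  · by_cases he : s(a, b) = s(c, d)
    · have hag : a ∈ g ∧ b ∈ g := by
        rcases Sym2.eq_iff.1 he with ⟨rfl, rfl⟩ | ⟨rfl, rfl⟩ <;> exact ⟨by assumption, by assumption⟩
      exfalso
      refine not_extreme_of_line (hne hab) ?_ hx
      exact (eventually_openSegment h1 (convex_tri w f) (mem_tri ha) (mem_tri hb)).and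
        (eventually_openSegment h1 (convex_tri w g) (mem_tri hag.1) (mem_tri hag.2))
    · exact absurd h2 (Set.disjoint_left.1 (hw.edges_disjoint a b c d hab hcd he) h1)
  · exfalso
    refine not_extreme_of_line (hne hab) ?_ hx
    exact (eventually_openSegment h1 (convex_tri w f) (mem_tri ha) (mem_tri hb)).and
      (eventually_line_mem h2 _)
  · rw [h2] at h1; exact absurd h1 (hfe c)
  · exfalso
    refine not_extreme_of_line (hne hcd) ?_ hx
    exact (eventually_line_mem h1 _).and
      (eventually_openSegment h2 (convex_tri w g) (mem_tri hc) (mem_tri hd))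
  · exfalso
    obtain ⟨a, b, _, hab, _⟩ := face_spec hF hf
    refine not_extreme_of_line (hne hab) ?_ hx
    exact (eventually_line_mem h1 _).and (eventually_line_mem h2 _)

/-- Krein–Milman for the compact convex set `tri w f ∩ tri w g`. -/
lemma inter_faces_subset (hw : IsPlaneDrawing G w) (hF : emptyTriangles G w = F)
    {f g : Finset V} (hf : f ∈ F) (hg : g ∈ F) : tri w f ∩ tri w g ⊆ tri w (f ∩ g) := by
  have hc : IsCompact (tri w f ∩ tri w g) := (isCompact_tri w f).inter (isCompact_tri w g)
  have hv : Convex ℝ (tri w f ∩ tri w g) := (convex_tri w f).inter (convex_tri w g)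
  rw [← closure_convexHull_extremePoints hc hv]
  exact closure_minimal (convexHull_mono (extremePoints_inter_faces hw hF hf hg))
    (isCompact_tri w (f ∩ g)).isClosed

/-- The drawings `p` of `f` and `q` of `g` are separated by a line, which contains no corners
but those in `K`. -/
def Sep (p q : V → Plane) (f g : Finset V) (K : Set V) : Prop :=
  ∃ (u : Plane →L[ℝ] ℝ) (c : ℝ), (∀ x ∈ f, x ∉ K → c < u (p x)) ∧ (∀ x ∈ g, x ∉ K → u (q x) < c) ∧
    ∀ x ∈ K, u (p x) = c ∧ u (q x) = c

lemma small_comb_mem_tri {i j k : V} {s t : ℝ} (hs : 0 ≤ s) (ht : 0 ≤ t) (hst : s + t ≤ 1) :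
    w i + (s • (w j - w i) + t • (w k - w i)) ∈ tri w {i, j, k} := by
  rw [tri_triple]
  refine mem_triangle.2 ⟨1 - s - t, s, t, by linarith, hs, ht, by ring, ?_⟩
  apply plane_ext <;> simp <;> ring

lemma comb_eq_zero {a b c : Plane} (h : ori a b c ≠ 0) {s t : ℝ}
    (hst : s • (b - a) + t • (c - a) = 0) : s = 0 ∧ t = 0 := by
  have h0 := congrArg (fun x : Plane => x 0) hst
  have h1 := congrArg (fun x : Plane => x 1) hst
  simp at h0 h1
  rw [ori_eq] at h
  constructor
  · have : s * ((b 0 - a 0) * (c 1 - a 1) - (b 1 - a 1) * (c 0 - a 0)) = 0 := by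
      linear_combination (c 1 - a 1) * h0 - (c 0 - a 0) * h1
    exact (mul_eq_zero.1 this).resolve_right h
  · have : t * ((b 0 - a 0) * (c 1 - a 1) - (b 1 - a 1) * (c 0 - a 0)) = 0 := by
      linear_combination (b 0 - a 0) * h1 - (b 1 - a 1) * h0
    exact (mul_eq_zero.1 this).resolve_right h

lemma sep_of_disjoint (hw : IsPlaneDrawing G w) (hF : emptyTriangles G w = F)
    {f g : Finset V} (hf : f ∈ F) (hg : g ∈ F) (hK : f ∩ g = ∅) : Sep w w f g ∅ := by
  have hd : Disjoint (tri w g) (tri w f) := by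
    rw [Set.disjoint_left]
    intro x h1 h2
    have := inter_faces_subset hw hF hf hg ⟨h2, h1⟩
    rw [hK] at this
    simp [tri] at this
  obtain ⟨u, a, b, h1, h2, h3⟩ := geometric_hahn_banach_compact_closed (convex_tri w g)
    (isCompact_tri w g) (convex_tri w f) (isCompact_tri w f).isClosed hd
  refine ⟨u, b, fun x hx _ => h3 _ (mem_tri hx), fun x hx _ => (h1 _ (mem_tri hx)).trans h2, ?_⟩
  simp

/-- The cones of the two triangles at `w i` meet only in the apex. Hence `0` is not a convex
combination of the two sides of `f` and the negatives of the two sides of `g`, and a functional that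
is positive on these four vectors gives the line. -/
lemma sep_of_inter_singleton (hw : IsPlaneDrawing G w) (hF : emptyTriangles G w = F)
    {f g : Finset V} (hf : f ∈ F) (hg : g ∈ F) {i : V} (hK : f ∩ g = {i}) : Sep w w f g {i} := by
  have hi : i ∈ f ∩ g := by simp [hK]
  rw [Finset.mem_inter] at hi
  obtain ⟨a, b, hai, hbi, hba, rfl⟩ := exists_triple (face_card hF hf) hi.1
  obtain ⟨c, d, hci, hdi, hdc, rfl⟩ := exists_triple (face_card hF hg) hi.2
  have o1 := face_ori_ne_zero hw hF hf (i := i) (j := a) (k := b) (by simp) (by simp) (by simp)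
    hai.symm hbi.symm hba.symm
  have o2 := face_ori_ne_zero hw hF hg (i := i) (j := c) (k := d) (by simp) (by simp) (by simp)
    hci.symm hdi.symm hdc.symm
  set S : Set Plane := {w a - w i, w b - w i, -(w c - w i), -(w d - w i)} with hS
  have h0 : (0 : Plane) ∉ convexHull ℝ S := by
    intro h
    rw [hS, convexHull_insert (by simp), convexJoin_singleton_left] at h
    simp only [mem_iUnion] at h
    obtain ⟨y, hy, p, q, hp, hq, hpq, h⟩ := h
    obtain ⟨α, β, γ, hα, hβ, hγ, hs, rfl⟩ := mem_triangle.1 hy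
    -- A vanishing combination exhibits one vector in both cones. As the coefficients sum to `1`, it
    -- leads from `w i` to a point of both triangles without rescaling.
    have e : p • (w a - w i) + (q * α) • (w b - w i) =
        (q * β) • (w c - w i) + (q * γ) • (w d - w i) := by
      rw [← sub_eq_zero, ← h]
      module
    have hqα : q * α ≤ q := mul_le_of_le_one_right hq (by linarith)
    have hqβ : q * β + q * γ ≤ 1 := by
      have : q * β + q * γ + q * α = q := by rw [← mul_add, ← mul_add]; rw [show β + γ + α = 1 by linarith, mul_one]
      nlinarith [mul_nonneg hq hα]
    have m1 := small_comb_mem_tri (w := w) (i := i) (j := a) (k := b) hp (mul_nonneg hq hα)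
      (by linarith)
    have m2 := small_comb_mem_tri (w := w) (i := i) (j := c) (k := d) (mul_nonneg hq hβ)
      (mul_nonneg hq hγ) hqβ
    rw [← e] at m2
    have m3 := inter_faces_subset hw hF hf hg ⟨m1, m2⟩
    rw [hK] at m3
    simp only [tri, Finset.coe_singleton, image_singleton, convexHull_singleton,
      mem_singleton_iff, add_eq_left] at m3
    obtain ⟨z1, z2⟩ := comb_eq_zero o1 m3
    rw [m3] at e
    obtain ⟨z3, z4⟩ := comb_eq_zero o2 e.symm
    have : p + q * (α + β + γ) = 0 := by linear_combination z1 + z2 + z3 + z4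
    rw [hs, mul_one] at this
    linarith
  obtain ⟨u, t, h1, h2⟩ := geometric_hahn_banach_point_closed (convex_convexHull ℝ S)
    ((Set.toFinite S).isCompact_convexHull ℝ).isClosed h0
  rw [map_zero] at h1
  have hu : ∀ y ∈ S, 0 < u y := fun y hy => h1.trans (h2 y (subset_convexHull _ _ hy))
  have ha := hu _ (by simp [hS] : w a - w i ∈ S)
  have hb := hu _ (by simp [hS] : w b - w i ∈ S)
  have hc := hu _ (by simp [hS] : -(w c - w i) ∈ S)
  have hd := hu _ (by simp [hS] : -(w d - w i) ∈ S)
  simp only [map_sub, map_neg] at ha hb hc hd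
  refine ⟨u, u (w i), ?_, ?_, by simp⟩
  · intro x hx hxi
    simp only [Finset.mem_insert, Finset.mem_singleton] at hx
    rcases hx with rfl | rfl | rfl
    · exact absurd rfl hxi
    · linarith
    · linarith
  · intro x hx hxi
    simp only [Finset.mem_insert, Finset.mem_singleton] at hx
    rcases hx with rfl | rfl | rfl
    · exact absurd rfl hxi
    · linarith
    · linarith

/-- The linear functional `cr v`. -/
noncomputable def crL (v : Plane) : Plane →L[ℝ] ℝ :=
  LinearMap.toContinuousLinearMap
    { toFun := fun x => cr v x
      map_add' := fun x y => by simp [cr]; ring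
      map_smul' := fun r x => by simp [cr]; ring }

@[simp] lemma crL_apply (v x : Plane) : crL v x = cr v x := rfl

/-- If `k` and `l` were on the same side of the common edge, then a point slightly off its midpoint,
towards `l`, would be in both triangles, which meet only in the edge. -/
lemma ori_neg_of_inter_pair (hw : IsPlaneDrawing G w) (hF : emptyTriangles G w = F)
    {i j k l : V} (hf : {i, j, k} ∈ F) (hg : {i, j, l} ∈ F) (hij : i ≠ j)
    (hki : k ≠ i) (hkj : k ≠ j) (hli : l ≠ i) (hlj : l ≠ j) (hkl : k ≠ l) :
    ori (w i) (w j) (w k) * ori (w i) (w j) (w l) < 0 := by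
  have o1 := face_ori_ne_zero hw hF hf (i := i) (j := j) (k := k) (by simp) (by simp) (by simp)
    hij hki.symm hkj.symm
  have o2 := face_ori_ne_zero hw hF hg (i := i) (j := j) (k := l) (by simp) (by simp) (by simp)
    hij hli.symm hlj.symm
  by_contra hcon
  have hpos : 0 < ori (w i) (w j) (w k) * ori (w i) (w j) (w l) :=
    lt_of_le_of_ne (not_lt.1 hcon) (mul_ne_zero o1 o2).symm
  have hK : ({i, j, k} ∩ {i, j, l} : Finset V) = {i, j} := by
    ext x; simp only [Finset.mem_inter, Finset.mem_insert, Finset.mem_singleton]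
    constructor
    · rintro ⟨rfl | rfl | rfl, h⟩
      · simp
      · simp
      · rcases h with rfl | rfl | rfl <;> simp_all
    · rintro (rfl | rfl) <;> simp
  have b := barycentric o1 (w l)
  set o := ori (w i) (w j) (w k)
  set β := ori (w i) (w l) (w k) / o
  set γ := ori (w i) (w j) (w l) / o
  have hα : ori (w l) (w j) (w k) / o = 1 - β - γ := by
    have := ori_sum (w i) (w j) (w k) (w l)
    simp only [β, γ]
    field_simp
    linarith
  have hγ : 0 < γ := by
    simp only [γ]
    rw [show ori (w i) (w j) (w l) / o = (o * ori (w i) (w j) (w l)) / (o * o) by field_simp]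
    exact div_pos hpos (mul_self_pos.2 o1)
  rw [hα] at b
  -- The point at `1/2` along the edge and `ε` towards `w l` has the coordinates `1/2 + ε β` and `ε
  -- γ` with respect to the triangle `ijk`. The bounds on `ε` keep it in both triangles.
  obtain ⟨ε, hε, hε1, hε2, hε3⟩ : ∃ ε : ℝ, 0 < ε ∧ ε ≤ 1 / 2 ∧ ε * |β| ≤ 1 / 4 ∧ ε * γ ≤ 1 / 4 := by
    refine ⟨1 / (4 * (1 + |β| + γ)), by positivity, ?_, ?_, ?_⟩
    · rw [div_le_div_iff₀ (by positivity) (by positivity)]; nlinarith [abs_nonneg β]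
    · rw [div_mul_eq_mul_div, div_le_div_iff₀ (by positivity) (by positivity)]
      nlinarith [abs_nonneg β]
    · rw [div_mul_eq_mul_div, div_le_div_iff₀ (by positivity) (by positivity)]
      nlinarith [abs_nonneg β]
  have hb1 : -(1/4) ≤ ε * β := by nlinarith [neg_abs_le β]
  have hb2 : ε * β ≤ 1/4 := by nlinarith [le_abs_self β]
  have m1 := small_comb_mem_tri (w := w) (i := i) (j := j) (k := k) (s := 1 / 2 + ε * β)
    (t := ε * γ) (by linarith) (by positivity) (by linarith)
  have m2 := small_comb_mem_tri (w := w) (i := i) (j := j) (k := l) (s := 1 / 2)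
    (t := ε) (by norm_num) hε.le (by linarith)
  have e : w i + ((1 / 2 : ℝ) • (w j - w i) + ε • (w l - w i)) =
      w i + ((1 / 2 + ε * β) • (w j - w i) + (ε * γ) • (w k - w i)) := by
    rw [b]
    module
  rw [e] at m2
  have m3 := inter_faces_subset hw hF hf hg ⟨m1, m2⟩
  rw [hK, tri, Finset.coe_pair, image_pair, convexHull_pair] at m3
  obtain ⟨p, q, -, -, hpq, hm⟩ := m3
  obtain rfl : p = 1 - q := by linarith
  have : (1 / 2 + ε * β - q) • (w j - w i) + (ε * γ) • (w k - w i) = 0 := by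
    have h3 := sub_eq_zero.2 hm.symm
    rw [← h3]; module
  have := (comb_eq_zero o1 this).2
  exact absurd this (by positivity)

lemma sep_of_inter_pair (hw : IsPlaneDrawing G w) (hF : emptyTriangles G w = F)
    {i j k l : V} (hf : {i, j, k} ∈ F) (hg : {i, j, l} ∈ F) (hij : i ≠ j)
    (hki : k ≠ i) (hkj : k ≠ j) (hli : l ≠ i) (hlj : l ≠ j) (hkl : k ≠ l) :
    Sep w w {i, j, k} {i, j, l} {i, j} := by
  have key := ori_neg_of_inter_pair hw hF hf hg hij hki hkj hli hlj hkl
  have hlin : ∀ v x y : Plane, cr v (x - y) = cr v x - cr v y := fun v x y => (crL v).map_sub x y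
  have hz : cr (w j - w i) (w j) = cr (w j - w i) (w i) := by simp [cr]; ring
  rcases lt_or_ge 0 (ori (w i) (w j) (w k)) with h | h
  · have h2 : ori (w i) (w j) (w l) < 0 := by
      by_contra h3; exact absurd key (not_lt.2 (mul_nonneg h.le (not_lt.1 h3)))
    rw [ori, hlin] at h h2
    refine ⟨crL (w j - w i), cr (w j - w i) (w i), ?_, ?_, ?_⟩
    · intro x hx hxK
      simp only [Finset.mem_insert, Finset.mem_singleton, mem_insert_iff, mem_singleton_iff] at hx hxK
      rcases hx with rfl | rfl | rfl
      · simp at hxK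
      · simp at hxK
      · simp; linarith
    · intro x hx hxK
      simp only [Finset.mem_insert, Finset.mem_singleton, mem_insert_iff, mem_singleton_iff] at hx hxK
      rcases hx with rfl | rfl | rfl
      · simp at hxK
      · simp at hxK
      · simp; linarith
    · rintro x (rfl | rfl) <;> simp [hz]
  · have h2 : 0 < ori (w i) (w j) (w l) := by
      by_contra h3; exact absurd key (not_lt.2 (mul_nonneg_of_nonpos_of_nonpos h (not_lt.1 h3)))
    have h : ori (w i) (w j) (w k) < 0 := by
      rcases h.lt_or_eq with h | h
      · exact h
      · rw [h, zero_mul] at key; exact absurd key (lt_irrefl _)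
    rw [ori, hlin] at h h2
    refine ⟨-crL (w j - w i), -cr (w j - w i) (w i), ?_, ?_, ?_⟩
    · intro x hx hxK
      simp only [Finset.mem_insert, Finset.mem_singleton, mem_insert_iff, mem_singleton_iff] at hx hxK
      rcases hx with rfl | rfl | rfl
      · simp at hxK
      · simp at hxK
      · simp; linarith
    · intro x hx hxK
      simp only [Finset.mem_insert, Finset.mem_singleton, mem_insert_iff, mem_singleton_iff] at hx hxK
      rcases hx with rfl | rfl | rfl
      · simp at hxK
      · simp at hxK
      · simp; linarith
    · rintro x (rfl | rfl) <;> simp [hz]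

lemma inter_pair_of_ne {f g : Finset V} (hf : f.card = 3) (hg : g.card = 3) (hfg : f ≠ g) {i j : V}
    (hij : i ≠ j) (hif : i ∈ f) (hjf : j ∈ f) (hig : i ∈ g) (hjg : j ∈ g) :
    ∃ k l, k ≠ i ∧ k ≠ j ∧ l ≠ i ∧ l ≠ j ∧ k ≠ l ∧ f = {i, j, k} ∧ g = {i, j, l} ∧
      f ∩ g = {i, j} := by
  obtain ⟨k, hki, hkj, rfl⟩ := exists_third hf hif hjf hij
  obtain ⟨l, hli, hlj, rfl⟩ := exists_third hg hig hjg hij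
  have hkl : k ≠ l := fun h => hfg (by rw [h])
  refine ⟨k, l, hki, hkj, hli, hlj, hkl, rfl, rfl, ?_⟩
  ext x; simp only [Finset.mem_inter, Finset.mem_insert, Finset.mem_singleton]
  constructor
  · rintro ⟨rfl | rfl | rfl, h⟩
    · simp
    · simp
    · rcases h with rfl | rfl | rfl <;> simp_all
  · rintro (rfl | rfl) <;> simp

/-- Two faces of a plane drawing are separated by a line that contains no corners but their common
ones. -/
lemma sep_faces (hw : IsPlaneDrawing G w) (hF : emptyTriangles G w = F)
    {f g : Finset V} (hf : f ∈ F) (hg : g ∈ F) (hfg : f ≠ g) :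
    Sep w w f g {x | x ∈ f ∧ x ∈ g} := by
  have hset : {x | x ∈ f ∧ x ∈ g} = ((f ∩ g : Finset V) : Set V) := by ext; simp
  rw [hset]
  rcases (f ∩ g).eq_empty_or_nonempty with h | ⟨i, hi⟩
  · rw [h]; simpa using sep_of_disjoint hw hF hf hg h
  · by_cases h1 : ∃ j ∈ f ∩ g, j ≠ i
    · obtain ⟨j, hj, hji⟩ := h1
      rw [Finset.mem_inter] at hi hj
      obtain ⟨k, l, h1, h2, h3, h4, h5, h6, h7, h8⟩ := inter_pair_of_ne (face_card hF hf)
        (face_card hF hg) hfg hji.symm hi.1 hj.1 hi.2 hj.2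
      rw [h8]
      subst h6 h7
      simpa using sep_of_inter_pair hw hF hf hg hji.symm h1 h2 h3 h4 h5
    · have h2 : f ∩ g = {i} := by
        ext x
        simp only [Finset.mem_singleton]
        constructor
        · intro hx; by_contra h; exact h1 ⟨x, hx, h⟩
        · rintro rfl; exact hi
      rw [h2]; simpa using sep_of_inter_singleton hw hF hf hg h2

/-- An edge of a plane drawing is in at most two faces. -/
lemma not_three_faces (hw : IsPlaneDrawing G w) (hF : emptyTriangles G w = F)
    {f g h : Finset V} (hf : f ∈ F) (hg : g ∈ F) (hh : h ∈ F) (hfg : f ≠ g) (hfh : f ≠ h)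
    (hgh : g ≠ h) {i j : V} (hij : i ≠ j) (hif : i ∈ f) (hjf : j ∈ f) (hig : i ∈ g) (hjg : j ∈ g)
    (hih : i ∈ h) (hjh : j ∈ h) : False := by
  obtain ⟨k, hki, hkj, rfl⟩ := exists_third (face_card hF hf) hif hjf hij
  obtain ⟨l, hli, hlj, rfl⟩ := exists_third (face_card hF hg) hig hjg hij
  obtain ⟨m, hmi, hmj, rfl⟩ := exists_third (face_card hF hh) hih hjh hij
  have h1 := ori_neg_of_inter_pair hw hF hf hg hij hki hkj hli hlj (by rintro rfl; simp at hfg)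
  have h2 := ori_neg_of_inter_pair hw hF hf hh hij hki hkj hmi hmj (by rintro rfl; simp at hfh)
  have h3 := ori_neg_of_inter_pair hw hF hg hh hij hli hlj hmi hmj (by rintro rfl; simp at hgh)
  -- Three third corners cannot be pairwise on opposite sides of one line: the product of the three
  -- negative numbers is a square.
  nlinarith [mul_pos_of_neg_of_neg h1 h2, mul_self_nonneg (ori (w i) (w j) (w k))]

end faces

/-! ### Angles, cones and arcs of cones -/

/-- The unit vector at angle `θ`. -/
noncomputable def dirv (θ : ℝ) : Plane := !₂[Real.cos θ, Real.sin θ]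

@[simp] lemma dirv_zero (θ : ℝ) : dirv θ 0 = Real.cos θ := by simp [dirv]
@[simp] lemma dirv_one (θ : ℝ) : dirv θ 1 = Real.sin θ := by simp [dirv]

lemma cr_dirv (θ φ : ℝ) : cr (dirv θ) (dirv φ) = Real.sin (φ - θ) := by
  simp [cr, Real.sin_sub]; ring

lemma cr_smul_left (r : ℝ) (x y : Plane) : cr (r • x) y = r * cr x y := by simp [cr]; ring
lemma cr_smul_right (r : ℝ) (x y : Plane) : cr x (r • y) = r * cr x y := by simp [cr]; ring

lemma dirv_add_two_pi (θ : ℝ) (k : ℤ) : dirv (θ + 2 * Real.pi * k) = dirv θ := by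
  have : θ + 2 * Real.pi * k = θ + k * (2 * Real.pi) := by ring
  apply plane_ext <;> simp [this]

lemma dirv_add_pi (θ : ℝ) : dirv (θ + Real.pi) = -dirv θ := by
  apply plane_ext <;> simp

lemma exists_polar {x : Plane} (hx : x ≠ 0) : ∃ r : ℝ, 0 < r ∧ ∃ θ, x = r • dirv θ := by
  set z : ℂ := ⟨x 0, x 1⟩ with hz
  have hz0 : z ≠ 0 := fun h => hx (plane_ext (by simpa [hz] using congrArg Complex.re h)
    (by simpa [hz] using congrArg Complex.im h))
  refine ⟨‖z‖, norm_pos_iff.2 hz0, z.arg, plane_ext ?_ ?_⟩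
  · simp [hz]
  · simp [hz]

lemma exists_int_of_smul_dirv_eq {r s α β : ℝ} (hr : 0 < r) (hs : 0 < s)
    (h : r • dirv α = s • dirv β) : ∃ k : ℤ, α = β + 2 * Real.pi * k := by
  have h0 := congrArg (fun x : Plane => x 0) h
  have h1 := congrArg (fun x : Plane => x 1) h
  simp at h0 h1
  have hrs : r ^ 2 = s ^ 2 := by
    have e1 := Real.sin_sq_add_cos_sq α
    have e2 := Real.sin_sq_add_cos_sq β
    calc r ^ 2 = (r * Real.cos α) ^ 2 + (r * Real.sin α) ^ 2 := by linear_combination -r ^ 2 * e1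
      _ = s ^ 2 := by rw [h0, h1]; linear_combination s ^ 2 * e2
  have hrs' : r = s := by
    rcases pow_eq_pow_iff_of_ne_zero (two_ne_zero) |>.1 hrs with h | ⟨h, -⟩
    · exact h
    · linarith
  subst hrs'
  have c := mul_left_cancel₀ hr.ne' h0
  have s' := mul_left_cancel₀ hr.ne' h1
  obtain ⟨k, hk⟩ := Real.Angle.angle_eq_iff_two_pi_dvd_sub.1 (Real.Angle.cos_sin_inj c s')
  exact ⟨k, by linarith⟩

/-- `α` and `β` are angles of the vectors `x` and `y`, and `y` is to the left of `x`. -/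
def IsLift (x y : Plane) (α β : ℝ) : Prop :=
  α < β ∧ β < α + Real.pi ∧ (∃ r : ℝ, 0 < r ∧ x = r • dirv α) ∧ ∃ r : ℝ, 0 < r ∧ y = r • dirv β

lemma IsLift.shift {x y : Plane} {α β : ℝ} (h : IsLift x y α β) (k : ℤ) :
    IsLift x y (α + 2 * Real.pi * k) (β + 2 * Real.pi * k) := by
  obtain ⟨h1, h2, ⟨r, hr, h3⟩, s, hs, h4⟩ := h
  exact ⟨by linarith, by linarith, ⟨r, hr, by rw [dirv_add_two_pi, h3]⟩,
    s, hs, by rw [dirv_add_two_pi, h4]⟩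

/-- `α` is taken in the prescribed turn and `β` in the turn that starts at `α`. Positivity of the
cross product is positivity of `sin (β - α)`, which excludes `β = α` and `β ≥ α + π`. -/
lemma exists_lift_ge {x y : Plane} (h : 0 < cr x y) (κ : ℝ) :
    ∃ α β, IsLift x y α β ∧ κ ≤ α ∧ α < κ + 2 * Real.pi := by
  have hx : x ≠ 0 := by rintro rfl; simp [cr] at h
  have hy : y ≠ 0 := by rintro rfl; simp [cr] at h
  obtain ⟨r, hr, α, rfl⟩ := exists_polar hx
  obtain ⟨s, hs, β, rfl⟩ := exists_polar hy
  have key : ∀ κ θ : ℝ, ∃ k : ℤ, κ ≤ θ + 2 * Real.pi * k ∧ θ + 2 * Real.pi * k < κ + 2 * Real.pi := by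
    intro κ θ
    obtain ⟨k, hk, -⟩ := existsUnique_add_zsmul_mem_Ico Real.two_pi_pos θ κ
    rw [zsmul_eq_mul, mul_comm (k : ℝ)] at hk
    exact ⟨k, hk.1, hk.2⟩
  obtain ⟨k, hk1, hk2⟩ := key κ α
  obtain ⟨l, hl1, hl2⟩ := key (α + 2 * Real.pi * k) β
  rw [← dirv_add_two_pi α k, ← dirv_add_two_pi β l] at *
  set α' := α + 2 * Real.pi * k
  set β' := β + 2 * Real.pi * l
  rw [cr_smul_left, cr_smul_right, cr_dirv] at h
  have hsin : 0 < Real.sin (β' - α') := by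
    have h := pos_of_mul_pos_right h hr.le
    exact pos_of_mul_pos_right h hs.le
  have h1 : β' < α' + Real.pi := by
    by_contra hc
    have : Real.sin (β' - α' - Real.pi) = -Real.sin (β' - α') := Real.sin_sub_pi _
    have := Real.sin_nonneg_of_nonneg_of_le_pi (x := β' - α' - Real.pi) (by linarith) (by linarith)
    linarith
  have h2 : α' < β' := by
    refine lt_of_le_of_ne hl1 fun h => ?_
    rw [h, sub_self, Real.sin_zero] at hsin
    exact lt_irrefl _ hsin
  exact ⟨α', β', ⟨h2, h1, ⟨r, hr, rfl⟩, s, hs, rfl⟩, hk1, hk2⟩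

/-- `x` is in the open cone between `a` and `b`. -/
def InCone (a b x : Plane) : Prop := 0 < cr a x ∧ 0 < cr x b

lemma IsLift.inCone {x y : Plane} {α β θ : ℝ} (h : IsLift x y α β) (h1 : α < θ) (h2 : θ < β) :
    InCone x y (dirv θ) := by
  obtain ⟨h3, h4, ⟨r, hr, rfl⟩, s, hs, rfl⟩ := h
  rw [InCone, cr_smul_left, cr_smul_right, cr_dirv, cr_dirv]
  exact ⟨mul_pos hr (Real.sin_pos_of_pos_of_lt_pi (by linarith) (by linarith)),
    mul_pos hs (Real.sin_pos_of_pos_of_lt_pi (by linarith) (by linarith))⟩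

/-- For `α ≤ θ ≤ β < α + π` all three sines are nonnegative, so this presents the direction `θ` as
an element of the cone between the directions `α` and `β`. -/
lemma lift_identity (α β θ : ℝ) : Real.sin (β - α) • dirv θ =
    Real.sin (β - θ) • dirv α + Real.sin (θ - α) • dirv β := by
  apply plane_ext <;> simp only [PiLp.add_apply, PiLp.smul_apply, smul_eq_mul, dirv_zero,
    dirv_one, Real.sin_sub]
  · ring
  · ring

lemma IsLift.map_nonneg {x y : Plane} {α β θ : ℝ} (h : IsLift x y α β) (h1 : α ≤ θ) (h2 : θ ≤ β)
    {u : Plane →L[ℝ] ℝ} (hx : 0 ≤ u x) (hy : 0 ≤ u y) : 0 ≤ u (dirv θ) := by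
  obtain ⟨h3, h4, ⟨r, hr, rfl⟩, s, hs, rfl⟩ := h
  have hs' := Real.sin_pos_of_pos_of_lt_pi (x := β - α) (by linarith) (by linarith)
  have e := congrArg u (lift_identity α β θ)
  simp only [map_add, map_smul, smul_eq_mul] at e hx hy
  have hx' := nonneg_of_mul_nonneg_right hx hr
  have hy' := nonneg_of_mul_nonneg_right hy hs
  have s1 := Real.sin_nonneg_of_nonneg_of_le_pi (x := β - θ) (by linarith) (by linarith)
  have s2 := Real.sin_nonneg_of_nonneg_of_le_pi (x := θ - α) (by linarith) (by linarith)
  have : 0 ≤ Real.sin (β - α) * u (dirv θ) := by rw [e]; positivity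
  exact nonneg_of_mul_nonneg_right this hs'

section arcs
variable {ι : Type} {a b : ι → Plane}

/-- If the intervals overlapped, an angle interior to both would give a direction in both open
cones. -/
lemma lifts_disjoint (hdisj : ∀ f g, f ≠ g → ∀ x, InCone (a f) (b f) x → ¬ InCone (a g) (b g) x)
    {f g : ι} (hfg : f ≠ g) {α β α' β' : ℝ} (hf : IsLift (a f) (b f) α β)
    (hg : IsLift (a g) (b g) α' β') : β ≤ α' ∨ β' ≤ α := by
  by_contra! h
  have h1 : max α α' < min β β' := max_lt (lt_min hf.1 h.2) (lt_min h.1 hg.1)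
  obtain ⟨θ, h2, h3⟩ := exists_between h1
  rw [max_lt_iff] at h2
  rw [lt_min_iff] at h3
  exact hdisj f g hfg _ (hf.inCone h2.1 h3.1) (hg.inCone h2.2 h3.2)

/-- The cones of the family `C` fill the arc from `θ₁` to `θ₂`. -/
def IsArc (a b : ι → Plane) (C : Set ι) (θ₁ θ₂ : ℝ) : Prop :=
  C.Nonempty ∧ ∃ α β : ι → ℝ, (∀ f ∈ C, IsLift (a f) (b f) (α f) (β f)) ∧
    ⋃ f ∈ C, Icc (α f) (β f) = Icc θ₁ θ₂

/-- The cone `o` outside the family serves to cut the circle open. All angles of the family then fit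
between the end of `o` and its beginning one turn later, so neighbouring cones have intervals with a
common end point, and not only up to a full turn. The union of the intervals is connected and
compact, hence an interval. -/
lemma exists_arc [Finite ι] (hpos : ∀ f, 0 < cr (a f) (b f))
    (hdisj : ∀ f g, f ≠ g → ∀ x, InCone (a f) (b f) x → ¬ InCone (a g) (b g) x)
    {R : ι → ι → Prop} (hR : ∀ f g, R f g → a f = b g ∨ b f = a g) {C : Set ι}
    (hne : C.Nonempty)
    (hC : ∀ f ∈ C, ∀ g ∈ C, Relation.ReflTransGen (fun x y => R x y ∧ x ∈ C ∧ y ∈ C) f g)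
    {o : ι} (ho : o ∉ C) : ∃ θ₁ θ₂, IsArc a b C θ₁ θ₂ := by
  obtain ⟨κ, κ', hκ, -, -⟩ := exists_lift_ge (hpos o) 0
  choose α β hl hge hlt using fun f => exists_lift_ge (hpos f) κ
  have hκα : ∀ f ∈ C, κ' ≤ α f ∧ β f ≤ κ + 2 * Real.pi := by
    intro f hf
    have hfo : f ≠ o := fun h => ho (h ▸ hf)
    constructor
    · rcases lifts_disjoint hdisj hfo (hl f) hκ with h | h
      · linarith [hge f, (hl f).1]
      · exact h
    · have hs := hκ.shift 1
      rw [Int.cast_one, mul_one] at hs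
      rcases lifts_disjoint hdisj hfo (hl f) hs with h | h
      · exact h
      · linarith [hlt f, hs.1]
  -- Equal vectors have angles that differ by `2πk`. Both angles are in a window shorter than a full
  -- turn, because the cone `o` is missing from it, so `k = 0`.
  have hends : ∀ f ∈ C, ∀ g ∈ C, b f = a g → β f = α g := by
    intro f hf g hg h
    obtain ⟨-, -, -, r, hr, h1⟩ := hl f
    obtain ⟨-, -, ⟨s, hs, h2⟩, -⟩ := hl g
    rw [h1, h2] at h
    obtain ⟨k, hk⟩ := exists_int_of_smul_dirv_eq hr hs h
    have hκ' := hκ.1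
    have h3 := hκα f hf
    have h4 := hκα g hg
    have h5 := (hl f).1
    have h6 := hge f
    have h7 := hlt g
    have hpi := Real.two_pi_pos
    have hk1 : (k : ℝ) < 1 := by
      by_contra hc
      have : 2 * Real.pi * 1 ≤ 2 * Real.pi * k := mul_le_mul_of_nonneg_left (not_lt.1 hc) hpi.le
      linarith
    have hk2 : (-1 : ℝ) < k := by
      by_contra hc
      have : 2 * Real.pi * k ≤ 2 * Real.pi * (-1) := mul_le_mul_of_nonneg_left (not_lt.1 hc) hpi.le
      linarith
    have : k = 0 := by
      have h8 : k < 1 := by exact_mod_cast hk1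
      have h9 : -1 < k := by exact_mod_cast hk2
      omega
    rw [this] at hk; simpa using hk
  have hconn : IsConnected (⋃ f ∈ C, Icc (α f) (β f)) := by
    refine IsConnected.biUnion_of_reflTransGen hne (fun f _ => isConnected_Icc (hl f).1.le) ?_
    intro f hf g hg
    refine Relation.ReflTransGen.mono ?_ _ _ (hC f hf g hg)
    rintro x y ⟨h, hx, hy⟩
    refine ⟨?_, hx⟩
    rcases hR x y h with h | h
    · have := hends y hy x hx h.symm
      exact ⟨α x, ⟨le_rfl, (hl x).1.le⟩, this ▸ (hl y).1.le, this.ge⟩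
    · have := hends x hx y hy h
      exact ⟨β x, ⟨(hl x).1.le, le_rfl⟩, this.ge, this ▸ (hl y).1.le⟩
  have hcomp : IsCompact (⋃ f ∈ C, Icc (α f) (β f)) :=
    (Set.toFinite C).isCompact_biUnion fun f _ => isCompact_Icc
  exact ⟨_, _, hne, α, β, fun f _ => hl f, eq_Icc_of_connected_compact hconn hcomp⟩

lemma IsArc.lt {C : Set ι} {θ₁ θ₂ : ℝ} (h : IsArc a b C θ₁ θ₂) : θ₁ < θ₂ := by
  obtain ⟨⟨f, hf⟩, α, β, h1, h2⟩ := h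
  have hsub : Icc (α f) (β f) ⊆ Icc θ₁ θ₂ := by
    rw [← h2]; exact subset_biUnion_of_mem (u := fun f => Icc (α f) (β f)) hf
  have h3 := hsub ⟨le_rfl, (h1 f hf).1.le⟩
  have h4 := hsub ⟨(h1 f hf).1.le, le_rfl⟩
  exact (h3.1.trans_lt (h1 f hf).1).trans_le h4.2

lemma IsArc.shift {C : Set ι} {θ₁ θ₂ : ℝ} (h : IsArc a b C θ₁ θ₂) (k : ℤ) :
    IsArc a b C (θ₁ + 2 * Real.pi * k) (θ₂ + 2 * Real.pi * k) := by
  obtain ⟨h0, α, β, h1, h2⟩ := h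
  refine ⟨h0, fun f => α f + 2 * Real.pi * k, fun f => β f + 2 * Real.pi * k,
    fun f hf => (h1 f hf).shift k, ?_⟩
  ext θ
  have := Set.ext_iff.1 h2 (θ - 2 * Real.pi * k)
  simp only [mem_iUnion, mem_Icc, exists_prop] at this ⊢
  constructor
  · rintro ⟨f, hf, h3, h4⟩
    have := this.1 ⟨f, hf, by linarith, by linarith⟩
    exact ⟨by linarith, by linarith⟩
  · rintro ⟨h3, h4⟩
    obtain ⟨f, hf, h5, h6⟩ := this.2 ⟨by linarith, by linarith⟩
    exact ⟨f, hf, by linarith, by linarith⟩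

lemma IsArc.singleton {C : Set ι} {θ₁ θ₂ : ℝ} (h : IsArc a b C θ₁ θ₂) {f : ι} (hf : f ∈ C) :
    ∃ α β, θ₁ ≤ α ∧ β ≤ θ₂ ∧ β - α ≤ Real.pi ∧ IsArc a b {f} α β := by
  obtain ⟨-, α, β, h1, h2⟩ := h
  have hsub : Icc (α f) (β f) ⊆ Icc θ₁ θ₂ := by
    rw [← h2]; exact subset_biUnion_of_mem (u := fun f => Icc (α f) (β f)) hf
  have h3 := hsub ⟨le_rfl, (h1 f hf).1.le⟩
  have h4 := hsub ⟨(h1 f hf).1.le, le_rfl⟩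
  refine ⟨α f, β f, h3.1, h4.2, by linarith [(h1 f hf).2.1], singleton_nonempty f, α, β, ?_, ?_⟩
  · rintro g rfl; exact h1 g hf
  · simp

/-- An overlap of positive length contains an angle that is not an end of any of the finitely many
intervals. It is interior to a cone of each family, and these two cones are different. -/
lemma arcs_disjoint [Finite ι]
    (hdisj : ∀ f g, f ≠ g → ∀ x, InCone (a f) (b f) x → ¬ InCone (a g) (b g) x)
    {C D : Set ι} (hCD : Disjoint C D) {θ₁ θ₂ φ₁ φ₂ : ℝ} (hC : IsArc a b C θ₁ θ₂)
    (hD : IsArc a b D φ₁ φ₂) : θ₂ ≤ φ₁ ∨ φ₂ ≤ θ₁ := by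
  by_contra! h
  have h1 : max θ₁ φ₁ < min θ₂ φ₂ := max_lt (lt_min hC.lt h.2) (lt_min h.1 hD.lt)
  obtain ⟨-, α, β, h2, h3⟩ := hC
  obtain ⟨-, α', β', h4, h5⟩ := hD
  have hfin : (range α ∪ range β ∪ range α' ∪ range β').Finite :=
    (((finite_range _).union (finite_range _)).union (finite_range _)).union (finite_range _)
  obtain ⟨θ, ⟨h6, h7⟩, h8⟩ := ((Ioo_infinite h1).sdiff hfin).nonempty
  simp only [mem_union, mem_range, not_or, not_exists] at h8
  obtain ⟨⟨⟨n1, n2⟩, n3⟩, n4⟩ := h8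
  rw [max_lt_iff] at h6
  rw [lt_min_iff] at h7
  have m1 : θ ∈ ⋃ f ∈ C, Icc (α f) (β f) := by rw [h3]; exact ⟨h6.1.le, h7.1.le⟩
  have m2 : θ ∈ ⋃ f ∈ D, Icc (α' f) (β' f) := by rw [h5]; exact ⟨h6.2.le, h7.2.le⟩
  simp only [mem_iUnion, mem_Icc, exists_prop] at m1 m2
  obtain ⟨f, hf, l1, l2⟩ := m1
  obtain ⟨g, hg, l3, l4⟩ := m2
  refine hdisj f g (fun h => Set.disjoint_left.1 hCD hf (h ▸ hg)) (dirv θ)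
    ((h2 f hf).inCone (lt_of_le_of_ne l1 (n1 f)) (lt_of_le_of_ne l2 (Ne.symm (n2 f))))
    ((h4 g hg).inCone (lt_of_le_of_ne l3 (n3 g)) (lt_of_le_of_ne l4 (Ne.symm (n4 g))))

/-- The family `C` is in the closed half-plane `0 ≤ u`. -/
def InHalf (a b : ι → Plane) (C : Set ι) (u : Plane →L[ℝ] ℝ) : Prop :=
  u ≠ 0 ∧ ∀ f ∈ C, 0 ≤ u (a f) ∧ 0 ≤ u (b f)

lemma eq_zero_of_dirv {u : Plane →L[ℝ] ℝ} {θ φ : ℝ} (h : 0 < Real.sin (φ - θ))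
    (h1 : u (dirv θ) = 0) (h2 : u (dirv φ) = 0) : u = 0 := by
  ext x
  have key : Real.sin (φ - θ) • x = cr x (dirv φ) • dirv θ + cr (dirv θ) x • dirv φ := by
    apply plane_ext <;> simp [cr, Real.sin_sub] <;> ring
  have := congrArg u key
  simp only [map_add, map_smul, h1, h2, smul_eq_mul, mul_zero, add_zero] at this
  simpa [h.ne'] using this

/-- On an arc longer than `π` the functional would be nonnegative at opposite directions and hence
zero at them. This happens for a whole interval of directions, so the functional would vanish. -/
lemma IsArc.length_le {C : Set ι} {θ₁ θ₂ : ℝ} (h : IsArc a b C θ₁ θ₂) {u : Plane →L[ℝ] ℝ}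
    (hu : InHalf a b C u) : θ₂ - θ₁ ≤ Real.pi := by
  obtain ⟨-, α, β, h2, h3⟩ := h
  have key : ∀ θ, θ₁ ≤ θ → θ ≤ θ₂ → 0 ≤ u (dirv θ) := by
    intro θ l1 l2
    have m1 : θ ∈ ⋃ f ∈ C, Icc (α f) (β f) := by rw [h3]; exact ⟨l1, l2⟩
    simp only [mem_iUnion, mem_Icc, exists_prop] at m1
    obtain ⟨f, hf, l1, l2⟩ := m1
    exact (h2 f hf).map_nonneg l1 l2 (hu.2 f hf).1 (hu.2 f hf).2
  by_contra! hc
  have hpi := Real.pi_pos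
  have z : ∀ θ, θ₁ ≤ θ → θ + Real.pi ≤ θ₂ → u (dirv θ) = 0 := by
    intro θ l1 l2
    have e1 := key θ l1 (by linarith)
    have e2 := key (θ + Real.pi) (by linarith) l2
    rw [dirv_add_pi, map_neg] at e2
    linarith
  -- Two directions at distance `ε`, both with their opposites in the arc; `ε ≤ π / 2` makes them
  -- independent.
  set ε := min (θ₂ - θ₁ - Real.pi) (Real.pi / 2)
  have h5 : 0 < ε := lt_min (by linarith) (by linarith)
  have h6 : ε ≤ θ₂ - θ₁ - Real.pi := min_le_left _ _
  have h7 : ε ≤ Real.pi / 2 := min_le_right _ _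
  refine hu.1 (eq_zero_of_dirv (θ := θ₁) (φ := θ₁ + ε) ?_ (z _ le_rfl (by linarith))
    (z _ (by linarith) (by linarith)))
  rw [add_sub_cancel_left]
  exact Real.sin_pos_of_pos_of_lt_pi h5 (by linarith)

lemma IsArc.map_nonneg {C : Set ι} {θ₁ θ₂ φ : ℝ} (h : IsArc a b C θ₁ θ₂) (h1 : φ ≤ θ₁)
    (h2 : θ₂ ≤ φ + Real.pi) : ∀ f ∈ C, 0 ≤ crL (dirv φ) (a f) ∧ 0 ≤ crL (dirv φ) (b f) := by
  obtain ⟨-, α, β, h3, h4⟩ := h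
  intro f hf
  have hsub : Icc (α f) (β f) ⊆ Icc θ₁ θ₂ := by
    rw [← h4]; exact subset_biUnion_of_mem (u := fun f => Icc (α f) (β f)) hf
  have h5 := hsub ⟨le_rfl, (h3 f hf).1.le⟩
  have h6 := hsub ⟨(h3 f hf).1.le, le_rfl⟩
  have h7 := (h3 f hf).1
  obtain ⟨-, -, ⟨r, hr, e1⟩, s, hs, e2⟩ := h3 f hf
  rw [crL_apply, crL_apply, e1, e2, cr_smul_right, cr_smul_right, cr_dirv, cr_dirv]
  constructor
  · exact mul_nonneg hr.le (Real.sin_nonneg_of_nonneg_of_le_pi (by linarith [h5.1]) (by linarith [h6.2]))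
  · exact mul_nonneg hs.le (Real.sin_nonneg_of_nonneg_of_le_pi (by linarith [h5.1]) (by linarith [h6.2]))

lemma crL_dirv_ne_zero (φ : ℝ) : crL (dirv φ) ≠ 0 := by
  intro h
  have := congrArg (fun u : Plane →L[ℝ] ℝ => u (dirv (φ + Real.pi / 2))) h
  simp [cr_dirv] at this

/-- The line through the origin with direction `φ` works if `[φ, φ + π]` contains the first arc and
`[φ + π, φ + 2π]` the second one. The maximum below is the least `φ` that reaches the ends of both
arcs, and the hypotheses say that it is not beyond their beginnings. -/
lemma separate_arcs {C D : Set ι} {θ₁ θ₂ φ₁ φ₂ : ℝ} (hC : IsArc a b C θ₁ θ₂)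
    (hD : IsArc a b D φ₁ φ₂) (h1 : θ₂ - θ₁ ≤ Real.pi) (h2 : φ₂ - φ₁ ≤ Real.pi) (h3 : θ₂ ≤ φ₁)
    (h4 : φ₂ ≤ θ₁ + 2 * Real.pi) : ∃ u, InHalf a b C u ∧ InHalf a b D (-u) := by
  set φ := max (θ₂ - Real.pi) (φ₂ - 2 * Real.pi) with hφ
  have l1 : θ₂ - Real.pi ≤ φ := le_max_left _ _
  have l2 : φ₂ - 2 * Real.pi ≤ φ := le_max_right _ _
  have l3 : φ ≤ θ₁ := max_le (by linarith) (by linarith)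
  have l4 : φ + Real.pi ≤ φ₁ := by
    have : φ ≤ φ₁ - Real.pi := max_le (by linarith) (by linarith)
    linarith
  have e : crL (dirv (φ + Real.pi)) = -crL (dirv φ) := by
    ext x
    rw [dirv_add_pi]
    simp [cr]; ring
  refine ⟨crL (dirv φ), ⟨crL_dirv_ne_zero φ, hC.map_nonneg l3 (by linarith)⟩,
    neg_ne_zero.2 (crL_dirv_ne_zero φ), ?_⟩
  rw [← e]
  exact hD.map_nonneg l4 (by linarith)

open Classical in
/-- A vector that points into the family `C` if `C` is in a half-plane, and `0` otherwise. -/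
noncomputable def inward [Fintype ι] (a b : ι → Plane) (C : Set ι) : Plane :=
  if ∃ u, InHalf a b C u then ∑ f ∈ {f | f ∈ C}, (a f + b f) else 0

lemma eq_zero_of_cr_pos {x y : Plane} (h : 0 < cr x y) {u : Plane →L[ℝ] ℝ} (hx : u x = 0)
    (hy : u y = 0) : u = 0 := by
  ext z
  have key : cr x y • z = cr z y • x + cr x z • y := by
    apply plane_ext <;> simp [cr] <;> ring
  have := congrArg u key
  simp only [map_add, map_smul, hx, hy, smul_eq_mul, mul_zero, add_zero] at this
  simpa [h.ne'] using this

/-- All summands of `inward` have nonnegative values, and a nonzero functional cannot vanish on both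
sides of a cone. -/
lemma InHalf.map_inward_pos [Fintype ι] (hpos : ∀ f, 0 < cr (a f) (b f)) {C : Set ι}
    (hne : C.Nonempty) {u : Plane →L[ℝ] ℝ} (hu : InHalf a b C u) : 0 < u (inward a b C) := by
  classical
  rw [inward, if_pos ⟨u, hu⟩, map_sum]
  obtain ⟨f, hf⟩ := hne
  refine Finset.sum_pos' (fun g hg => ?_) ⟨f, by simpa using hf, ?_⟩
  · have := hu.2 g (by simpa using hg)
    rw [map_add]; linarith [this.1, this.2]
  · have h := hu.2 f hf
    rw [map_add]
    refine lt_of_le_of_ne (by linarith [h.1, h.2]) fun h0 => hu.1 ?_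
    exact eq_zero_of_cr_pos (hpos f) (by linarith [h.1, h.2]) (by linarith [h.1, h.2])

/-- Different arcs are pushed apart by their inward vectors. -/
lemma exists_separating_inward [Fintype ι] (hpos : ∀ f, 0 < cr (a f) (b f))
    (hdisj : ∀ f g, f ≠ g → ∀ x, InCone (a f) (b f) x → ¬ InCone (a g) (b g) x)
    {R : ι → ι → Prop} (hR : ∀ f g, R f g → a f = b g ∨ b f = a g) {C D : Set ι}
    (hC : ∀ f ∈ C, ∀ g ∈ C, Relation.ReflTransGen (fun x y => R x y ∧ x ∈ C ∧ y ∈ C) f g)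
    (hD : ∀ f ∈ D, ∀ g ∈ D, Relation.ReflTransGen (fun x y => R x y ∧ x ∈ D ∧ y ∈ D) f g)
    (hCD : Disjoint C D) {f g : ι} (hf : f ∈ C) (hg : g ∈ D) :
    ∃ u : Plane →L[ℝ] ℝ, u ≠ 0 ∧ (0 ≤ u (a f) ∧ 0 ≤ u (b f)) ∧ (u (a g) ≤ 0 ∧ u (b g) ≤ 0) ∧
      u (inward a b D) < u (inward a b C) := by
  obtain ⟨θ₁, θ₂, aC⟩ := exists_arc hpos hdisj hR ⟨f, hf⟩ hC (Set.disjoint_right.1 hCD hg)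
  obtain ⟨φ₁, φ₂, aD⟩ := exists_arc hpos hdisj hR ⟨g, hg⟩ hD (Set.disjoint_left.1 hCD hf)
  -- Turning the second arc by multiples of `2π` makes it follow the first one within a single turn.
  obtain ⟨φ₁, φ₂, aD, l1, l2⟩ : ∃ φ₁ φ₂, IsArc a b D φ₁ φ₂ ∧ θ₂ ≤ φ₁ ∧ φ₂ ≤ θ₁ + 2 * Real.pi := by
    obtain ⟨k, hk, -⟩ := existsUnique_add_zsmul_mem_Ico Real.two_pi_pos φ₁ θ₁
    rw [zsmul_eq_mul, mul_comm (k : ℝ)] at hk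
    refine ⟨_, _, aD.shift k, ?_, ?_⟩
    · rcases arcs_disjoint hdisj hCD aC (aD.shift k) with h | h
      · exact h
      · linarith [hk.1, (aD.shift k).lt]
    · have := aC.shift 1
      rw [Int.cast_one, mul_one] at this
      rcases arcs_disjoint hdisj hCD this (aD.shift k) with h | h
      · linarith [hk.2, aC.lt]
      · exact h
  have hlin : ∀ (E : Set ι) (ψ₁ ψ₂ : ℝ), IsArc a b E ψ₁ ψ₂ → ψ₂ - ψ₁ ≤ Real.pi →
      ∃ u, InHalf a b E u := fun E ψ₁ ψ₂ h h' =>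
    ⟨_, crL_dirv_ne_zero ψ₁, h.map_nonneg le_rfl (by linarith)⟩
  -- The two arcs share one turn, so at most one of them does not fit into a half-plane. That one
  -- has inward vector `0`, and it suffices to separate the other arc from the single cone in
  -- question, which has an angle of at most `π`.
  by_cases c1 : ∃ u, InHalf a b C u <;> by_cases c2 : ∃ u, InHalf a b D u
  · obtain ⟨u, h1, h2⟩ := separate_arcs aC aD (aC.length_le c1.choose_spec)
      (aD.length_le c2.choose_spec) l1 l2
    have p1 := h1.map_inward_pos hpos ⟨f, hf⟩
    have p2 := h2.map_inward_pos hpos ⟨g, hg⟩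
    have := h2.2 g hg
    simp only [neg_apply] at p2 this
    exact ⟨u, h1.1, h1.2 f hf, ⟨by linarith [this.1], by linarith [this.2]⟩, by linarith⟩
  · obtain ⟨α, β, l3, l4, l5, ag⟩ := aD.singleton hg
    obtain ⟨u, h1, h2⟩ := separate_arcs aC ag (aC.length_le c1.choose_spec) l5
      (by linarith) (by linarith)
    have p1 := h1.map_inward_pos hpos ⟨f, hf⟩
    have := h2.2 g rfl
    simp only [neg_apply] at this
    refine ⟨u, h1.1, h1.2 f hf, ⟨by linarith [this.1], by linarith [this.2]⟩, ?_⟩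
    rw [inward, if_neg c2, map_zero]; exact p1
  · obtain ⟨α, β, l3, l4, l5, af⟩ := aC.singleton hf
    obtain ⟨u, h1, h2⟩ := separate_arcs af aD l5 (aD.length_le c2.choose_spec)
      (by linarith) (by linarith)
    have p2 := h2.map_inward_pos hpos ⟨g, hg⟩
    have := h2.2 g hg
    simp only [neg_apply] at this p2
    refine ⟨u, h1.1, h1.2 f rfl, ⟨by linarith [this.1], by linarith [this.2]⟩, ?_⟩
    rw [inward, inward, if_neg c1, map_zero, ← inward]; linarith
  · exfalso
    have g1 : Real.pi < θ₂ - θ₁ := by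
      by_contra h; exact c1 (hlin _ _ _ aC (not_lt.1 h))
    have g2 : Real.pi < φ₂ - φ₁ := by
      by_contra h; exact c2 (hlin _ _ _ aD (not_lt.1 h))
    linarith

end arcs

/-! ### Components of the faces at a vertex -/

/-- The faces `f` and `g` are connected in the subgraph that `H` induces on the faces
containing `i`. -/
def Conn {V : Type} {F : Finset (Finset V)} (H : SimpleGraph {f // f ∈ F}) (i : V)
    (f g : {f // f ∈ F}) : Prop :=
  Relation.ReflTransGen (fun x y => H.Adj x y ∧ i ∈ x.1 ∧ i ∈ y.1) f g

section conn
variable {V : Type} {F : Finset (Finset V)} {H : SimpleGraph {f // f ∈ F}} {i : V}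
  {f g h : {f // f ∈ F}}

lemma Conn.refl (f : {f // f ∈ F}) : Conn H i f f := Relation.ReflTransGen.refl

lemma Conn.symm (h : Conn H i f g) : Conn H i g f := by
  have : Std.Symm fun x y : {f // f ∈ F} => H.Adj x y ∧ i ∈ x.1 ∧ i ∈ y.1 :=
    ⟨fun _ _ h => ⟨h.1.symm, h.2.2, h.2.1⟩⟩
  exact Relation.ReflTransGen.stdSymm.symm _ _ h

lemma Conn.trans (h1 : Conn H i f g) (h2 : Conn H i g h) : Conn H i f h :=
  Relation.ReflTransGen.trans h1 h2

lemma Conn.of_adj (h : H.Adj f g) (hf : i ∈ f.1) (hg : i ∈ g.1) : Conn H i f g :=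
  Relation.ReflTransGen.single ⟨h, hf, hg⟩

lemma Conn.mem (h : Conn H i f g) (hf : i ∈ f.1) : i ∈ g.1 := by
  induction h with
  | refl => exact hf
  | tail _ h _ => exact h.2.2

end conn

/-! ### Displacements that push faces apart -/

section perturb
variable {V : Type} [DecidableEq V] {G : SimpleGraph V} {w : V → Plane}
  {F : Finset (Finset V)} {H : SimpleGraph {f // f ∈ F}}

lemma exists_directed_corners (hw : IsPlaneDrawing G w) (hF : emptyTriangles G w = F) (i : V)
    (f : {f : {f // f ∈ F} // i ∈ f.1}) : ∃ j k, j ≠ i ∧ k ≠ i ∧ k ≠ j ∧ f.1.1 = {i, j, k} ∧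
      0 < cr (w j - w i) (w k - w i) := by
  obtain ⟨j, k, h1, h2, h3, h4⟩ := exists_triple (face_card hF f.1.2) f.2
  have ho := face_ori_ne_zero hw hF f.1.2 (i := i) (j := j) (k := k) f.2 (by simp [h4])
    (by simp [h4]) h1.symm h2.symm h3.symm
  rcases lt_or_gt_of_ne ho with h | h
  · refine ⟨k, j, h2, h1, h3.symm, by rw [h4]; ext; simp; tauto, ?_⟩
    rw [← neg_pos, ← ori_swap] at h
    exact h
  · exact ⟨j, k, h1, h2, h3, h4, h⟩

/-- There are displacements of the corners of the faces that push apart disconnected faces at each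
vertex. -/
lemma exists_displacement (hw : IsPlaneDrawing G w) (hF : emptyTriangles G w = F)
    (hH : ∀ f g, H.Adj f g → ∃ i j, i ≠ j ∧ i ∈ f.1 ∧ j ∈ f.1 ∧ i ∈ g.1 ∧ j ∈ g.1) :
    ∃ d : {f // f ∈ F} → V → Plane,
      (∀ i f g, i ∈ f.1 → i ∈ g.1 → Conn H i f g → d f i = d g i) ∧
      ∀ i f g, i ∈ f.1 → i ∈ g.1 → ¬ Conn H i f g → ∃ u : Plane →L[ℝ] ℝ, u ≠ 0 ∧
        (∀ x ∈ f.1, 0 ≤ u (w x - w i)) ∧ (∀ x ∈ g.1, u (w x - w i) ≤ 0) ∧ u (d g i) < u (d f i) := by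
  classical
  choose J K hJi hKi hKJ hset hcr using exists_directed_corners hw hF
  let a : ∀ i, {f : {f // f ∈ F} // i ∈ f.1} → Plane := fun i f => w (J i f) - w i
  let b : ∀ i, {f : {f // f ∈ F} // i ∈ f.1} → Plane := fun i f => w (K i f) - w i
  let comp : ∀ i, {f : {f // f ∈ F} // i ∈ f.1} → Set {f : {f // f ∈ F} // i ∈ f.1} :=
    fun i f => {g | Conn H i f.1 g.1}
  -- The displacement depends on the face only through its component at `i`, so connected faces move
  -- their corner together.
  refine ⟨fun f i => if h : i ∈ f.1 then inward (a i) (b i) (comp i ⟨f, h⟩) else 0, ?_, ?_⟩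
  · intro i f g hf hg h
    simp only [hf, hg, dif_pos]
    congr 1
    ext x
    exact ⟨fun h' => h.symm.trans h', fun h' => h.trans h'⟩
  · intro i f g hf hg hfg
    -- The line from `sep_faces` passes through `w i`. Its functional is nonnegative on the sides of
    -- one cone and nonpositive on those of the other, and it vanishes on both sides of neither
    -- cone. A common direction would have a positive and a negative value.
    have hdisj : ∀ f g, f ≠ g → ∀ x, InCone (a i f) (b i f) x → ¬ InCone (a i g) (b i g) x := by
      intro f g hfg x hx hx'
      obtain ⟨u, c, h1, h2, h3⟩ := sep_faces hw hF f.1.2 g.1.2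
        (fun h => hfg (Subtype.ext (Subtype.ext h)))
      have hc : u (w i) = c := (h3 i ⟨f.2, g.2⟩).1
      have key : ∀ f g : {f : {f // f ∈ F} // i ∈ f.1}, ∀ u : Plane →L[ℝ] ℝ, ∀ c,
          (∀ y ∈ f.1.1, y ∉ {x | x ∈ f.1.1 ∧ x ∈ g.1.1} → c < u (w y)) →
          (∀ y ∈ {x | x ∈ f.1.1 ∧ x ∈ g.1.1}, u (w y) = c) → u (w i) = c →
          0 ≤ u (a i f) ∧ 0 ≤ u (b i f) := by
        intro f g u c h1 h3 hc
        have hh : ∀ y ∈ f.1.1, c ≤ u (w y) := by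
          intro y hy
          by_cases hm : y ∈ {x | x ∈ f.1.1 ∧ x ∈ g.1.1}
          · exact (h3 y hm).ge
          · exact (h1 y hy hm).le
        simp only [a, b, map_sub, hc]
        exact ⟨sub_nonneg.2 (hh _ (by simp [hset i f])), sub_nonneg.2 (hh _ (by simp [hset i f]))⟩
      have hweak : ∀ f : {f : {f // f ∈ F} // i ∈ f.1}, ∀ u : Plane →L[ℝ] ℝ, 0 ≤ u (a i f) →
          0 ≤ u (b i f) → (u (a i f) ≠ 0 ∨ u (b i f) ≠ 0) → InCone (a i f) (b i f) x → 0 < u x := by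
        intro f u p1 p2 p3 hx
        have key : cr (a i f) (b i f) • x = cr x (b i f) • a i f + cr (a i f) x • b i f := by
          apply plane_ext <;> simp [cr] <;> ring
        have := congrArg u key
        simp only [map_add, map_smul, smul_eq_mul] at this
        have h2 : 0 < cr (a i f) (b i f) * u x := by
          rw [this]
          rcases p3 with h | h
          · have := mul_pos hx.2 (lt_of_le_of_ne p1 h.symm); have := mul_nonneg hx.1.le p2; linarith
          · have := mul_nonneg hx.2.le p1; have := mul_pos hx.1 (lt_of_le_of_ne p2 h.symm); linarith
        exact pos_of_mul_pos_right h2 (hcr i f).le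
      have hu0 : u ≠ 0 := by
        rintro rfl
        have : f.1.1 ⊆ g.1.1 := by
          intro y hy
          by_contra hyg
          have e1 := h1 y hy (fun h => hyg h.2)
          simp at hc e1
          linarith
        exact hfg (Subtype.ext (Subtype.ext (Finset.eq_of_subset_of_card_le this
          (by rw [face_card hF f.1.2, face_card hF g.1.2]))))
      have hnz : ∀ f : {f : {f // f ∈ F} // i ∈ f.1}, u (a i f) ≠ 0 ∨ u (b i f) ≠ 0 := by
        intro f
        by_contra! h
        exact hu0 (eq_zero_of_cr_pos (hcr i f) h.1 h.2)
      have p := key f g u c h1 (fun y hy => (h3 y hy).1) hc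
      have q := key g f (-u) (-c) (fun y hy hn => by
          have := h2 y hy (fun h => hn ⟨h.2, h.1⟩); simpa using this)
        (fun y hy => by have := (h3 y ⟨hy.2, hy.1⟩).1; simpa using this) (by simpa using hc)
      have r1 := hweak f u p.1 p.2 (hnz f) hx
      have r2 := hweak g (-u) q.1 q.2 (by simpa using hnz g) hx'
      simp only [neg_apply] at r2
      linarith
    -- Linked faces share a side at `i` and lie on opposite sides of it. With all corners in
    -- anticlockwise order, the first side of one face is the second side of the other.
    have hR : ∀ f g : {f : {f // f ∈ F} // i ∈ f.1}, H.Adj f.1 g.1 →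
        a i f = b i g ∨ b i f = a i g := by
      intro f g h
      have hne : f.1.1 ≠ g.1.1 := fun h' => h.ne (Subtype.ext h')
      obtain ⟨j, hji, hjf, hjg⟩ : ∃ j, j ≠ i ∧ j ∈ f.1.1 ∧ j ∈ g.1.1 := by
        obtain ⟨x, y, hxy, h1, h2, h3, h4⟩ := hH _ _ h
        by_cases hx : x = i
        · exact ⟨y, fun h => hxy (hx.trans h.symm), h2, h4⟩
        · exact ⟨x, hx, h1, h3⟩
      have hjf' := hjf
      have hjg' := hjg
      rw [hset i f] at hjf'
      rw [hset i g] at hjg'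
      simp only [Finset.mem_insert, Finset.mem_singleton, hji, false_or] at hjf' hjg'
      have hKeq : ∀ k l, f.1.1 = {i, j, k} → g.1.1 = {i, j, l} → k ≠ i → k ≠ j → l ≠ i → l ≠ j →
          ori (w i) (w j) (w k) * ori (w i) (w j) (w l) < 0 := by
        intro k l e1 e2 n1 n2 n3 n4
        refine ori_neg_of_inter_pair hw hF (e1 ▸ f.1.2) (e2 ▸ g.1.2) hji.symm n1 n2 n3 n4 ?_
        rintro rfl
        exact hne (e1.trans e2.symm)
      have hc1 := hcr i f
      have hc2 := hcr i g
      rcases hjf' with e1 | e1 <;> rcases hjg' with e2 | e2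
      · exfalso
        have := hKeq (K i f) (K i g) (by rw [hset i f, e1]) (by rw [hset i g, e2])
          (hKi i f) (e1 ▸ hKJ i f) (hKi i g) (e2 ▸ hKJ i g)
        rw [← e1] at hc1
        rw [← e2] at hc2
        exact absurd this (not_lt.2 (mul_pos hc1 hc2).le)
      · left; simp only [a, b, ← e1, ← e2]
      · right; simp only [a, b, ← e1, ← e2]
      · exfalso
        have := hKeq (J i f) (J i g) (by rw [hset i f, e1]; ext; simp; tauto)
          (by rw [hset i g, e2]; ext; simp; tauto)
          (hJi i f) (fun h => hKJ i f (by rw [← e1, h])) (hJi i g) (fun h => hKJ i g (by rw [← e2, h]))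
        rw [← e1] at hc1
        rw [← e2] at hc2
        rw [ori_swap _ (w (J i f)), ori_swap _ (w (J i g)), neg_mul_neg] at this
        exact absurd this (not_lt.2 (mul_pos hc1 hc2).le)
    have hconn : ∀ f : {f : {f // f ∈ F} // i ∈ f.1}, ∀ x ∈ comp i f, ∀ y ∈ comp i f,
        Relation.ReflTransGen (fun x y => H.Adj x.1 y.1 ∧ x ∈ comp i f ∧ y ∈ comp i f) x y := by
      intro f x hx y hy
      have hxy : Conn H i x.1 y.1 := (Conn.symm hx).trans hy
      obtain ⟨x, hxi⟩ := x
      obtain ⟨y, hyi⟩ := y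
      simp only at hxy
      induction hxy with
      | refl => exact Relation.ReflTransGen.refl
      | @tail y z h1 h2 ih =>
        have hy' : Conn H i f.1 y := Conn.trans hx h1
        exact (ih h2.2.1 hy').tail ⟨h2.1, hy', hy⟩
    have hdc : Disjoint (comp i ⟨f, hf⟩) (comp i ⟨g, hg⟩) := by
      rw [Set.disjoint_left]
      intro x h1 h2
      exact hfg (Conn.trans h1 (Conn.symm h2))
    obtain ⟨u, h1, h2, h3, h4⟩ := exists_separating_inward (a := a i) (b := b i) (hcr i) hdisj
      (R := fun f g => H.Adj f.1 g.1) hR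
      (hconn ⟨f, hf⟩) (hconn ⟨g, hg⟩) hdc (f := ⟨f, hf⟩) (g := ⟨g, hg⟩) (Conn.refl f) (Conn.refl g)
    refine ⟨u, h1, ?_, ?_, ?_⟩
    · intro x hx
      rw [hset i ⟨f, hf⟩] at hx
      simp only [Finset.mem_insert, Finset.mem_singleton] at hx
      rcases hx with rfl | rfl | rfl
      · simp
      · exact h2.1
      · exact h2.2
    · intro x hx
      rw [hset i ⟨g, hg⟩] at hx
      simp only [Finset.mem_insert, Finset.mem_singleton] at hx
      rcases hx with rfl | rfl | rfl
      · simp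
      · exact h3.1
      · exact h3.2
    · simp only [hf, hg, dif_pos]
      exact h4

end perturb

lemma eventually_pos_of_continuous {φ : ℝ → ℝ} (hc : Continuous φ) (h : 0 < φ 0) :
    ∀ᶠ δ in 𝓝[>] (0 : ℝ), 0 < φ δ :=
  ((hc.tendsto 0).eventually (lt_mem_nhds h)).filter_mono nhdsWithin_le_nhds

section perturb
variable {V : Type} {G : SimpleGraph V} {w : V → Plane}
  {F : Finset (Finset V)} {H : SimpleGraph {f // f ∈ F}}

/-- The corner `i` of the face `f` after the displacement `d`, scaled by `δ`. -/
def moved (w : V → Plane) (d : {f // f ∈ F} → V → Plane) (δ : ℝ) (f : {f // f ∈ F}) (i : V) :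
    Plane := w i + δ • d f i

/-- The displacement `d` pushes apart the faces `f` and `g` at their common corner `i`, unless they
are connected there. -/
def Pushes (w : V → Plane) (H : SimpleGraph {f // f ∈ F}) (d : {f // f ∈ F} → V → Plane)
    (i : V) (f g : {f // f ∈ F}) : Prop :=
  (Conn H i f g → d f i = d g i) ∧ (¬ Conn H i f g → ∃ u : Plane →L[ℝ] ℝ, u ≠ 0 ∧
    (∀ x ∈ f.1, 0 ≤ u (w x - w i)) ∧ (∀ x ∈ g.1, u (w x - w i) ≤ 0) ∧ u (d g i) < u (d f i))

lemma eventually_sep_of_disjoint {d : {f // f ∈ F} → V → Plane} {f g : {f // f ∈ F}}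
    (h : ∀ x ∈ f.1, x ∉ g.1) (hs : Sep w w f.1 g.1 {x | x ∈ f.1 ∧ x ∈ g.1}) :
    ∀ᶠ δ in 𝓝[>] (0 : ℝ), Sep (moved w d δ f) (moved w d δ g) f.1 g.1
      {x | x ∈ f.1 ∧ x ∈ g.1 ∧ Conn H x f g} := by
  obtain ⟨u, c, h1, h2, -⟩ := hs
  have e1 : ∀ᶠ δ in 𝓝[>] (0 : ℝ), ∀ x ∈ f.1, 0 < u (moved w d δ f x) - c := by
    refine (Finset.eventually_all f.1).2 fun x hx => ?_
    refine eventually_pos_of_continuous (by unfold moved; fun_prop) ?_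
    simpa [moved] using h1 x hx (fun h' => h x hx h'.2)
  have e2 : ∀ᶠ δ in 𝓝[>] (0 : ℝ), ∀ x ∈ g.1, 0 < c - u (moved w d δ g x) := by
    refine (Finset.eventually_all g.1).2 fun x hx => ?_
    refine eventually_pos_of_continuous (by unfold moved; fun_prop) ?_
    simpa [moved] using h2 x hx (fun h' => h x h'.1 hx)
  filter_upwards [e1, e2] with δ e1 e2
  exact ⟨u, c, fun x hx _ => by linarith [e1 x hx], fun x hx _ => by linarith [e2 x hx],
    fun x hx => absurd hx.2.1 (h x hx.1)⟩

/-- Near `i` the displacement decides, and away from `i` the old strict separation persists. If the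
faces are connected at `i`, the old functional serves for both purposes. -/
lemma eventually_sep_of_singleton {d : {f // f ∈ F} → V → Plane} {f g : {f // f ∈ F}} {i : V}
    (hif : i ∈ f.1) (hig : i ∈ g.1)
    (h : ∀ x ∈ f.1, x ∈ g.1 → x = i) (hs : Sep w w f.1 g.1 {x | x ∈ f.1 ∧ x ∈ g.1})
    (hp : Pushes w H d i f g) :
    ∀ᶠ δ in 𝓝[>] (0 : ℝ), Sep (moved w d δ f) (moved w d δ g) f.1 g.1
      {x | x ∈ f.1 ∧ x ∈ g.1 ∧ Conn H x f g} := by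
  obtain ⟨u, h1, h2, h3⟩ : ∃ u : Plane →L[ℝ] ℝ, (∀ x ∈ f.1, x ≠ i → 0 < u (w x - w i)) ∧
      (∀ x ∈ g.1, x ≠ i → u (w x - w i) < 0) ∧ (Conn H i f g ∨ u (d g i) < u (d f i)) := by
    obtain ⟨u, c, h1, h2, h3⟩ := hs
    have hc : u (w i) = c := (h3 i ⟨hif, hig⟩).1
    have p1 : ∀ x ∈ f.1, x ≠ i → 0 < u (w x - w i) := by
      intro x hx hxi
      have := h1 x hx (fun h' => hxi (h x hx h'.2))
      rw [map_sub, hc]; linarith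
    have p2 : ∀ x ∈ g.1, x ≠ i → u (w x - w i) < 0 := by
      intro x hx hxi
      have := h2 x hx (fun h' => hxi (h x h'.1 hx))
      rw [map_sub, hc]; linarith
    by_cases hcn : Conn H i f g
    · exact ⟨u, p1, p2, Or.inl hcn⟩
    · obtain ⟨v, -, q1, q2, q3⟩ := hp.2 hcn
      -- `v` pushes the two copies of `i` apart but may vanish on other corners. Adding a small
      -- multiple of `u` makes it strict there and keeps the gap at `i`.
      have : ∀ᶠ η in 𝓝[>] (0 : ℝ), 0 < v (d f i - d g i) + η * u (d f i - d g i) := by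
        refine eventually_pos_of_continuous (by fun_prop) ?_
        simpa using q3
      obtain ⟨η, e, hη⟩ := (this.and self_mem_nhdsWithin).exists
      have hη : 0 < η := hη
      refine ⟨v + η • u, ?_, ?_, Or.inr ?_⟩
      · intro x hx hxi
        have := mul_pos hη (p1 x hx hxi)
        have := q1 x hx
        simp only [add_apply, smul_apply, smul_eq_mul]
        linarith
      · intro x hx hxi
        have := mul_neg_of_pos_of_neg hη (p2 x hx hxi)
        have := q2 x hx
        simp only [add_apply, smul_apply, smul_eq_mul]
        linarith
      · simp only [map_sub] at e
        simp only [add_apply, smul_apply, smul_eq_mul]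
        linarith
  -- The separating line goes through the midpoint of the two copies of `i`; if the copies coincide,
  -- it contains them.
  set e : Plane := (1 / 2 : ℝ) • (d f i + d g i) with he
  have e1 : ∀ᶠ δ in 𝓝[>] (0 : ℝ), ∀ x ∈ f.1, x ≠ i → 0 < u (moved w d δ f x) - u (w i + δ • e) := by
    refine (Finset.eventually_all f.1).2 fun x hx => ?_
    by_cases hxi : x = i
    · simp [hxi]
    refine (eventually_pos_of_continuous (φ := fun δ => u (moved w d δ f x) - u (w i + δ • e))
      (by unfold moved; fun_prop) ?_).mono fun _ h _ => h
    simpa [moved] using h1 x hx hxi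
  have e2 : ∀ᶠ δ in 𝓝[>] (0 : ℝ), ∀ x ∈ g.1, x ≠ i → 0 < u (w i + δ • e) - u (moved w d δ g x) := by
    refine (Finset.eventually_all g.1).2 fun x hx => ?_
    by_cases hxi : x = i
    · simp [hxi]
    refine (eventually_pos_of_continuous (φ := fun δ => u (w i + δ • e) - u (moved w d δ g x))
      (by unfold moved; fun_prop) ?_).mono fun _ h _ => h
    have := h2 x hx hxi
    simp only [moved, zero_smul, add_zero]
    rw [map_sub] at this; linarith
  filter_upwards [e1, e2, self_mem_nhdsWithin] with δ e1 e2 hδ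
  have hδ : 0 < δ := hδ
  refine ⟨u, u (w i + δ • e), ?_, ?_, ?_⟩
  · intro x hx hxK
    by_cases hxi : x = i
    · subst hxi
      have hlt := h3.resolve_left fun h' => hxK ⟨hx, hig, h'⟩
      simp only [moved, he, map_add, map_smul, smul_eq_mul]
      nlinarith
    · linarith [e1 x hx hxi]
  · intro x hx hxK
    by_cases hxi : x = i
    · subst hxi
      have hlt := h3.resolve_left fun h' => hxK ⟨hif, hx, h'⟩
      simp only [moved, he, map_add, map_smul, smul_eq_mul]
      nlinarith
    · linarith [e2 x hx hxi]
  · rintro x ⟨hxf, hxg, hc⟩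
    obtain rfl := h x hxf hxg
    have := hp.1 hc
    simp only [moved, he, this, map_add, map_smul, smul_eq_mul]
    constructor <;> ring

/-- At an edge with end points `i` and `j` of two faces, the displacement at `i` is transversal
to the edge. -/
lemma Pushes.transversal {d : {f // f ∈ F} → V → Plane} {f g : {f // f ∈ F}} {i j k : V}
    (hjf : j ∈ f.1) (hjg : j ∈ g.1) (hkf : k ∈ f.1) (ho : ori (w i) (w j) (w k) ≠ 0)
    (hp : Pushes w H d i f g) (hc : ¬ Conn H i f g) :
    0 < ori (w i) (w j) (w k) * cr (w j - w i) (d f i - d g i) := by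
  obtain ⟨u, h0, h1, h2, h3⟩ := hp.2 hc
  -- `j` is a corner of both faces, so the functional vanishes along the edge. It is therefore a
  -- multiple of the cross product with the edge, and its sign is determined at `k`.
  have hn : u (w j - w i) = 0 := le_antisymm (h2 j hjg) (h1 j hjf)
  have hk := h1 k hkf
  have key : ∀ x, ori (w i) (w j) (w k) * u x = cr (w j - w i) x * u (w k - w i) := by
    intro x
    have : ori (w i) (w j) (w k) • x = cr x (w k - w i) • (w j - w i) +
        cr (w j - w i) x • (w k - w i) := by
      apply plane_ext <;> simp [cr, ori] <;> ring
    have := congrArg u this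
    simpa [hn] using this
  have hk0 : 0 < u (w k - w i) := by
    refine lt_of_le_of_ne hk fun h => h0 ?_
    ext x
    have := key x
    rw [← h, mul_zero] at this
    simpa [ho] using this
  have e := key (d f i - d g i)
  have hpos : 0 < u (d f i - d g i) := by rw [map_sub]; linarith
  have : 0 < ori (w i) (w j) (w k) * cr (w j - w i) (d f i - d g i) * u (w k - w i) := by
    rw [mul_assoc, ← e, ← mul_assoc]
    exact mul_pos (mul_self_pos.2 ho) hpos
  exact pos_of_mul_pos_left this hk

variable [DecidableEq V]

/-- The separating line joins the midpoint `p i δ` of the two copies of `i` to the midpoint `p j δ`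
of the two copies of `j`. The third corners stay on their sides by continuity. Copies of `i` or `j`
that differ leave the line on the correct sides since the displacement is transversal to the edge;
copies that agree stay on it. -/
lemma eventually_sep_of_pair {d : {f // f ∈ F} → V → Plane} {f g : {f // f ∈ F}} {i j k l : V}
    (hf : f.1 = {i, j, k}) (hg : g.1 = {i, j, l})
    (hki : k ≠ i) (hkj : k ≠ j) (hli : l ≠ i) (hlj : l ≠ j) (hkl : k ≠ l)
    (ho : ori (w i) (w j) (w k) * ori (w i) (w j) (w l) < 0)
    (hpi : Pushes w H d i f g) (hpj : Pushes w H d j f g) :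
    ∀ᶠ δ in 𝓝[>] (0 : ℝ), Sep (moved w d δ f) (moved w d δ g) f.1 g.1
      {x | x ∈ f.1 ∧ x ∈ g.1 ∧ Conn H x f g} := by
  have o1 : ori (w i) (w j) (w k) ≠ 0 := by intro h; simp [h] at ho
  set σ := ori (w i) (w j) (w k) with hσ
  have hif : i ∈ f.1 := by simp [hf]
  have hjf : j ∈ f.1 := by simp [hf]
  have hkf : k ∈ f.1 := by simp [hf]
  have hig : i ∈ g.1 := by simp [hg]
  have hjg : j ∈ g.1 := by simp [hg]
  let p : V → ℝ → Plane := fun x δ => w x + δ • ((1 / 2 : ℝ) • (d f x + d g x))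
  have pc : ∀ x, Continuous (p x) := fun x => by fun_prop
  have p0 : ∀ x, p x 0 = w x := fun x => by simp [p]
  have mf : ∀ x δ, moved w d δ f x = p x δ + (δ / 2) • (d f x - d g x) := by
    intro x δ; simp only [moved, p]; module
  have mg : ∀ x δ, moved w d δ g x = p x δ - (δ / 2) • (d f x - d g x) := by
    intro x δ; simp only [moved, p]; module
  clear_value p
  have cc : ∀ {a b : ℝ → Plane}, Continuous a → Continuous b → Continuous fun δ => cr (a δ) (b δ) := by
    intro a b ha hb; unfold cr; fun_prop
  have tr : ∀ x, x = i ∨ x = j → ¬ Conn H x f g → 0 < σ * cr (w j - w i) (d f x - d g x) := by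
    rintro x (rfl | rfl) hc
    · exact hpi.transversal hjf hjg hkf o1 hc
    · have := hpj.transversal hif hig hkf (by rw [ori_swap_left]; exact neg_ne_zero.2 o1) hc
      rw [ori_swap_left, ← hσ] at this
      have e : cr (w i - w x) (d f x - d g x) = -cr (w x - w i) (d f x - d g x) := by
        simp [cr]; ring
      rwa [e, neg_mul_neg] at this
  have ek : ∀ᶠ δ in 𝓝[>] (0 : ℝ), 0 < σ * cr (p j δ - p i δ) (moved w d δ f k - p i δ) := by
    refine eventually_pos_of_continuous (continuous_const.mul (cc ((pc j).sub (pc i))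
      ((by unfold moved; fun_prop : Continuous fun δ => moved w d δ f k).sub (pc i)))) ?_
    simp only [p0, moved, zero_smul, add_zero]
    exact mul_self_pos.2 o1
  have el : ∀ᶠ δ in 𝓝[>] (0 : ℝ), 0 < -(σ * cr (p j δ - p i δ) (moved w d δ g l - p i δ)) := by
    refine eventually_pos_of_continuous (continuous_const.mul (cc ((pc j).sub (pc i))
      ((by unfold moved; fun_prop : Continuous fun δ => moved w d δ g l).sub (pc i)))).neg ?_
    simp only [p0, moved, zero_smul, add_zero]
    have : ori (w i) (w j) (w l) = cr (w j - w i) (w l - w i) := rfl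
    rw [← this]; linarith
  have et : ∀ x, x = i ∨ x = j → ∀ᶠ δ in 𝓝[>] (0 : ℝ), ¬ Conn H x f g →
      0 < σ * cr (p j δ - p i δ) (d f x - d g x) := by
    intro x hx
    by_cases hc : Conn H x f g
    · simp [hc]
    refine (eventually_pos_of_continuous (φ := fun δ => σ * cr (p j δ - p i δ) (d f x - d g x))
      (continuous_const.mul (cc ((pc j).sub (pc i)) continuous_const)) ?_).mono fun _ h _ => h
    simpa only [p0] using tr x hx hc
  filter_upwards [ek, el, et i (Or.inl rfl), et j (Or.inr rfl), self_mem_nhdsWithin]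
    with δ ek el eti etj hδ
  have hδ : 0 < δ := hδ
  have het : ∀ x, x = i ∨ x = j → ¬ Conn H x f g → 0 < σ * cr (p j δ - p i δ) (d f x - d g x) := by
    rintro x (rfl | rfl) hc
    · exact eti hc
    · exact etj hc
  have sub : ∀ v x y : Plane, cr v (x - y) = cr v x - cr v y := fun v x y => (crL v).map_sub x y
  have hpp : cr (p j δ - p i δ) (p j δ) = cr (p j δ - p i δ) (p i δ) := by simp [cr]; ring
  have hp' : ∀ x, x = i ∨ x = j → cr (p j δ - p i δ) (p x δ) = cr (p j δ - p i δ) (p i δ) := by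
    rintro x (rfl | rfl)
    · rfl
    · exact hpp
  have addr : ∀ v x y : Plane, cr v (x + y) = cr v x + cr v y := fun v x y => (crL v).map_add x y
  refine ⟨σ • crL (p j δ - p i δ), σ * cr (p j δ - p i δ) (p i δ), ?_, ?_, ?_⟩
  · intro x hx hxK
    simp only [smul_apply, crL_apply, smul_eq_mul]
    by_cases hxij : x = i ∨ x = j
    · have hxg : x ∈ g.1 := by rcases hxij with rfl | rfl <;> assumption
      have := het x hxij (fun h => hxK ⟨hx, hxg, h⟩)
      rw [mf, addr, cr_smul_right, hp' x hxij]
      nlinarith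
    · rw [hf] at hx
      simp only [Finset.mem_insert, Finset.mem_singleton] at hx
      obtain rfl : x = k := by tauto
      rw [sub] at ek; linarith
  · intro x hx hxK
    simp only [smul_apply, crL_apply, smul_eq_mul]
    by_cases hxij : x = i ∨ x = j
    · have hxf : x ∈ f.1 := by rcases hxij with rfl | rfl <;> assumption
      have := het x hxij (fun h => hxK ⟨hxf, hx, h⟩)
      rw [mg, sub, cr_smul_right, hp' x hxij]
      nlinarith
    · rw [hg] at hx
      simp only [Finset.mem_insert, Finset.mem_singleton] at hx
      obtain rfl : x = l := by tauto
      rw [sub] at el; linarith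
  · rintro x ⟨hxf, hxg, hc⟩
    have hxij : x = i ∨ x = j := by
      rw [hf] at hxf; rw [hg] at hxg
      simp only [Finset.mem_insert, Finset.mem_singleton] at hxf hxg
      rcases hxf with h | h | h
      · exact Or.inl h
      · exact Or.inr h
      · rcases hxg with h' | h' | h'
        · exact Or.inl h'
        · exact Or.inr h'
        · exact absurd (h.symm.trans h') hkl
    have hd : d f x = d g x := by
      rcases hxij with rfl | rfl
      · exact hpi.1 hc
      · exact hpj.1 hc
    simp only [smul_apply, crL_apply, smul_eq_mul]
    rw [mf, mg, hd]
    simp [hp' x hxij]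

lemma eventually_sep (hw : IsPlaneDrawing G w) (hF : emptyTriangles G w = F)
    {d : {f // f ∈ F} → V → Plane} {f g : {f // f ∈ F}} (hfg : f ≠ g)
    (hp : ∀ i, i ∈ f.1 → i ∈ g.1 → Pushes w H d i f g) :
    ∀ᶠ δ in 𝓝[>] (0 : ℝ), Sep (moved w d δ f) (moved w d δ g) f.1 g.1
      {x | x ∈ f.1 ∧ x ∈ g.1 ∧ Conn H x f g} := by
  have hfg' : f.1 ≠ g.1 := fun h => hfg (Subtype.ext h)
  have hs := sep_faces hw hF f.2 g.2 hfg'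
  by_cases h0 : ∃ i ∈ f.1, i ∈ g.1
  · obtain ⟨i, hif, hig⟩ := h0
    by_cases h1 : ∃ j ∈ f.1, j ∈ g.1 ∧ j ≠ i
    · obtain ⟨j, hjf, hjg, hji⟩ := h1
      obtain ⟨k, l, h1, h2, h3, h4, h5, h6, h7, -⟩ := inter_pair_of_ne (face_card hF f.2)
        (face_card hF g.2) hfg' hji.symm hif hjf hig hjg
      exact eventually_sep_of_pair h6 h7 h1 h2 h3 h4 h5
        (ori_neg_of_inter_pair hw hF (h6 ▸ f.2) (h7 ▸ g.2) hji.symm h1 h2 h3 h4 h5)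
        (hp i hif hig) (hp j hjf hjg)
    · push Not at h1
      exact eventually_sep_of_singleton hif hig h1 hs (hp i hif hig)
  · push Not at h0
    exact eventually_sep_of_disjoint h0 hs

end perturb

/-! ### The drawing of the cut complex -/

section drawing
variable {V : Type} {G : SimpleGraph V} {w : V → Plane}
  {F : Finset (Finset V)} {H : SimpleGraph {f // f ∈ F}}

/-- The two faces that are adjacent in `H` share an edge. -/
def SharesEdges (H : SimpleGraph {f // f ∈ F}) : Prop :=
  ∀ f g, H.Adj f g → ∃ i j, i ≠ j ∧ i ∈ f.1 ∧ j ∈ f.1 ∧ i ∈ g.1 ∧ j ∈ g.1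

/-- A drawing `W` of the corners of the faces that is close to the drawing `w` of the vertices,
in which two faces have in common only the corners at which they are connected. -/
structure IsCutDrawing (w : V → Plane) (H : SimpleGraph {f // f ∈ F})
    (W : {f // f ∈ F} → V → Plane) : Prop where
  eq_of_conn : ∀ i f g, i ∈ f.1 → Conn H i f g → W f i = W g i
  sep : ∀ f g, f ≠ g → Sep (W f) (W g) f.1 g.1 {x | x ∈ f.1 ∧ x ∈ g.1 ∧ Conn H x f g}
  ori_pos : ∀ f g h i j k, ori (w i) (w j) (w k) ≠ 0 →
    0 < ori (W f i) (W g j) (W h k) * ori (w i) (w j) (w k)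

/-- All requirements are finitely many conditions that hold for every sufficiently small scale `δ >
0`. -/
lemma exists_cutDrawing [DecidableEq V] [Finite V] (hw : IsPlaneDrawing G w) (hF : emptyTriangles G w = F)
    (hH : SharesEdges H) {ε : ℝ} (hε : 0 < ε) :
    ∃ W, IsCutDrawing w H W ∧ ∀ f i, dist (W f i) (w i) < ε := by
  obtain ⟨d, h1, h2⟩ := exists_displacement hw hF hH
  have e1 : ∀ᶠ δ in 𝓝[>] (0 : ℝ), ∀ p : {f // f ∈ F} × {f // f ∈ F}, p.1 ≠ p.2 →
      Sep (moved w d δ p.1) (moved w d δ p.2) p.1.1 p.2.1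
        {x | x ∈ p.1.1 ∧ x ∈ p.2.1 ∧ Conn H x p.1 p.2} := by
    refine eventually_all.2 fun p => ?_
    by_cases hp : p.1 = p.2
    · simp [hp]
    · exact (eventually_sep hw hF hp fun i hi hi' =>
        ⟨h1 i _ _ hi hi', h2 i _ _ hi hi'⟩).mono fun _ h _ => h
  have e2 : ∀ᶠ δ in 𝓝[>] (0 : ℝ), ∀ p : ({f // f ∈ F} × {f // f ∈ F} × {f // f ∈ F}) × V × V × V,
      ori (w p.2.1) (w p.2.2.1) (w p.2.2.2) ≠ 0 →
      0 < ori (moved w d δ p.1.1 p.2.1) (moved w d δ p.1.2.1 p.2.2.1)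
        (moved w d δ p.1.2.2 p.2.2.2) * ori (w p.2.1) (w p.2.2.1) (w p.2.2.2) := by
    refine eventually_all.2 fun p => ?_
    by_cases hp : ori (w p.2.1) (w p.2.2.1) (w p.2.2.2) = 0
    · simp [hp]
    refine (eventually_pos_of_continuous
      ((continuous_ori ?_ ?_ ?_).mul continuous_const) ?_).mono fun _ h _ => h
    · unfold moved; fun_prop
    · unfold moved; fun_prop
    · unfold moved; fun_prop
    · simpa [moved] using hp
  have e3 : ∀ᶠ δ in 𝓝[>] (0 : ℝ), ∀ p : {f // f ∈ F} × V,
      0 < ε - dist (moved w d δ p.1 p.2) (w p.2) := by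
    refine eventually_all.2 fun p => ?_
    refine eventually_pos_of_continuous (by unfold moved; fun_prop) ?_
    simpa [moved] using hε
  obtain ⟨δ, ⟨e1, e2⟩, e3⟩ := ((e1.and e2).and e3).exists
  refine ⟨moved w d δ, ⟨?_, fun f g => e1 (f, g), fun f g h i j k => e2 ((f, g, h), (i, j, k))⟩,
    fun f i => by linarith [e3 (f, i)]⟩
  intro i f g hi hc
  simp only [moved, h1 i f g hi (hc.mem hi) hc]

/-- A labelling of the corners of the faces by the vertices of the cut complex. -/
structure Labeling (H : SimpleGraph {f // f ∈ F}) (V' : Type) where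
  lab : {f // f ∈ F} → V → V'
  lab_eq {f g i j} : i ∈ f.1 → j ∈ g.1 → (lab f i = lab g j ↔ i = j ∧ Conn H i f g)
  surj : ∀ a, ∃ f i, i ∈ f.1 ∧ lab f i = a

namespace Labeling
variable {V' : Type} (Λ : Labeling H V')

/-- The graph of the cut complex. -/
def graph : SimpleGraph V' where
  Adj a b := ∃ f i j, i ∈ f.1 ∧ j ∈ f.1 ∧ i ≠ j ∧ Λ.lab f i = a ∧ Λ.lab f j = b
  symm := ⟨fun _ _ ⟨f, i, j, h1, h2, h3, h4, h5⟩ => ⟨f, j, i, h2, h1, h3.symm, h5, h4⟩⟩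
  loopless := ⟨fun _ ⟨_, _, _, h1, h2, h3, h4, h5⟩ =>
    h3 ((Λ.lab_eq h1 h2).1 (h4.trans h5.symm)).1⟩

/-- The face of the cut complex over the face `f`. -/
def liftFace [DecidableEq V'] (f : {f // f ∈ F}) : Finset V' := f.1.image (Λ.lab f)

/-- The vertex under a vertex of the cut complex. -/
noncomputable def proj (a : V') : V := (Λ.surj a).choose_spec.choose

lemma proj_spec (a : V') : ∃ f, Λ.proj a ∈ f.1 ∧ Λ.lab f (Λ.proj a) = a :=
  ⟨_, (Λ.surj a).choose_spec.choose_spec⟩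

lemma proj_lab {f : {f // f ∈ F}} {i : V} (hi : i ∈ f.1) : Λ.proj (Λ.lab f i) = i := by
  obtain ⟨g, h1, h2⟩ := Λ.proj_spec (Λ.lab f i)
  exact ((Λ.lab_eq h1 hi).1 h2).1

/-- The drawing of the vertices of the cut complex. -/
noncomputable def draw (W : {f // f ∈ F} → V → Plane) (a : V') : Plane :=
  W (Λ.proj_spec a).choose (Λ.proj a)

variable {Λ} {W : {f // f ∈ F} → V → Plane}

lemma draw_lab (hW : IsCutDrawing w H W) {f : {f // f ∈ F}} {i : V} (hi : i ∈ f.1) :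
    Λ.draw W (Λ.lab f i) = W f i := by
  obtain ⟨h1, h2⟩ := (Λ.proj_spec (Λ.lab f i)).choose_spec
  have h3 := (Λ.lab_eq h1 hi).1 h2
  rw [draw, hW.eq_of_conn _ _ _ h1 h3.2, h3.1]

end Labeling

namespace IsCutDrawing
variable {W : {f // f ∈ F} → V → Plane} (hW : IsCutDrawing w H W)
include hW

lemma ori_ne_zero {f g h : {f // f ∈ F}} {i j k : V} (ho : ori (w i) (w j) (w k) ≠ 0) :
    ori (W f i) (W g j) (W h k) ≠ 0 := by
  have := hW.ori_pos f g h i j k ho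
  intro h0; simp [h0] at this

variable [DecidableEq V]

lemma injOn_face (hw : IsPlaneDrawing G w) (hF : emptyTriangles G w = F) {f : {f // f ∈ F}}
    {i j : V} (hi : i ∈ f.1) (hj : j ∈ f.1) (h : W f i = W f j) : i = j := by
  by_contra hij
  obtain ⟨k, h1, h2, h3⟩ := exists_third (face_card hF f.2) hi hj hij
  have := hW.ori_ne_zero (f := f) (g := f) (h := f) (face_ori_ne_zero hw hF f.2 hi hj
    (by simp [h3] : k ∈ f.1) hij h1.symm h2.symm)
  rw [h, ori_self_left] at this
  exact this rfl

/-- The corners of two faces on a line that separates them are their common corners. -/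
lemma exists_sep {f g : {f // f ∈ F}} (hfg : f ≠ g) : ∃ (u : Plane →L[ℝ] ℝ) (c : ℝ),
    (∀ x ∈ f.1, c ≤ u (W f x)) ∧ (∀ x ∈ g.1, u (W g x) ≤ c) ∧
    (∀ x ∈ f.1, u (W f x) = c ↔ x ∈ g.1 ∧ Conn H x f g) ∧
    (∀ x ∈ g.1, u (W g x) = c ↔ x ∈ f.1 ∧ Conn H x f g) := by
  obtain ⟨u, c, h1, h2, h3⟩ := hW.sep f g hfg
  refine ⟨u, c, ?_, ?_, ?_, ?_⟩
  · intro x hx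
    by_cases h : x ∈ {x | x ∈ f.1 ∧ x ∈ g.1 ∧ Conn H x f g}
    · exact (h3 x h).1.ge
    · exact (h1 x hx h).le
  · intro x hx
    by_cases h : x ∈ {x | x ∈ f.1 ∧ x ∈ g.1 ∧ Conn H x f g}
    · exact (h3 x h).2.le
    · exact (h2 x hx h).le
  · intro x hx
    constructor
    · intro he; by_contra hn
      exact (h1 x hx (fun h => hn h.2)).ne' he
    · exact fun h => (h3 x ⟨hx, h⟩).1
  · intro x hx
    constructor
    · intro he; by_contra hn
      exact (h2 x hx (fun h => hn ⟨h.1, h.2.2⟩)).ne he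
    · exact fun h => (h3 x ⟨h.1, hx, h.2⟩).2

/-- A common corner point of two faces is on their separating line, where only the connected corners
are. -/
lemma eq_and_conn (hw : IsPlaneDrawing G w) (hF : emptyTriangles G w = F) {f g : {f // f ∈ F}}
    {i j : V} (hi : i ∈ f.1) (hj : j ∈ g.1) (h : W f i = W g j) : i = j ∧ Conn H i f g := by
  by_cases hfg : f = g
  · subst hfg
    exact ⟨hW.injOn_face hw hF hi hj h, Conn.refl _⟩
  · obtain ⟨u, c, h1, h2, h3, h4⟩ := hW.exists_sep hfg
    have e1 := h1 i hi
    have e2 := h2 j hj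
    rw [← h] at e2
    obtain ⟨h5, h6⟩ := (h3 i hi).1 (le_antisymm e2 e1)
    exact ⟨hW.injOn_face hw hF h5 hj ((hW.eq_of_conn i f g hi h6).symm.trans h), h6⟩

omit hW in
lemma notMem_segment_of_ori {a b c : Plane} (h : ori a b c ≠ 0) : c ∉ segment ℝ a b := by
  rintro ⟨p, q, -, -, hpq, rfl⟩
  obtain rfl : p = 1 - q := by linarith
  apply h
  simp only [ori_eq, PiLp.add_apply, PiLp.smul_apply, smul_eq_mul]; ring

omit hW in
lemma disjoint_openSegment_of_ori {a b c : Plane} (h : ori a b c ≠ 0) :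
    Disjoint (openSegment ℝ a b) (openSegment ℝ a c) := by
  rw [Set.disjoint_left]
  rintro x ⟨p, q, hp, hq, hpq, rfl⟩ ⟨p', q', hp', hq', hpq', he⟩
  obtain rfl : p = 1 - q := by linarith
  obtain rfl : p' = 1 - q' := by linarith
  have : q • (b - a) + (-q') • (c - a) = 0 := by
    have := sub_eq_zero.2 he.symm
    rw [← this]; module
  exact hq.ne' (comb_eq_zero h this).1

/-- On a side of `f`, a corner of `g` would be on the separating line and hence be a corner of `f`
too; within one nondegenerate triangle the claim is clear. -/
lemma notMem_segment (hw : IsPlaneDrawing G w) (hF : emptyTriangles G w = F) {f g : {f // f ∈ F}}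
    {i j k : V} (hi : i ∈ f.1) (hj : j ∈ f.1) (hij : i ≠ j) (hk : k ∈ g.1) (hki : W g k ≠ W f i)
    (hkj : W g k ≠ W f j) : W g k ∉ segment ℝ (W f i) (W f j) := by
  have key : ∀ k ∈ f.1, k ≠ i → k ≠ j → W f k ∉ segment ℝ (W f i) (W f j) := by
    intro k hk hki hkj
    exact notMem_segment_of_ori (hW.ori_ne_zero (face_ori_ne_zero hw hF f.2 hi hj hk hij
      hki.symm hkj.symm))
  by_cases hfg : f = g
  · subst hfg
    exact key k hk (by rintro rfl; exact hki rfl) (by rintro rfl; exact hkj rfl)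
  · obtain ⟨u, c, h1, h2, h3, h4⟩ := hW.exists_sep hfg
    intro hm
    have hc : c ≤ u (W g k) := by
      obtain ⟨p, q, hp, hq, hpq, he⟩ := hm
      rw [← he, map_add, map_smul, map_smul, smul_eq_mul, smul_eq_mul]
      have := mul_le_mul_of_nonneg_left (h1 i hi) hp
      have := mul_le_mul_of_nonneg_left (h1 j hj) hq
      have : p * c + q * c = c := by rw [← add_mul, hpq, one_mul]
      linarith
    obtain ⟨h5, h6⟩ := (h4 k hk).1 (le_antisymm (h2 k hk) hc)
    have e := hW.eq_of_conn k f g h5 h6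
    rw [← e] at hm hki hkj
    exact key k h5 (by rintro rfl; exact hki rfl) (by rintro rfl; exact hkj rfl) hm

lemma disjoint_openSegment_face (hw : IsPlaneDrawing G w) (hF : emptyTriangles G w = F)
    {f : {f // f ∈ F}} {i j k l : V} (hi : i ∈ f.1) (hj : j ∈ f.1) (hij : i ≠ j) (hk : k ∈ f.1)
    (hl : l ∈ f.1) (hkl : k ≠ l) (hne : s(i, j) ≠ s(k, l)) :
    Disjoint (openSegment ℝ (W f i) (W f j)) (openSegment ℝ (W f k) (W f l)) := by
  have key : ∀ a b c, a ∈ f.1 → b ∈ f.1 → c ∈ f.1 → a ≠ b → a ≠ c → b ≠ c →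
      Disjoint (openSegment ℝ (W f a) (W f b)) (openSegment ℝ (W f a) (W f c)) :=
    fun a b c ha hb hc hab hac hbc => disjoint_openSegment_of_ori
      (hW.ori_ne_zero (face_ori_ne_zero hw hF f.2 ha hb hc hab hac hbc))
  rw [Ne, Sym2.eq_iff] at hne
  push Not at hne
  by_cases h1 : i = k
  · subst h1
    exact key i j l hi hj hl hij hkl (hne.1 rfl)
  by_cases h2 : i = l
  · subst h2
    rw [openSegment_symm ℝ (W f k)]
    exact key i j k hi hj hk hij h1 (hne.2 rfl)
  by_cases h3 : j = k
  · subst h3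
    rw [openSegment_symm ℝ (W f i)]
    exact key j i l hj hi hl hij.symm hkl h2
  by_cases h4 : j = l
  · subst h4
    rw [openSegment_symm ℝ (W f i), openSegment_symm ℝ (W f k)]
    exact key j i k hj hi hk hij.symm h3 h1
  exfalso
  have hsub : ({i, j, k, l} : Finset V) ⊆ f.1 := by
    intro x hx
    simp only [Finset.mem_insert, Finset.mem_singleton] at hx
    rcases hx with rfl | rfl | rfl | rfl <;> assumption
  have := Finset.card_le_card hsub
  rw [face_card hF f.2, Finset.card_insert_of_notMem (by simp [hij, h1, h2]),
    Finset.card_insert_of_notMem (by simp [h3, h4]), Finset.card_pair hkl] at this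
  omega

/-- A common point is on the separating line. Being an inner point of the side of `f`, it forces
both ends of this side onto the line, so that they are shared with `g`, and two different sides of
one triangle are left to compare. -/
lemma disjoint_openSegment (hw : IsPlaneDrawing G w) (hF : emptyTriangles G w = F)
    {f g : {f // f ∈ F}} {i j k l : V} (hi : i ∈ f.1) (hj : j ∈ f.1) (hij : i ≠ j) (hk : k ∈ g.1)
    (hl : l ∈ g.1) (hkl : k ≠ l)
    (hne : i ∈ g.1 → j ∈ g.1 → Conn H i f g → Conn H j f g → s(i, j) ≠ s(k, l)) :
    Disjoint (openSegment ℝ (W f i) (W f j)) (openSegment ℝ (W g k) (W g l)) := by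
  by_cases hfg : f = g
  · subst hfg
    exact hW.disjoint_openSegment_face hw hF hi hj hij hk hl hkl
      (hne hi hj (Conn.refl _) (Conn.refl _))
  · obtain ⟨u, c, h1, h2, h3, h4⟩ := hW.exists_sep hfg
    rw [Set.disjoint_left]
    rintro x ⟨p, q, hp, hq, hpq, he⟩ hx
    have hx' := hx
    obtain ⟨p', q', hp', hq', hpq', he'⟩ := hx
    have e1 := h1 i hi
    have e2 := h1 j hj
    have e3 := h2 k hk
    have e4 := h2 l hl
    have u1 : u x = p * u (W f i) + q * u (W f j) := by rw [← he]; simp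
    have u2 : u x = p' * u (W g k) + q' * u (W g l) := by rw [← he']; simp
    have l1 : u x ≤ c := by
      rw [u2]
      have := mul_le_mul_of_nonneg_left e3 hp'.le
      have := mul_le_mul_of_nonneg_left e4 hq'.le
      have : p' * c + q' * c = c := by rw [← add_mul, hpq', one_mul]
      linarith
    have hc : p * c + q * c = c := by rw [← add_mul, hpq, one_mul]
    have m1 := mul_le_mul_of_nonneg_left e1 hp.le
    have m2 := mul_le_mul_of_nonneg_left e2 hq.le
    have z1 : u (W f i) = c := by
      have : p * c = p * u (W f i) := by linarith
      exact (mul_left_cancel₀ hp.ne' this).symm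
    have z2 : u (W f j) = c := by
      have : q * c = q * u (W f j) := by linarith
      exact (mul_left_cancel₀ hq.ne' this).symm
    obtain ⟨a1, a2⟩ := (h3 i hi).1 z1
    obtain ⟨b1, b2⟩ := (h3 j hj).1 z2
    have := hW.disjoint_openSegment_face hw hF a1 b1 hij hk hl hkl (hne a1 b1 a2 b2)
    rw [← hW.eq_of_conn i f g hi a2, ← hW.eq_of_conn j f g hj b2] at this
    exact Set.disjoint_left.1 this ⟨p, q, hp, hq, hpq, he⟩ hx'

/-- An interior point is a combination of the three corners of `f` with positive coefficients. As a
corner of another face it would be on the other side of the separating line, or on it; then all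
corners of `f` would be on the line and so be corners of `g`. -/
lemma notMem_interior (hw : IsPlaneDrawing G w) (hF : emptyTriangles G w = F)
    {f g : {f // f ∈ F}} {i j k l : V} (hf : f.1 = {i, j, k}) (hij : i ≠ j) (hik : i ≠ k)
    (hjk : j ≠ k) (hl : l ∈ g.1) :
    W g l ∉ interior (convexHull ℝ {W f i, W f j, W f k}) := by
  have hi : i ∈ f.1 := by simp [hf]
  have hj : j ∈ f.1 := by simp [hf]
  have hk : k ∈ f.1 := by simp [hf]
  have ho := hW.ori_ne_zero (f := f) (g := f) (h := f)
    (face_ori_ne_zero hw hF f.2 hi hj hk hij hik hjk)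
  rw [interior_triangle ho]
  rintro ⟨h1, h2, h3⟩
  by_cases hfg : f = g
  · subst hfg
    rw [hf] at hl
    simp only [Finset.mem_insert, Finset.mem_singleton] at hl
    rcases hl with rfl | rfl | rfl
    · simp [ori_self_left] at h2
    · simp [ori_self_left] at h1
    · simp [ori_self_outer] at h1
  · obtain ⟨u, c, q1, q2, q3, q4⟩ := hW.exists_sep hfg
    set o := ori (W f i) (W f j) (W f k)
    have hu := congrArg u (barycentric ho (W g l))
    have hs := ori_sum (W f i) (W f j) (W f k) (W g l)
    simp only [map_add, map_smul, smul_eq_mul] at hu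
    have hd : ∀ t, 0 < t * o → 0 < t / o := by
      intro t ht
      rw [show t / o = (t * o) / (o * o) by field_simp]
      exact div_pos ht (mul_self_pos.2 ho)
    have p1 := hd _ h1
    have p2 := hd _ h2
    have p3 := hd _ h3
    have hsum : ori (W g l) (W f j) (W f k) / o + ori (W f i) (W g l) (W f k) / o +
        ori (W f i) (W f j) (W g l) / o = 1 := by
      rw [← add_div, ← add_div, hs, div_self ho]
    set α := ori (W g l) (W f j) (W f k) / o
    set β := ori (W f i) (W g l) (W f k) / o
    set γ := ori (W f i) (W f j) (W g l) / o
    have m1 := mul_le_mul_of_nonneg_left (q1 i hi) p1.le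
    have m2 := mul_le_mul_of_nonneg_left (q1 j hj) p2.le
    have m3 := mul_le_mul_of_nonneg_left (q1 k hk) p3.le
    have hc : α * c + β * c + γ * c = c := by rw [← add_mul, ← add_mul, hsum, one_mul]
    have := q2 l hl
    have z1 : c = u (W f i) := mul_left_cancel₀ p1.ne' (by linarith)
    have z2 : c = u (W f j) := mul_left_cancel₀ p2.ne' (by linarith)
    have z3 : c = u (W f k) := mul_left_cancel₀ p3.ne' (by linarith)
    have hsub : f.1 ⊆ g.1 := by
      intro x hx
      rw [hf] at hx
      simp only [Finset.mem_insert, Finset.mem_singleton] at hx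
      rcases hx with rfl | rfl | rfl
      · exact ((q3 _ hi).1 z1.symm).1
      · exact ((q3 _ hj).1 z2.symm).1
      · exact ((q3 _ hk).1 z3.symm).1
    exact hfg (Subtype.ext (Finset.eq_of_subset_of_card_le hsub
      (by rw [face_card hF f.2, face_card hF g.2])))

end IsCutDrawing

namespace Labeling
variable [DecidableEq V] {V' : Type} {Λ : Labeling H V'} {W : {f // f ∈ F} → V → Plane}

lemma isPlaneDrawing (hW : IsCutDrawing w H W) (hw : IsPlaneDrawing G w)
    (hF : emptyTriangles G w = F) : IsPlaneDrawing Λ.graph (Λ.draw W) where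
  injective := by
    intro a b hab
    obtain ⟨f, i, hi, rfl⟩ := Λ.surj a
    obtain ⟨g, j, hj, rfl⟩ := Λ.surj b
    rw [draw_lab hW hi, draw_lab hW hj] at hab
    exact (Λ.lab_eq hi hj).2 (hW.eq_and_conn hw hF hi hj hab)
  vertex_notMem := by
    rintro _ _ c ⟨f, i, j, hi, hj, hij, rfl, rfl⟩ h1 h2
    obtain ⟨g, k, hk, rfl⟩ := Λ.surj c
    rw [draw_lab hW hi, draw_lab hW hj, draw_lab hW hk]
    exact hW.notMem_segment hw hF hi hj hij hk
      (fun h => h1 ((Λ.lab_eq hk hi).2 (hW.eq_and_conn hw hF hk hi h)))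
      (fun h => h2 ((Λ.lab_eq hk hj).2 (hW.eq_and_conn hw hF hk hj h)))
  edges_disjoint := by
    rintro _ _ _ _ ⟨f, i, j, hi, hj, hij, rfl, rfl⟩ ⟨g, k, l, hk, hl, hkl, rfl, rfl⟩ hne
    rw [draw_lab hW hi, draw_lab hW hj, draw_lab hW hk, draw_lab hW hl]
    refine hW.disjoint_openSegment hw hF hi hj hij hk hl hkl fun h1 h2 h3 h4 he => hne ?_
    rw [(Λ.lab_eq hi h1).2 ⟨rfl, h3⟩, (Λ.lab_eq hj h2).2 ⟨rfl, h4⟩]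
    exact congrArg (Sym2.map (Λ.lab g)) he

/-- A triangle of the cut complex over a face `f` that is not the copy of `f` contains a copy of
a corner of `f`. -/
lemma false_of_not_lift (hW : IsCutDrawing w H W) (hw : IsPlaneDrawing G w)
    (hF : emptyTriangles G w = F) (hH : SharesEdges H) (hconn : H.Connected)
    {f f₁ f₂ f₃ : {f // f ∈ F}} {i j k : V} (hf : f.1 = {i, j, k}) (hij : i ≠ j) (hik : i ≠ k)
    (hjk : j ≠ k) (h1i : i ∈ f₁.1) (h1j : j ∈ f₁.1) (h2j : j ∈ f₂.1) (h2k : k ∈ f₂.1)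
    (h3i : i ∈ f₃.1) (h3k : k ∈ f₃.1) (h13 : Conn H i f₁ f₃) (h12 : Conn H j f₁ f₂)
    (h23 : Conn H k f₂ f₃) (hj : ¬ Conn H j f f₁)
    (hempty : W f j ∉ interior (convexHull ℝ {W f₁ i, W f₁ j, W f₂ k})) : False := by
  have hi' : i ∈ f.1 := by simp [hf]
  have hj' : j ∈ f.1 := by simp [hf]
  have hk' : k ∈ f.1 := by simp [hf]
  have hf1 : f ≠ f₁ := by rintro rfl; exact hj (Conn.refl _)
  have hf2 : f ≠ f₂ := by rintro rfl; exact hj h12.symm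
  have hvne : ∀ {g h : {f // f ∈ F}}, g ≠ h → g.1 ≠ h.1 := fun h h' => h (Subtype.ext h')
  -- Since `H` is connected, `f` has a neighbour `g` in `H`. Across the sides `ij` or `jk` it would
  -- be `f₁` or `f₂`, as an edge is in at most two faces, and would connect `f` to `f₁` at `j`. So
  -- it lies across `ik`, and the triangle shares the corners `i` and `k` with the copy of `f` (as
  -- it does if `f = f₃`).
  have hac : Conn H i f f₁ ∧ Conn H k f f₂ := by
    by_cases hf3 : f = f₃
    · subst hf3; exact ⟨h13.symm, h23.symm⟩
    have : Nontrivial {f // f ∈ F} := ⟨f, f₁, hf1⟩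
    obtain ⟨g, hg⟩ := hconn.preconnected.exists_adj_of_nontrivial f
    obtain ⟨x, y, hxy, hxf, hyf, hxg, hyg⟩ := hH f g hg
    have key : ∀ h x y, h ≠ f → x ≠ y → x ∈ f.1 → y ∈ f.1 → x ∈ g.1 → y ∈ g.1 → x ∈ h.1 → y ∈ h.1 →
        g = h := by
      intro h x y hh hxy hxf hyf hxg hyg hxh hyh
      by_contra hgh
      exact not_three_faces hw hF f.2 g.2 h.2 (hvne hg.ne) (hvne (Ne.symm hh)) (hvne hgh) hxy
        hxf hyf hxg hyg hxh hyh
    have c1 : i ∈ g.1 → j ∈ g.1 → False := by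
      intro h1 h2
      have := key f₁ i j hf1.symm hij hi' hj' h1 h2 h1i h1j
      subst this
      exact hj (Conn.of_adj hg hj' h2)
    have c2 : j ∈ g.1 → k ∈ g.1 → False := by
      intro h1 h2
      have := key f₂ j k hf2.symm hjk hj' hk' h1 h2 h2j h2k
      subst this
      exact hj ((Conn.of_adj hg hj' h1).trans h12.symm)
    have c3 : i ∈ g.1 ∧ k ∈ g.1 := by
      rw [hf] at hxf hyf
      simp only [Finset.mem_insert, Finset.mem_singleton] at hxf hyf
      rcases hxf with rfl | rfl | rfl <;> rcases hyf with rfl | rfl | rfl <;> tauto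
    have := key f₃ i k (Ne.symm hf3) hik hi' hk' c3.1 c3.2 h3i h3k
    subst this
    exact ⟨(Conn.of_adj hg hi' c3.1).trans h13.symm, (Conn.of_adj hg hk' c3.2).trans h23.symm⟩
  obtain ⟨ha, hc⟩ := hac
  have how := face_ori_ne_zero hw hF f.2 hi' hj' hk' hij hik hjk
  have ho := hW.ori_ne_zero (f := f) (g := f) (h := f) how
  rw [← hW.eq_of_conn i f f₁ hi' ha, ← hW.eq_of_conn k f f₂ hk' hc] at hempty
  have b := barycentric ho (W f₁ j)
  have hs := ori_sum (W f i) (W f j) (W f k) (W f₁ j)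
  have hβ : 0 < ori (W f i) (W f₁ j) (W f k) / ori (W f i) (W f j) (W f k) := by
    have e1 := hW.ori_pos f f f i j k how
    have e2 := hW.ori_pos f f₁ f i j k how
    have : ori (W f i) (W f₁ j) (W f k) / ori (W f i) (W f j) (W f k) =
        (ori (W f i) (W f₁ j) (W f k) * ori (w i) (w j) (w k)) /
          (ori (W f i) (W f j) (W f k) * ori (w i) (w j) (w k)) := by field_simp
    rw [this]; exact div_pos e2 e1
  have hsum : ori (W f₁ j) (W f j) (W f k) / ori (W f i) (W f j) (W f k) +
      ori (W f i) (W f₁ j) (W f k) / ori (W f i) (W f j) (W f k) +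
      ori (W f i) (W f j) (W f₁ j) / ori (W f i) (W f j) (W f k) = 1 := by
    rw [← add_div, ← add_div, hs, div_self ho]
  generalize ori (W f₁ j) (W f j) (W f k) / ori (W f i) (W f j) (W f k) = α at b hsum
  generalize ori (W f i) (W f₁ j) (W f k) / ori (W f i) (W f j) (W f k) = β at b hβ hsum
  generalize ori (W f i) (W f j) (W f₁ j) / ori (W f i) (W f j) (W f k) = γ at b hsum
  -- The line that separates `f` from `f₁` passes through the corner `i`, which they share, and has
  -- the two copies of `j` strictly on different sides. The same argument with `f₂` and the corner
  -- `k` gives the sign of `α`.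
  have hγ : γ < 0 := by
    obtain ⟨u, c, q1, q2, q3, q4⟩ := hW.exists_sep hf1
    have u1 : u (W f i) = c := (q3 i hi').2 ⟨h1i, ha⟩
    have u2 : c < u (W f j) := lt_of_le_of_ne (q1 j hj') fun h => hj ((q3 j hj').1 h.symm).2
    have u3 : c ≤ u (W f k) := q1 k hk'
    have u4 : u (W f₁ j) < c := lt_of_le_of_ne (q2 j h1j) fun h => hj ((q4 j h1j).1 h).2
    rw [b] at u4
    simp only [map_add, map_smul, smul_eq_mul, u1] at u4
    by_contra hn
    have := mul_le_mul_of_nonneg_left u3 (not_lt.1 hn)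
    have := mul_lt_mul_of_pos_left u2 hβ
    have : α * c + β * c + γ * c = c := by rw [← add_mul, ← add_mul, hsum, one_mul]
    linarith
  have hα : α < 0 := by
    obtain ⟨u, c, q1, q2, q3, q4⟩ := hW.exists_sep hf2
    have hj2 : ¬ Conn H j f f₂ := fun h => hj (h.trans h12.symm)
    have u1 : u (W f k) = c := (q3 k hk').2 ⟨h2k, hc⟩
    have u2 : c < u (W f j) := lt_of_le_of_ne (q1 j hj') fun h => hj2 ((q3 j hj').1 h.symm).2
    have u3 : c ≤ u (W f i) := q1 i hi'
    have u4 : u (W f₂ j) < c := lt_of_le_of_ne (q2 j h2j) fun h => hj2 ((q4 j h2j).1 h).2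
    rw [← hW.eq_of_conn j f₁ f₂ h1j h12, b] at u4
    simp only [map_add, map_smul, smul_eq_mul, u1] at u4
    by_contra hn
    have := mul_le_mul_of_nonneg_left u3 (not_lt.1 hn)
    have := mul_lt_mul_of_pos_left u2 hβ
    have : α * c + β * c + γ * c = c := by rw [← add_mul, ← add_mul, hsum, one_mul]
    linarith
  -- The displaced copy of `j` has coordinates `α, γ < 0 < β` with respect to the copy of `f`.
  -- Solved for `W f j`, this is a combination with positive coefficients, so `W f j` is inside the
  -- triangle.
  have e2 := (ori_comb (a := W f i) (b := W f j) (c := W f k) hsum).2.1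
  rw [← b] at e2
  refine hempty ((interior_triangle (by rw [e2]; exact mul_ne_zero hβ.ne' ho)).2 ?_)
  obtain rfl : β = 1 - α - γ := by linarith
  have e1 : ori (W f j) (W f₁ j) (W f k) = -α * ori (W f i) (W f j) (W f k) := by
    rw [b]; simp only [ori_eq, PiLp.add_apply, PiLp.smul_apply, smul_eq_mul]; ring
  have e3 : ori (W f i) (W f₁ j) (W f j) = -γ * ori (W f i) (W f j) (W f k) := by
    rw [b]; simp only [ori_eq, PiLp.add_apply, PiLp.smul_apply, smul_eq_mul]; ring
  rw [e1, e2, e3]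
  have hpos := mul_self_pos.2 ho
  refine ⟨?_, ?_, ?_⟩
  · have := mul_pos (mul_pos (neg_pos.2 hα) hβ) hpos; linarith
  · have := mul_pos hβ hpos; linarith
  · have := mul_pos (mul_pos (neg_pos.2 hγ) hβ) hpos; linarith

/-- The faces of the cut complex are the copies of the faces. -/
lemma emptyTriangles_eq [DecidableEq V'] (hW : IsCutDrawing w H W) (hw : IsPlaneDrawing G w)
    (hF : emptyTriangles G w = F) (hH : SharesEdges H) (hconn : H.Connected)
    (hV : ∀ i, ∃ f : {f // f ∈ F}, i ∈ f.1) :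
    emptyTriangles Λ.graph (Λ.draw W) = range Λ.liftFace := by
  ext s
  constructor
  · rintro ⟨a, b, c, ⟨f₁, i₀, j₀, h1i, h1j, hij, rfl, rfl⟩, ⟨f₃, i, k₀, h3i, h3k, hik, e1, rfl⟩,
      ⟨f₂, j, k, h2j, h2k, hjk, e2, e3⟩, rfl, hempty⟩
    obtain ⟨rfl, h13⟩ := (Λ.lab_eq h3i h1i).1 e1
    obtain ⟨rfl, h12⟩ := (Λ.lab_eq h2j h1j).1 e2
    obtain ⟨rfl, h23⟩ := (Λ.lab_eq h2k h3k).1 e3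
    rw [draw_lab hW h1i, draw_lab hW h1j, draw_lab hW h3k] at hempty
    have hcorner : ∀ f : {f // f ∈ F}, ∀ x ∈ f.1,
        W f x ∉ interior (convexHull ℝ {W f₁ i, W f₁ j, W f₃ k}) := by
      intro f x hx
      rw [← draw_lab (Λ := Λ) hW hx]
      exact hempty _
    -- A vertex inside the triangle `ijk` of the old drawing stays inside: `ori_pos` preserves the
    -- signs of all areas, from whichever faces the corners are taken.
    have hmem : {i, j, k} ∈ emptyTriangles G w := by
      by_contra hn
      have a1 := face_adj hF f₁.2 h1i h1j hij
      have a2 := face_adj hF f₃.2 h3i h3k hik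
      have a3 := face_adj hF f₂.2 h2j h2k hjk
      have : ∃ l, w l ∈ interior (convexHull ℝ {w i, w j, w k}) := by
        by_contra! h
        exact hn ⟨i, j, k, a1, a2, a3, rfl, h⟩
      obtain ⟨l, hl⟩ := this
      have ho := hw.ori_ne_zero a1 a2 a3
      rw [interior_triangle ho] at hl
      obtain ⟨g, hg⟩ := hV l
      refine hcorner g l hg ((interior_triangle (hW.ori_ne_zero ho)).2 ?_)
      have e0 := hW.ori_pos f₁ f₁ f₃ i j k ho
      have key : ∀ p q p' o : ℝ, 0 < p * o → 0 < p' * p → 0 < q * o → 0 < p' * q := by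
        intro p q p' o h1 h2 h3
        have h4 : 0 < (p' * q) * (p * o) ^ 2 := by
          have := mul_pos (mul_pos h2 h1) h3
          have h5 : p ≠ 0 := by rintro rfl; simp at h1
          have h6 := mul_pos this (mul_self_pos.2 h5)
          have h7 : (p' * q) * (p * o) ^ 2 = p' * p * (p * o) * (q * o) := by ring
          rw [h7]; exact this
        exact pos_of_mul_pos_left h4 (sq_nonneg _)
      refine ⟨?_, ?_, ?_⟩
      · exact key _ _ _ _ hl.1 (hW.ori_pos g f₁ f₃ l j k (by intro h; simp [h] at hl)) e0
      · exact key _ _ _ _ hl.2.1 (hW.ori_pos f₁ g f₃ i l k (by intro h; simp [h] at hl)) e0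
      · exact key _ _ _ _ hl.2.2 (hW.ori_pos f₁ f₁ g i j l (by intro h; simp [h] at hl)) e0
    rw [hF] at hmem
    let f : {f // f ∈ F} := ⟨{i, j, k}, hmem⟩
    have hi : i ∈ f.1 := by simp [f]
    have hj : j ∈ f.1 := by simp [f]
    have hk : k ∈ f.1 := by simp [f]
    have wi := hW.eq_of_conn i f₃ f₁ h3i h13
    have wj := hW.eq_of_conn j f₂ f₁ h2j h12
    have wk := hW.eq_of_conn k f₂ f₃ h2k h23
    -- The triangle lies over the face `f`. If one of its corners is not the corner of the copy of
    -- `f`, then `false_of_not_lift` applies, with this corner in the role of `j`.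
    have c1 : Conn H i f f₁ := by
      by_contra h
      refine false_of_not_lift (f₁ := f₁) (f₂ := f₃) (f₃ := f₂) (i := j) (j := i) (k := k)
        hW hw hF hH hconn (f := f)
        (by simp only [f]; ext; simp; tauto) hij.symm hjk hik h1j h1i h3i h3k h2j h2k
        h12.symm h13.symm h23.symm h ?_
      have := hcorner f i hi
      rwa [Set.insert_comm] at this
    have c2 : Conn H j f f₁ := by
      by_contra h
      refine false_of_not_lift (f₁ := f₁) (f₂ := f₂) (f₃ := f₃) (i := i) (j := j) (k := k)
        hW hw hF hH hconn (f := f) rfl hij hik hjk h1i h1j h2j h2k h3i h3k h13.symm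
        h12.symm h23 h ?_
      rw [wk]
      exact hcorner f j hj
    have c3 : Conn H k f f₃ := by
      by_contra h
      refine false_of_not_lift (f₁ := f₃) (f₂ := f₂) (f₃ := f₁) (i := i) (j := k) (k := j)
        hW hw hF hH hconn (f := f)
        (by simp only [f]; ext; simp; tauto) hik hij hjk.symm h3i h3k h2k h2j h1i h1j
        h13 h23.symm h12 h ?_
      rw [wi, wj]
      have := hcorner f k hk
      rwa [Set.pair_comm (W f₁ j)] at this
    refine ⟨f, ?_⟩
    simp only [liftFace, f, Finset.image_insert, Finset.image_singleton]
    rw [(Λ.lab_eq hi h1i).2 ⟨rfl, c1⟩, (Λ.lab_eq hj h1j).2 ⟨rfl, c2⟩,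
      (Λ.lab_eq hk h3k).2 ⟨rfl, c3⟩]
  · rintro ⟨f, rfl⟩
    obtain ⟨i, j, k, h1, h2, h3, h4, -⟩ := face_spec hF f.2
    have hi : i ∈ f.1 := by simp [h4]
    have hj : j ∈ f.1 := by simp [h4]
    have hk : k ∈ f.1 := by simp [h4]
    refine ⟨Λ.lab f i, Λ.lab f j, Λ.lab f k, ⟨f, i, j, hi, hj, h1.ne, rfl, rfl⟩,
      ⟨f, i, k, hi, hk, h2.ne, rfl, rfl⟩, ⟨f, j, k, hj, hk, h3.ne, rfl, rfl⟩, ?_, ?_⟩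
    · rw [liftFace, h4]; simp
    · intro l
      obtain ⟨g, x, hx, rfl⟩ := Λ.surj l
      rw [draw_lab hW hx, draw_lab hW hi, draw_lab hW hj, draw_lab hW hk]
      exact hW.notMem_interior hw hF h4 h1.ne h2.ne h3.ne hx

end Labeling
end drawing

/-! ### The cut truss and its rigidity graph -/

section truss
variable {n : ℕ} {T : Truss n} {H : SimpleGraph T.Face}

lemma Truss.exists_drawing (T : Truss n) :
    ∃ w, IsPlaneDrawing T.graph w ∧ emptyTriangles T.graph w = (T.faces : Set (Finset (Fin n))) := by
  obtain ⟨w, -, h1, h2⟩ := T.planar 1 one_pos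
  exact ⟨w, h1, h2⟩

lemma Truss.adj_of_mem_face {f : Finset (Fin n)} (hf : f ∈ T.faces) {i j : Fin n} (hi : i ∈ f)
    (hj : j ∈ f) (hij : i ≠ j) : T.graph.Adj i j := by
  obtain ⟨w, h1, h2⟩ := T.exists_drawing
  exact face_adj h2 hf hi hj hij

lemma Truss.card_face {f : Finset (Fin n)} (hf : f ∈ T.faces) : f.card = 3 := by
  obtain ⟨w, h1, h2⟩ := T.exists_drawing
  exact face_card h2 hf

lemma Truss.not_three_faces {f g h : T.Face} (hfg : f ≠ g) (hfh : f ≠ h)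
    (hgh : g ≠ h) {i j : Fin n} (hij : i ≠ j) (hif : i ∈ f.1) (hjf : j ∈ f.1) (hig : i ∈ g.1)
    (hjg : j ∈ g.1) (hih : i ∈ h.1) (hjh : j ∈ h.1) : False := by
  obtain ⟨w, h1, h2⟩ := T.exists_drawing
  exact Fretsaw.not_three_faces h1 h2 f.2 g.2 h.2 (fun h => hfg (Subtype.ext h))
    (fun h => hfh (Subtype.ext h)) (fun h => hgh (Subtype.ext h)) hij hif hjf hig hjg hih hjh

lemma Truss.rigidityGraph_adj {f g : T.Face} : T.rigidityGraph.Adj f g ↔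
    f ≠ g ∧ ∃ i j, i ≠ j ∧ i ∈ f.1 ∧ j ∈ f.1 ∧ i ∈ g.1 ∧ j ∈ g.1 := by
  constructor
  · rintro ⟨h, i, j, hij, h'⟩
    exact ⟨h, i, j, hij.ne, h'⟩
  · rintro ⟨h, i, j, hij, h1, h2, h'⟩
    exact ⟨h, i, j, T.adj_of_mem_face f.2 h1 h2 hij, h1, h2, h'⟩

lemma sharesEdges_of_le (hH : H ≤ T.rigidityGraph) : SharesEdges H :=
  fun _ _ h => (Truss.rigidityGraph_adj.1 (hH h)).2

lemma Truss.StifflyConnected.exists_face (hT : T.StifflyConnected) (i : Fin n) :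
    ∃ f : T.Face, i ∈ f.1 := by
  obtain ⟨f⟩ := (hT.2 i).nonempty
  exact ⟨f.1, f.2⟩

/-- In the cut complex, the faces `f` and `g` share an edge. -/
def Glued (H : SimpleGraph T.Face) (f g : T.Face) : Prop :=
  f ≠ g ∧ ∃ i j, i ≠ j ∧ i ∈ f.1 ∧ j ∈ f.1 ∧ i ∈ g.1 ∧ j ∈ g.1 ∧ Conn H i f g ∧ Conn H j f g

namespace Labeling
variable {m : ℕ} (Λ : Labeling H (Fin m))

lemma mem_liftFace {f : T.Face} {a : Fin m} : a ∈ Λ.liftFace f ↔ ∃ i ∈ f.1, Λ.lab f i = a := by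
  simp [liftFace]

lemma lab_mem_liftFace {f g : T.Face} {i : Fin n} (hi : i ∈ f.1) :
    Λ.lab f i ∈ Λ.liftFace g ↔ i ∈ g.1 ∧ Conn H i f g := by
  rw [mem_liftFace]
  constructor
  · rintro ⟨j, hj, h⟩
    obtain ⟨rfl, h'⟩ := (Λ.lab_eq hj hi).1 h
    exact ⟨hj, Conn.symm h'⟩
  · rintro ⟨h1, h2⟩
    exact ⟨i, h1, ((Λ.lab_eq hi h1).2 ⟨rfl, h2⟩).symm⟩

lemma image_proj_liftFace (f : T.Face) : (Λ.liftFace f).image Λ.proj = f.1 := by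
  ext i
  simp only [liftFace, Finset.mem_image, exists_exists_and_eq_and]
  constructor
  · rintro ⟨j, hj, rfl⟩
    rwa [Λ.proj_lab hj]
  · intro hi
    exact ⟨i, hi, Λ.proj_lab hi⟩

lemma liftFace_injective : Function.Injective Λ.liftFace := by
  intro f g h
  apply Subtype.ext
  rw [← Λ.image_proj_liftFace f, h, Λ.image_proj_liftFace]

/-- The truss obtained by cutting `T` along the rigidity edges not in `H`. -/
noncomputable def truss (hT : T.StifflyConnected) (hH : H ≤ T.rigidityGraph)
    (hc : H.Connected) : Truss m where
  pos a := T.pos (Λ.proj a)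
  graph := Λ.graph
  weight e := T.weight (e.map Λ.proj)
  faces := Finset.univ.image Λ.liftFace
  weight_pos := by
    intro e
    induction e with
    | _ a b =>
      rintro ⟨f, i, j, hi, hj, hij, rfl, rfl⟩
      rw [Sym2.map_mk, Λ.proj_lab hi, Λ.proj_lab hj]
      exact T.weight_pos _ (T.adj_of_mem_face f.2 hi hj hij)
  pos_ne := by
    rintro _ _ ⟨f, i, j, hi, hj, hij, rfl, rfl⟩
    rw [Λ.proj_lab hi, Λ.proj_lab hj]
    exact T.pos_ne _ _ (T.adj_of_mem_face f.2 hi hj hij)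
  planar := by
    intro ε hε
    obtain ⟨w, h1, hw, hF⟩ := T.planar (ε / 2) (half_pos hε)
    obtain ⟨W, hW, h2⟩ := exists_cutDrawing hw hF (sharesEdges_of_le hH) (half_pos hε)
    refine ⟨Λ.draw W, fun a => ?_, isPlaneDrawing hW hw hF, ?_⟩
    · obtain ⟨f, i, hi, rfl⟩ := Λ.surj a
      rw [draw_lab hW hi, Λ.proj_lab hi]
      calc dist (W f i) (T.pos i) ≤ dist (W f i) (w i) + dist (w i) (T.pos i) := dist_triangle _ _ _
        _ < ε / 2 + ε / 2 := add_lt_add (h2 f i) (h1 i)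
        _ = ε := add_halves ε
    · rw [emptyTriangles_eq hW hw hF (sharesEdges_of_le hH) hc hT.exists_face]
      simp
  edge_mem_face := by
    rintro _ _ ⟨f, i, j, hi, hj, hij, rfl, rfl⟩
    exact ⟨Λ.liftFace f, Finset.mem_image_of_mem _ (Finset.mem_univ f),
      Λ.mem_liftFace.2 ⟨i, hi, rfl⟩, Λ.mem_liftFace.2 ⟨j, hj, rfl⟩⟩

variable (hT : T.StifflyConnected) (hH : H ≤ T.rigidityGraph) (hc : H.Connected)

/-- The correspondence between the faces of the cut truss and the faces of the truss. -/
noncomputable def faceEquiv : (Λ.truss hT hH hc).Face ≃ T.Face :=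
  (Equiv.ofBijective
    (fun f : T.Face => (⟨Λ.liftFace f, Finset.mem_image_of_mem _ (Finset.mem_univ f)⟩ :
      (Λ.truss hT hH hc).Face))
    ⟨fun _ _ h => Λ.liftFace_injective (congrArg Subtype.val h), fun f => by
      obtain ⟨g, -, hg⟩ := Finset.mem_image.1 f.2
      exact ⟨g, Subtype.ext hg⟩⟩).symm

@[simp] lemma faceEquiv_symm_coe (f : T.Face) :
    ((Λ.faceEquiv hT hH hc).symm f).1 = Λ.liftFace f := rfl

lemma coe_eq_liftFace (f : (Λ.truss hT hH hc).Face) :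
    f.1 = Λ.liftFace (Λ.faceEquiv hT hH hc f) := by
  rw [← Λ.faceEquiv_symm_coe hT hH hc, Equiv.symm_apply_apply]

lemma rigidityGraph_truss_adj (f g : (Λ.truss hT hH hc).Face) :
    (Λ.truss hT hH hc).rigidityGraph.Adj f g ↔
      Glued H (Λ.faceEquiv hT hH hc f) (Λ.faceEquiv hT hH hc g) := by
  rw [Truss.rigidityGraph_adj, Glued, (Λ.faceEquiv hT hH hc).injective.ne_iff,
    Λ.coe_eq_liftFace hT hH hc f, Λ.coe_eq_liftFace hT hH hc g]
  refine and_congr_right fun _ => ?_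
  constructor
  · rintro ⟨a, b, hab, h1, h2, h3, h4⟩
    obtain ⟨i, hi, rfl⟩ := Λ.mem_liftFace.1 h1
    obtain ⟨j, hj, rfl⟩ := Λ.mem_liftFace.1 h2
    rw [Λ.lab_mem_liftFace hi] at h3
    rw [Λ.lab_mem_liftFace hj] at h4
    exact ⟨i, j, fun h => hab (by rw [h]), hi, hj, h3.1, h4.1, h3.2, h4.2⟩
  · rintro ⟨i, j, hij, h1, h2, h3, h4, h5, h6⟩
    exact ⟨_, _, fun h => hij ((Λ.lab_eq h1 h2).1 h).1, (Λ.lab_mem_liftFace h1).2 ⟨h1, Conn.refl _⟩,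
      (Λ.lab_mem_liftFace h2).2 ⟨h2, Conn.refl _⟩, (Λ.lab_mem_liftFace h1).2 ⟨h3, h5⟩,
      (Λ.lab_mem_liftFace h2).2 ⟨h4, h6⟩⟩

lemma comap_le_rigidityGraph : H.comap (Λ.faceEquiv hT hH hc) ≤ (Λ.truss hT hH hc).rigidityGraph := by
  intro f g h
  rw [rigidityGraph_truss_adj]
  have h : H.Adj _ _ := h
  obtain ⟨i, j, hij, h1, h2, h3, h4⟩ := sharesEdges_of_le hH _ _ h
  exact ⟨h.ne, i, j, hij, h1, h2, h3, h4, Conn.of_adj h h1 h3, Conn.of_adj h h2 h4⟩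

/-- The rigidity graph contains the copy of `H`, and the faces at a copy of a vertex are one
component of `H` there, linked to each other by links of `H` at that vertex. -/
lemma truss_stifflyConnected : (Λ.truss hT hH hc).StifflyConnected := by
  constructor
  · have : (H.comap (Λ.faceEquiv hT hH hc)).Connected :=
      (SimpleGraph.Iso.comap (Λ.faceEquiv hT hH hc) H).connected_iff.2 hc
    exact this.mono (Λ.comap_le_rigidityGraph hT hH hc)
  · intro a
    obtain ⟨f, i, hi, rfl⟩ := Λ.surj a
    set Q := (Λ.truss hT hH hc).rigidityGraph.induce {g | Λ.lab f i ∈ g.1}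
    have hmem : ∀ {g : T.Face}, Conn H i f g →
        (Λ.faceEquiv hT hH hc).symm g ∈ {g : (Λ.truss hT hH hc).Face | Λ.lab f i ∈ g.1} := by
      intro g h
      exact (Λ.lab_mem_liftFace hi).2 ⟨h.mem hi, h⟩
    have key : ∀ g (h : Conn H i f g), Q.Reachable ⟨_, hmem (Conn.refl f)⟩ ⟨_, hmem h⟩ := by
      intro g h
      induction h with
      | refl => exact SimpleGraph.Reachable.refl _
      | @tail x y h1 h2 ih =>
        refine ih.trans (SimpleGraph.Adj.reachable ?_)
        refine Λ.comap_le_rigidityGraph hT hH hc ?_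
        simpa using h2.1
    have key' : ∀ g : {g : (Λ.truss hT hH hc).Face | Λ.lab f i ∈ g.1},
        Q.Reachable ⟨_, hmem (Conn.refl f)⟩ g := by
      rintro ⟨g, hg⟩
      have h := hg
      simp only [mem_ofPred_eq] at h
      rw [Λ.coe_eq_liftFace hT hH hc g, Λ.lab_mem_liftFace hi] at h
      have := key _ h.2
      simpa using this
    exact { preconnected := fun x y => (key' x).symm.trans (key' y)
            nonempty := ⟨⟨_, hmem (Conn.refl f)⟩⟩ }

lemma isFretsawExtension (hnm : n ≤ m) (horig : ∀ i : Fin n, ∃ f : T.Face, i ∈ f.1 ∧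
    Λ.lab f i = Fin.castLE hnm i) :
    IsFretsawExtension T (Λ.truss hT hH hc) (Λ.faceEquiv hT hH hc) Λ.proj where
  le := hnm
  surjective i := by
    obtain ⟨f, hi⟩ := hT.exists_face i
    exact ⟨_, Λ.proj_lab hi⟩
  pos_eq _ := rfl
  face_eq f := by rw [Λ.coe_eq_liftFace hT hH hc f, Λ.image_proj_liftFace]
  weight_eq i j _ := rfl
  original i := by
    obtain ⟨f, hi, h⟩ := horig i
    rw [← h, Λ.proj_lab hi]

end Labeling
end truss

/-! ### An edge on the outer boundary -/

section boundary
variable {V : Type} [Finite V] [DecidableEq V] {G : SimpleGraph V} {w : V → Plane}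
  {F : Finset (Finset V)}

/-- Some edge is in only one face. -/
lemma exists_boundary_edge (hw : IsPlaneDrawing G w) (hF : emptyTriangles G w = F)
    (hne : F.Nonempty) (hV : ∀ i, ∃ f ∈ F, i ∈ f) :
    ∃ f ∈ F, ∃ i ∈ f, ∃ j ∈ f, i ≠ j ∧ ∀ g ∈ F, i ∈ g → j ∈ g → g = f := by
  obtain ⟨f₀, hf₀⟩ := hne
  obtain ⟨v₀, _, _, -, -, -, hv₀, -⟩ := face_spec hF hf₀
  have : Nonempty V := ⟨v₀⟩
  obtain ⟨u, hu⟩ := Finite.exists_max fun v => (w v 0) ^ 2 + (w v 1) ^ 2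
  set W := w u
  -- `u` is a vertex farthest from the origin. Seen from there, `p` measures (up to the factor
  -- `|W|`) how far a vertex is behind the tangent to the circle through `W`, so it is positive away
  -- from `u`, and `q` measures along the tangent. The largest quotient `q / p` belongs to an
  -- outermost edge at `u`.
  let p : V → ℝ := fun z => -(W 0 * (w z 0 - W 0) + W 1 * (w z 1 - W 1))
  let q : V → ℝ := fun z => W 0 * (w z 1 - W 1) - W 1 * (w z 0 - W 0)
  have hp : ∀ z, z ≠ u → 0 < p z := by
    intro z hz
    have h1 := hu z
    simp only at h1
    have h2 : w z 0 - W 0 ≠ 0 ∨ w z 1 - W 1 ≠ 0 := by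
      by_contra! h
      exact hz (hw.injective (plane_ext (by linarith [h.1]) (by linarith [h.2])))
    have h3 : 0 < (w z 0 - W 0) ^ 2 + (w z 1 - W 1) ^ 2 := by
      rcases h2 with h | h
      · have := pow_pos (abs_pos.2 h) 2; rw [sq_abs] at this
        linarith [sq_nonneg (w z 1 - W 1)]
      · have := pow_pos (abs_pos.2 h) 2; rw [sq_abs] at this
        linarith [sq_nonneg (w z 0 - W 0)]
    simp only [p]
    nlinarith
  obtain ⟨f, hf, huf⟩ := hV u
  obtain ⟨b, hbf, hbu⟩ := Finset.exists_mem_ne (by rw [face_card hF hf]; omega : 1 < f.card) u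
  obtain ⟨a, ⟨f, hf, huf, haf, hau⟩, hmax⟩ := Set.Finite.exists_maximalFor (fun z => q z / p z)
    {z | ∃ f ∈ F, u ∈ f ∧ z ∈ f ∧ z ≠ u} (Set.toFinite _) ⟨b, f, hf, huf, hbf, hbu⟩
  refine ⟨f, hf, u, huf, a, haf, hau.symm, fun g hg hug hag => ?_⟩
  by_contra hgf
  obtain ⟨k, l, h1, h2, h3, h4, h5, rfl, rfl, -⟩ := inter_pair_of_ne (face_card hF hf)
    (face_card hF hg) (Ne.symm hgf) hau.symm huf haf hug hag
  have hlt := ori_neg_of_inter_pair hw hF hf hg hau.symm h1 h2 h3 h4 h5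
  -- All vertices of faces at `u` are on one closed side of the line through `u` and `a`, whereas
  -- two faces with this edge would have third corners strictly on both sides.
  have hnn : ∀ z, (∃ f ∈ F, u ∈ f ∧ z ∈ f ∧ z ≠ u) → 0 ≤ ori (w u) (w a) (w z) := by
    intro z hz
    have hzu : z ≠ u := by obtain ⟨_, _, _, _, h⟩ := hz; exact h
    have hle : q z / p z ≤ q a / p a := by
      by_contra hc
      exact hc (hmax hz (not_le.1 hc).le)
    rw [div_le_div_iff₀ (hp z hzu) (hp a hau)] at hle
    have e : (W 0 ^ 2 + W 1 ^ 2) * ori (w u) (w a) (w z) = q a * p z - q z * p a := by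
      simp only [ori_eq, p, q, W]; ring
    have hW : 0 < W 0 ^ 2 + W 1 ^ 2 := by
      have := hp a hau
      by_contra hc
      have h0 : W 0 = 0 := by nlinarith [sq_nonneg (W 0), sq_nonneg (W 1)]
      have h1 : W 1 = 0 := by nlinarith [sq_nonneg (W 0), sq_nonneg (W 1)]
      simp [p, h0, h1] at this
    have : 0 ≤ (W 0 ^ 2 + W 1 ^ 2) * ori (w u) (w a) (w z) := by rw [e]; linarith
    exact nonneg_of_mul_nonneg_right this hW
  have e1 := hnn k ⟨_, hf, huf, by simp, h1⟩
  have e2 := hnn l ⟨_, hg, hug, by simp, h3⟩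
  exact absurd hlt (not_lt.2 (mul_nonneg e1 e2))

end boundary

/-! ### Cycles of faces around a vertex -/

section cycles
variable {n : ℕ} {T : Truss n} {H : SimpleGraph T.Face}

/-- A face has at most two neighbours at each of its corners. -/
lemma Truss.eq_or_eq_of_adj {i : Fin n} {x u v y : T.Face} (hx : i ∈ x.1)
    (hu : T.rigidityGraph.Adj x u) (hui : i ∈ u.1) (hv : T.rigidityGraph.Adj x v) (hvi : i ∈ v.1)
    (huv : u ≠ v) (hy : T.rigidityGraph.Adj x y) (hyi : i ∈ y.1) : y = u ∨ y = v := by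
  by_contra! hc
  have key : ∀ y : T.Face, T.rigidityGraph.Adj x y → i ∈ y.1 → ∃ j, j ≠ i ∧ j ∈ x.1 ∧ j ∈ y.1 := by
    intro y hy hyi
    obtain ⟨-, a, b, hab, h1, h2, h3, h4⟩ := Truss.rigidityGraph_adj.1 hy
    by_cases ha : a = i
    · exact ⟨b, fun h => hab (ha.trans h.symm), h2, h4⟩
    · exact ⟨a, ha, h1, h3⟩
  -- Each of three neighbours would share one of the two sides of `x` at `i`. Two of them would use
  -- the same side, which is then in three faces.
  obtain ⟨a, b, ha, hb, hba, hset⟩ := exists_triple (T.card_face x.2) hx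
  obtain ⟨j, hji, hjx, hju⟩ := key u hu hui
  obtain ⟨k, hki, hkx, hkv⟩ := key v hv hvi
  obtain ⟨l, hli, hlx, hly⟩ := key y hy hyi
  have hjk : j ≠ k := by
    rintro rfl
    exact Truss.not_three_faces hu.ne hv.ne huv hji hjx hx hju hui hkv hvi
  have hjl : j ≠ l := by
    rintro rfl
    exact Truss.not_three_faces hu.ne hy.ne hc.1.symm hji hjx hx hju hui hly hyi
  have hkl : k ≠ l := by
    rintro rfl
    exact Truss.not_three_faces hv.ne hy.ne hc.2.symm hki hkx hx hkv hvi hly hyi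
  rw [hset] at hjx hkx hlx
  simp only [Finset.mem_insert, Finset.mem_singleton, hji, hki, hli, false_or] at hjx hkx hlx
  rcases hjx with rfl | rfl <;> rcases hkx with rfl | rfl <;> rcases hlx with rfl | rfl <;>
    contradiction

/-- If two faces share an edge with end point `i` and are connected at `i` without being adjacent
in `H`, then the faces at `i` form a cycle and are all linked by `H`, but for these two. -/
lemma cycle_at_vertex (hT : T.StifflyConnected) (hH : H ≤ T.rigidityGraph) {i : Fin n}
    {f g : T.Face} (hf : i ∈ f.1) (hfg : T.rigidityGraph.Adj f g) (hnot : ¬ H.Adj f g)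
    (hc : Conn H i f g) {x : T.Face} (hx : i ∈ x.1) :
    ∃ u v, u ≠ v ∧ (∀ y, T.rigidityGraph.Adj x y ∧ i ∈ y.1 ↔ y = u ∨ y = v) ∧
      ((x = f ∧ u = g ∧ H.Adj x v) ∨ (x = g ∧ u = f ∧ H.Adj x v) ∨
        (x ≠ f ∧ x ≠ g ∧ H.Adj x u ∧ H.Adj x v)) := by
  let Hi : SimpleGraph T.Face :=
    { Adj := fun x y => H.Adj x y ∧ i ∈ x.1 ∧ i ∈ y.1
      symm := ⟨fun _ _ h => ⟨h.1.symm, h.2.2, h.2.1⟩⟩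
      loopless := ⟨fun _ h => h.1.ne rfl⟩ }
  have hg := hc.mem hf
  have hreach : Hi.Reachable f g := by
    clear hnot hfg hg
    induction hc with
    | refl => exact SimpleGraph.Reachable.refl _
    | tail _ h ih => exact ih.trans (SimpleGraph.Adj.reachable h)
  -- A path from `f` to `g` at `i` in `H`, closed by the link between `g` and `f`, gives each of its
  -- faces two neighbours at `i`, and a face has no more than two.
  obtain ⟨p, hp⟩ := hreach.exists_isPath
  have hstep : ∀ t < p.length, Hi.Adj (p.getVert t) (p.getVert (t + 1)) :=
    fun t ht => p.adj_getVert_succ ht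
  have hinj := hp.getVert_injOn
  have hlen : 2 ≤ p.length := by
    by_contra hlt
    have h0 : p.length ≠ 0 := fun h => hfg.ne (SimpleGraph.Walk.eq_of_length_eq_zero h)
    have h1 : p.length = 1 := by omega
    have := hstep 0 (by omega)
    rw [p.getVert_zero, show 0 + 1 = p.length by omega, p.getVert_length] at this
    exact hnot this.1
  have hmemt : ∀ t ≤ p.length, i ∈ (p.getVert t).1 := by
    intro t ht
    rcases Nat.eq_zero_or_pos t with rfl | h
    · rwa [p.getVert_zero]
    · have := (hstep (t - 1) (by omega)).2.2
      rwa [Nat.sub_add_cancel h] at this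
  have hgood : ∀ t ≤ p.length, ∃ u v, u ≠ v ∧
      (∀ y, T.rigidityGraph.Adj (p.getVert t) y ∧ i ∈ y.1 ↔ y = u ∨ y = v) ∧
      ((p.getVert t = f ∧ u = g ∧ H.Adj (p.getVert t) v) ∨
        (p.getVert t = g ∧ u = f ∧ H.Adj (p.getVert t) v) ∨
        (p.getVert t ≠ f ∧ p.getVert t ≠ g ∧ H.Adj (p.getVert t) u ∧ H.Adj (p.getVert t) v)) ∧
      (∃ s ≤ p.length, u = p.getVert s) ∧ ∃ s ≤ p.length, v = p.getVert s := by
    intro t ht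
    have fin : ∀ u v, u ≠ v → T.rigidityGraph.Adj (p.getVert t) u → i ∈ u.1 →
        T.rigidityGraph.Adj (p.getVert t) v → i ∈ v.1 →
        (∀ y, T.rigidityGraph.Adj (p.getVert t) y ∧ i ∈ y.1 ↔ y = u ∨ y = v) := by
      intro u v huv h1 h2 h3 h4 y
      constructor
      · rintro ⟨h5, h6⟩
        exact Truss.eq_or_eq_of_adj (hmemt t ht) h1 h2 h3 h4 huv h5 h6
      · rintro (rfl | rfl)
        · exact ⟨h1, h2⟩
        · exact ⟨h3, h4⟩
    rcases Nat.eq_zero_or_pos t with rfl | hpos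
    · have h1 := hstep 0 (by omega)
      rw [p.getVert_zero] at h1 fin ⊢
      have hne : g ≠ p.getVert (0 + 1) := by
        intro h
        rw [← h] at h1
        exact hnot h1.1
      exact ⟨g, _, hne, fin _ _ hne hfg hg (hH h1.1) h1.2.2, Or.inl ⟨rfl, rfl, h1.1⟩,
        ⟨p.length, le_rfl, p.getVert_length.symm⟩, ⟨_, by omega, rfl⟩⟩
    rcases ht.eq_or_lt with rfl | hlt
    · have h1 := hstep (p.length - 1) (by omega)
      rw [Nat.sub_add_cancel hpos, p.getVert_length] at h1
      rw [p.getVert_length] at fin ⊢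
      have hne : f ≠ p.getVert (p.length - 1) := by
        intro h
        rw [← h] at h1
        exact hnot h1.1
      exact ⟨f, _, hne, fin _ _ hne hfg.symm hf (hH h1.1.symm) h1.2.1,
        Or.inr (Or.inl ⟨rfl, rfl, h1.1.symm⟩), ⟨0, by omega, p.getVert_zero.symm⟩,
        ⟨_, by omega, rfl⟩⟩
    · have h1 := hstep (t - 1) (by omega)
      rw [Nat.sub_add_cancel hpos] at h1
      have h2 := hstep t hlt
      have hne : p.getVert (t - 1) ≠ p.getVert (t + 1) := by
        intro h
        have := hinj (by simp; omega) (by simp; omega) h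
        omega
      refine ⟨_, _, hne, fin _ _ hne (hH h1.1.symm) h1.2.1 (hH h2.1) h2.2.2,
        Or.inr (Or.inr ⟨?_, ?_, h1.1.symm, h2.1⟩), ⟨_, by omega, rfl⟩, ⟨_, by omega, rfl⟩⟩
      · intro h
        have := hinj (by simp; omega) (by simp) (h.trans p.getVert_zero.symm)
        omega
      · intro h
        have := hinj (by simp; omega) (by simp) (h.trans p.getVert_length.symm)
        omega
  -- The path is closed under adjacency at `i`, and the faces at `i` are connected in the rigidity
  -- graph, so there are no others.
  have hall : ∃ t ≤ p.length, x = p.getVert t := by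
    have hreach := (hT.2 i).preconnected ⟨f, hf⟩ ⟨x, hx⟩
    rw [SimpleGraph.reachable_iff_reflTransGen] at hreach
    have key : ∀ y : {y : T.Face | i ∈ y.1}, Relation.ReflTransGen
        (T.rigidityGraph.induce {y : T.Face | i ∈ y.1}).Adj ⟨f, hf⟩ y →
        ∃ t ≤ p.length, y.1 = p.getVert t := by
      intro y h
      induction h with
      | refl => exact ⟨0, by omega, p.getVert_zero.symm⟩
      | @tail y z h1 h2 ih =>
        obtain ⟨t, ht, hy⟩ := ih
        obtain ⟨u, v, -, h3, -, h4, h5⟩ := hgood t ht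
        have h2 : T.rigidityGraph.Adj y.1 z.1 := h2
        rw [hy] at h2
        rcases (h3 z.1).1 ⟨h2, z.2⟩ with h | h
        · rw [h]; exact h4
        · rw [h]; exact h5
    exact key _ hreach
  obtain ⟨t, ht, rfl⟩ := hall
  obtain ⟨u, v, h1, h2, h3, -⟩ := hgood t ht
  exact ⟨u, v, h1, h2, h3⟩

end cycles

/-! ### Counting extra links in the cycle space of `H` -/

section rank
variable {n : ℕ} {T : Truss n} {H : SimpleGraph T.Face}

/-- The pairs of faces that are glued in the cut complex without being adjacent in `H`. -/
def extraLinks (H : SimpleGraph T.Face) : Set (Sym2 T.Face) :=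
  {e | ∃ f g, e = s(f, g) ∧ Glued H f g ∧ ¬ H.Adj f g}

open Classical in
/-- The indicator function of the common corners of the faces in `e`. -/
noncomputable def common (e : Sym2 T.Face) (v : Fin n) : ZMod 2 :=
  if ∀ f ∈ e, v ∈ f.1 then 1 else 0

open Classical in
/-- The incidence matrix of the edges and vertices of `H`. -/
noncomputable def incid (H : SimpleGraph T.Face) : Matrix H.edgeSet T.Face (ZMod 2) :=
  fun h f => if f ∈ h.1 then 1 else 0

/-- The numbers modulo 2 of common corners of edges of `H` and extra links. -/
noncomputable def cycleMatrix (H : SimpleGraph T.Face) :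
    Matrix H.edgeSet (extraLinks H) (ZMod 2) :=
  fun h e => ∑ v, common h.1 v * common e.1 v

lemma common_mk {f g : T.Face} {v : Fin n} [Decidable (v ∈ f.1 ∧ v ∈ g.1)] :
    common s(f, g) v = if v ∈ f.1 ∧ v ∈ g.1 then 1 else 0 := by
  simp [common]

lemma Glued.adj {f g : T.Face} (h : Glued H f g) : T.rigidityGraph.Adj f g := by
  obtain ⟨h, i, j, hij, h1, h2, h3, h4, -⟩ := h
  exact Truss.rigidityGraph_adj.2 ⟨h, i, j, hij, h1, h2, h3, h4⟩

lemma Glued.exists_pair {f g : T.Face} (h : Glued H f g) :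
    ∃ i j, i ≠ j ∧ (∀ v, v ∈ f.1 ∧ v ∈ g.1 ↔ v = i ∨ v = j) ∧ Conn H i f g ∧ Conn H j f g := by
  obtain ⟨hne, i, j, hij, h1, h2, h3, h4, h5, h6⟩ := h
  obtain ⟨k, l, -, -, -, -, -, -, -, h7⟩ := inter_pair_of_ne (T.card_face f.2) (T.card_face g.2)
    (fun h => hne (Subtype.ext h)) hij h1 h2 h3 h4
  refine ⟨i, j, hij, fun v => ?_, h5, h6⟩
  rw [← Finset.mem_inter, h7]; simp

lemma Glued.conn {f g : T.Face} (h : Glued H f g) {i : Fin n} (hf : i ∈ f.1) (hg : i ∈ g.1) :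
    Conn H i f g := by
  obtain ⟨a, b, -, h1, h2, h3⟩ := h.exists_pair
  rcases (h1 i).1 ⟨hf, hg⟩ with rfl | rfl
  · exact h2
  · exact h3

open Classical in
-- The sum is the degree of `x`, modulo 2, in the graph of the links of `H` at `i`. By
-- `cycle_at_vertex` this graph is a path from `f` to `g` through all faces at `i`.
lemma sum_common_eq (hT : T.StifflyConnected) (hH : H ≤ T.rigidityGraph) [Fintype H.edgeSet]
    {i : Fin n} {f g : T.Face} (hfg : Glued H f g) (hnot : ¬ H.Adj f g) (hf : i ∈ f.1)
    (hg : i ∈ g.1) (x : T.Face) :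
    ∑ h, incid H h x * common h.1 i = if x = f ∨ x = g then 1 else 0 := by
  have h1 : ∑ h, incid H h x * common h.1 i =
      ((Finset.univ.filter fun y => H.Adj x y ∧ i ∈ x.1 ∧ i ∈ y.1).card : ZMod 2) := by
    rw [Finset.card_eq_sum_ones, Nat.cast_sum, Finset.sum_filter]
    have : ∀ h : H.edgeSet, incid H h x * common h.1 i =
        if x ∈ h.1 ∧ ∀ f ∈ h.1, i ∈ f.1 then 1 else 0 := by
      intro h; unfold incid common
      by_cases h1 : x ∈ h.1 <;> by_cases h2 : ∀ f ∈ h.1, i ∈ f.1 <;> simp [h1]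
    rw [Finset.sum_congr rfl fun h _ => this h, ← Finset.sum_filter, ← Finset.sum_filter]
    symm
    refine Finset.sum_bij (fun y hy => ⟨s(x, y), (Finset.mem_filter.1 hy).2.1⟩) ?_ ?_ ?_ ?_
    · intro y hy
      have := (Finset.mem_filter.1 hy).2
      refine Finset.mem_filter.2 ⟨Finset.mem_univ _, by simp, ?_⟩
      intro f hf
      rcases Sym2.mem_iff.1 hf with rfl | rfl
      · exact this.2.1
      · exact this.2.2
    · intro y hy z hz h
      exact Sym2.congr_right.1 (congrArg Subtype.val h)
    · rintro ⟨h, hh⟩ hm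
      have hm := (Finset.mem_filter.1 hm).2
      obtain ⟨y, rfl⟩ := Sym2.mem_iff_exists.1 hm.1
      refine ⟨y, Finset.mem_filter.2 ⟨Finset.mem_univ _, hh, hm.2 _ hm.1, hm.2 y (by simp)⟩, rfl⟩
    · simp
  rw [h1]
  by_cases hx : i ∈ x.1
  · obtain ⟨u, v, huv, h2, h3⟩ := cycle_at_vertex hT hH hf hfg.adj hnot (hfg.conn hf hg) hx
    have hsub : ∀ y, H.Adj x y ∧ i ∈ x.1 ∧ i ∈ y.1 → y = u ∨ y = v :=
      fun y h => (h2 y).1 ⟨hH h.1, h.2.2⟩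
    rcases h3 with ⟨rfl, rfl, hv⟩ | ⟨rfl, rfl, hv⟩ | ⟨h4, h5, hu, hv⟩
    · have : (Finset.univ.filter fun y => H.Adj x y ∧ i ∈ x.1 ∧ i ∈ y.1) = {v} := by
        ext y
        simp only [Finset.mem_filter, Finset.mem_univ, true_and, Finset.mem_singleton]
        constructor
        · intro h
          rcases hsub y h with rfl | rfl
          · exact absurd h.1 hnot
          · rfl
        · rintro rfl; exact ⟨hv, hx, ((h2 y).2 (Or.inr rfl)).2⟩
      rw [this]; simp
    · have : (Finset.univ.filter fun y => H.Adj x y ∧ i ∈ x.1 ∧ i ∈ y.1) = {v} := by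
        ext y
        simp only [Finset.mem_filter, Finset.mem_univ, true_and, Finset.mem_singleton]
        constructor
        · intro h
          rcases hsub y h with rfl | rfl
          · exact absurd h.1.symm hnot
          · rfl
        · rintro rfl; exact ⟨hv, hx, ((h2 y).2 (Or.inr rfl)).2⟩
      rw [this]; simp
    · have : (Finset.univ.filter fun y => H.Adj x y ∧ i ∈ x.1 ∧ i ∈ y.1) = {u, v} := by
        ext y
        simp only [Finset.mem_filter, Finset.mem_univ, true_and, Finset.mem_singleton,
          Finset.mem_insert]
        constructor
        · exact hsub y
        · rintro (rfl | rfl)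
          · exact ⟨hu, hx, ((h2 y).2 (Or.inl rfl)).2⟩
          · exact ⟨hv, hx, ((h2 y).2 (Or.inr rfl)).2⟩
      rw [this, Finset.card_pair huv, if_neg (by tauto)]
      decide
  · have : (Finset.univ.filter fun y => H.Adj x y ∧ i ∈ x.1 ∧ i ∈ y.1) = ∅ := by
      ext y; simp [hx]
    rw [this, if_neg]
    · simp
    · rintro (rfl | rfl) <;> contradiction

/-- The paths from `f` to `g` around the two ends of the common edge have the same boundary, so
their sum modulo 2 has none. -/
lemma incid_transpose_mul_cycleMatrix (hT : T.StifflyConnected) (hH : H ≤ T.rigidityGraph)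
    [Fintype H.edgeSet] : (incid H).transpose * cycleMatrix H = 0 := by
  classical
  ext x ⟨e, f, g, rfl, hfg, hnot⟩
  simp only [Matrix.mul_apply, Matrix.transpose_apply, cycleMatrix, Matrix.zero_apply,
    Finset.mul_sum]
  rw [Finset.sum_comm]
  have : ∀ v, ∑ h, incid H h x * (common h.1 v * common s(f, g) v) =
      (if v ∈ f.1 ∧ v ∈ g.1 then 1 else 0) * (if x = f ∨ x = g then 1 else 0) := by
    intro v
    simp only [← mul_assoc]
    rw [← Finset.sum_mul, common_mk, mul_comm]
    by_cases hv : v ∈ f.1 ∧ v ∈ g.1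
    · rw [sum_common_eq hT hH hfg hnot hv.1 hv.2]
    · simp [hv]
  rw [Finset.sum_congr rfl fun v _ => this v, ← Finset.sum_mul]
  obtain ⟨i, j, hij, h1, -⟩ := hfg.exists_pair
  have h2 : ∑ v : Fin n, (if v ∈ f.1 ∧ v ∈ g.1 then (1 : ZMod 2) else 0) = 0 := by
    rw [← Finset.sum_filter, Finset.filter_congr (q := fun v => v ∈ ({i, j} : Finset (Fin n)))
      fun v _ => by rw [h1 v]; simp]
    rw [Finset.filter_mem_eq_inter, Finset.univ_inter, Finset.sum_pair hij]
    decide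
  rw [h2, zero_mul]

lemma zmod_two_eq_of_add_eq_zero {a b : ZMod 2} (h : a + b = 0) : a = b := by
  revert a b; decide

/-- Modulo 2, a function that sums to zero over each edge of a connected graph is constant, so the
kernel has dimension at most one. -/
lemma card_le_rank_incid (hc : H.Connected) [Fintype H.edgeSet] :
    Fintype.card T.Face ≤ (incid H).rank + 1 := by
  classical
  have hker : LinearMap.ker (incid H).mulVecLin ≤ Submodule.span (ZMod 2) {fun _ => 1} := by
    intro φ hφ
    have key : ∀ f g, H.Adj f g → φ f = φ g := by
      intro f g h
      have h1 := congrFun (LinearMap.mem_ker.1 hφ) ⟨s(f, g), h⟩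
      simp only [Matrix.mulVecLin_apply, Matrix.mulVec, dotProduct, incid, Sym2.mem_iff, ite_mul,
        one_mul, zero_mul, Pi.zero_apply] at h1
      rw [← Finset.sum_filter, Finset.filter_congr (q := fun x => x ∈ ({f, g} : Finset T.Face))
        fun v _ => by simp, Finset.filter_mem_eq_inter, Finset.univ_inter,
        Finset.sum_pair h.ne] at h1
      exact zmod_two_eq_of_add_eq_zero h1
    obtain ⟨f₀⟩ := hc.nonempty
    have hall : ∀ g, φ g = φ f₀ := by
      intro g
      have := hc.preconnected f₀ g
      rw [SimpleGraph.reachable_iff_reflTransGen] at this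
      induction this with
      | refl => rfl
      | tail _ h ih => rw [← key _ _ h, ih]
    rw [Submodule.mem_span_singleton]
    exact ⟨φ f₀, by ext g; simp [hall g]⟩
  have h1 := (incid H).mulVecLin.finrank_range_add_finrank_ker
  have h2 := Submodule.finrank_mono hker
  have h3 := finrank_span_le_card (R := ZMod 2) ({fun _ => 1} : Set (T.Face → ZMod 2))
  rw [Set.toFinset_singleton, Finset.card_singleton] at h3
  rw [Module.finrank_fintype_fun_eq_card] at h1
  have : (incid H).rank = Module.finrank (ZMod 2) (LinearMap.range (incid H).mulVecLin) := rfl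
  omega

/-- A link at an end point of an extra link `e` is in `H` or equal to `e`. -/
lemma adj_or_eq_of_extra (hT : T.StifflyConnected) (hH : H ≤ T.rigidityGraph) {i : Fin n}
    {f g : T.Face} (hfg : Glued H f g) (hnot : ¬ H.Adj f g) (hf : i ∈ f.1) (hg : i ∈ g.1)
    {x y : T.Face} (hx : i ∈ x.1) (hy : i ∈ y.1) (hxy : T.rigidityGraph.Adj x y) :
    H.Adj x y ∨ s(x, y) = s(f, g) := by
  obtain ⟨u, v, huv, h2, h3⟩ := cycle_at_vertex hT hH hf hfg.adj hnot (hfg.conn hf hg) hx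
  rcases h3 with ⟨rfl, rfl, hv⟩ | ⟨rfl, rfl, hv⟩ | ⟨h4, h5, hu, hv⟩ <;>
    rcases (h2 y).1 ⟨hxy, hy⟩ with rfl | rfl
  · exact Or.inr rfl
  · exact Or.inl hv
  · exact Or.inr Sym2.eq_swap
  · exact Or.inl hv
  · exact Or.inl hu
  · exact Or.inl hv

/-- The two neighbours of `x` at `i` cannot both be across the same side, so each of the two sides
of `x` at `i` has a neighbour. -/
lemma exists_other_face (hT : T.StifflyConnected) (hH : H ≤ T.rigidityGraph) {i : Fin n}
    {f g : T.Face} (hfg : Glued H f g) (hnot : ¬ H.Adj f g) (hf : i ∈ f.1) (hg : i ∈ g.1)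
    {x : T.Face} (hx : i ∈ x.1) {j : Fin n} (hj : j ∈ x.1) (hij : i ≠ j) :
    ∃ y, T.rigidityGraph.Adj x y ∧ i ∈ y.1 ∧ j ∈ y.1 := by
  obtain ⟨u, v, huv, h2, -⟩ := cycle_at_vertex hT hH hf hfg.adj hnot (hfg.conn hf hg) hx
  have hu := (h2 u).2 (Or.inl rfl)
  have hv := (h2 v).2 (Or.inr rfl)
  obtain ⟨k, hki, hkj, hset⟩ := exists_third (T.card_face x.2) hx hj hij
  have key : ∀ y, T.rigidityGraph.Adj x y ∧ i ∈ y.1 → j ∈ y.1 ∨ k ∈ y.1 := by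
    rintro y ⟨hy, hyi⟩
    obtain ⟨-, a, b, hab, h1, h2, h3, h4⟩ := Truss.rigidityGraph_adj.1 hy
    rw [hset] at h1 h2
    simp only [Finset.mem_insert, Finset.mem_singleton] at h1 h2
    rcases h1 with rfl | rfl | rfl
    · rcases h2 with rfl | rfl | rfl
      · exact absurd rfl hab
      · exact Or.inl h4
      · exact Or.inr h4
    · exact Or.inl h3
    · exact Or.inr h3
  by_contra! hno
  have hku := (key u hu).resolve_left (hno u hu.1 hu.2)
  have hkv := (key v hv).resolve_left (hno v hv.1 hv.2)
  exact Truss.not_three_faces hu.1.ne hv.1.ne huv hki.symm hx (by rw [hset]; simp) hu.2 hku hv.2 hkv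

lemma exists_boundary_edge_truss (hT : T.StifflyConnected) :
    ∃ (f : T.Face) (i j : Fin n), i ∈ f.1 ∧ j ∈ f.1 ∧ i ≠ j ∧
      ∀ g : T.Face, i ∈ g.1 → j ∈ g.1 → g = f := by
  obtain ⟨w, hw, hF⟩ := T.exists_drawing
  obtain ⟨f₀⟩ := hT.1.nonempty
  obtain ⟨f, hf, i, hi, j, hj, hij, h⟩ := exists_boundary_edge hw hF ⟨f₀.1, f₀.2⟩ fun i => by
    obtain ⟨f, hf⟩ := hT.exists_face i
    exact ⟨f.1, f.2, hf⟩
  exact ⟨⟨f, hf⟩, i, j, hi, hj, hij, fun g h1 h2 => Subtype.ext (h g.1 g.2 h1 h2)⟩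

/-- For `a` in the kernel, `φ` has equal values at the two ends of every edge across which `H` links
two faces. A nonzero value at a vertex means that the faces close up around it, and it spreads to
all corners of these faces. Connectedness carries it to every vertex, in particular to the ends of a
boundary edge, where the faces do not close up. -/
lemma cycleMatrix_injective (hT : T.StifflyConnected) (hH : H ≤ T.rigidityGraph)
    [Fintype (extraLinks H)] {a : extraLinks H → ZMod 2} (ha : (cycleMatrix H).mulVec a = 0) :
    a = 0 := by
  classical
  by_contra hne
  obtain ⟨e₀, he₀⟩ := Function.ne_iff.1 hne
  let φ : Fin n → ZMod 2 := fun v => ∑ e : extraLinks H, common e.1 v * a e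
  have hφH : ∀ x y i j, H.Adj x y → i ≠ j → i ∈ x.1 → j ∈ x.1 → i ∈ y.1 → j ∈ y.1 → φ i = φ j := by
    intro x y i j hxy hij h1 h2 h3 h4
    have h5 := congrFun ha ⟨s(x, y), hxy⟩
    simp only [Matrix.mulVec, dotProduct, cycleMatrix, Pi.zero_apply, Finset.sum_mul] at h5
    rw [Finset.sum_comm] at h5
    simp only [mul_assoc] at h5
    simp only [← Finset.mul_sum] at h5
    obtain ⟨k, l, -, -, -, -, -, -, -, h7⟩ := inter_pair_of_ne (T.card_face x.2) (T.card_face y.2)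
      (fun h => hxy.ne (Subtype.ext h)) hij h1 h2 h3 h4
    simp only [common_mk, ite_mul, one_mul, zero_mul] at h5
    rw [← Finset.sum_filter, Finset.filter_congr (q := fun v => v ∈ ({i, j} : Finset (Fin n)))
      fun v _ => by rw [← h7, Finset.mem_inter], Finset.filter_mem_eq_inter, Finset.univ_inter,
      Finset.sum_pair hij] at h5
    exact zmod_two_eq_of_add_eq_zero h5
  -- At most one extra link occurs at a vertex, because all other links of its cycle are in `H`. So
  -- `φ` is there a single coefficient, the same at both ends of the edge.
  have hφe : ∀ (e : extraLinks H) f g, e.1 = s(f, g) → Glued H f g → ¬ H.Adj f g →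
      ∀ i, i ∈ f.1 → i ∈ g.1 → φ i = a e := by
    intro e f g he hfg hnot i hi hj
    have hz : ∀ e' : extraLinks H, e' ≠ e → common e'.1 i * a e' = 0 := by
      rintro ⟨e', x, y, rfl, hxy, hnxy⟩ hne
      rw [common_mk, if_neg, zero_mul]
      rintro ⟨hx, hy⟩
      rcases adj_or_eq_of_extra hT hH hfg hnot hi hj hx hy hxy.adj with h | h
      · exact hnxy h
      · exact hne (Subtype.ext (h.trans he.symm))
    simp only [φ]
    rw [Finset.sum_eq_single e (fun e' _ h => hz e' h) (fun h => absurd (Finset.mem_univ e) h), he,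
      common_mk, if_pos ⟨hi, hj⟩, one_mul]
  have hsupp : ∀ v, φ v ≠ 0 → ∃ (e : extraLinks H) (f g : T.Face), e.1 = s(f, g) ∧ Glued H f g ∧
      ¬ H.Adj f g ∧ v ∈ f.1 ∧ v ∈ g.1 := by
    intro v hv
    obtain ⟨e, -, he⟩ := Finset.exists_ne_zero_of_sum_ne_zero hv
    obtain ⟨f, g, h1, h2, h3⟩ := e.2
    have : common e.1 v ≠ 0 := left_ne_zero_of_mul he
    rw [h1, common_mk] at this
    have h4 : v ∈ f.1 ∧ v ∈ g.1 := by
      by_contra h; simp [h] at this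
    exact ⟨e, f, g, h1, h2, h3, h4⟩
  -- The side `ij` of `x` has a face on its other side. The link across it is in `H`, where the
  -- kernel condition applies, or is the extra link itself, where `φ` equals its coefficient at both
  -- ends.
  have hstep : ∀ (x : T.Face) i j, i ∈ x.1 → j ∈ x.1 → φ i ≠ 0 → φ j ≠ 0 := by
    intro x i j hi hj h0
    by_cases hij : i = j
    · rwa [← hij]
    obtain ⟨e, f, g, h1, h2, h3, h4, h5⟩ := hsupp i h0
    obtain ⟨y, hxy, hyi, hyj⟩ := exists_other_face hT hH h2 h3 h4 h5 hi hj hij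
    rcases adj_or_eq_of_extra hT hH h2 h3 h4 h5 hi hyi hxy with h | h
    · rwa [← hφH x y i j h hij hi hj hyi hyj]
    · have hj' : j ∈ f.1 ∧ j ∈ g.1 := by
        rcases Sym2.eq_iff.1 h with ⟨rfl, rfl⟩ | ⟨rfl, rfl⟩
        · exact ⟨hj, hyj⟩
        · exact ⟨hyj, hj⟩
      rwa [hφe e f g h1 h2 h3 j hj'.1 hj'.2, ← hφe e f g h1 h2 h3 i h4 h5]
  have hface : ∀ x : T.Face, ∀ i ∈ x.1, φ i ≠ 0 := by
    obtain ⟨f₀, g₀, h1, h2, h3⟩ := e₀.2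
    obtain ⟨i₀, _, -, h4, -⟩ := h2.exists_pair
    have hi₀ := (h4 i₀).2 (Or.inl rfl)
    have hφ0 : φ i₀ ≠ 0 := by
      rw [hφe e₀ f₀ g₀ h1 h2 h3 i₀ hi₀.1 hi₀.2]; exact he₀
    intro x
    have := hT.1.preconnected f₀ x
    rw [SimpleGraph.reachable_iff_reflTransGen] at this
    induction this with
    | refl => exact fun i hi => hstep f₀ i₀ i hi₀.1 hi hφ0
    | @tail y z _ h ih =>
      obtain ⟨-, p, q, -, hp, -, hp', -⟩ := Truss.rigidityGraph_adj.1 h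
      exact fun i hi => hstep z p i hp' hi (ih p hp)
  obtain ⟨x, i, j, hi, hj, hij, hx⟩ := exists_boundary_edge_truss hT
  obtain ⟨e, f, g, h1, h2, h3, h4, h5⟩ := hsupp i (hface x i hi)
  obtain ⟨y, hxy, hyi, hyj⟩ := exists_other_face hT hH h2 h3 h4 h5 hi hj hij
  exact hxy.ne (hx y hyi hyj).symm

/-- There are at most as many extra links as edges of `H` outside a spanning tree. -/
lemma ncard_extraLinks_le (hT : T.StifflyConnected) (hH : H ≤ T.rigidityGraph)
    (hc : H.Connected) {k : ℕ} (hk : H.edgeSet.ncard + 1 = T.faces.card + k) :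
    (extraLinks H).ncard ≤ k := by
  classical
  have := Fintype.ofFinite H.edgeSet
  have := Fintype.ofFinite (extraLinks H)
  -- Two matrices with product zero have ranks that add up to at most the number of edges of `H`.
  -- One rank is at least `|F| - 1` and the other one is the number of extra links.
  have h1 := Matrix.rank_add_rank_le_card_of_mul_eq_zero (incid_transpose_mul_cycleMatrix hT hH)
  rw [Matrix.rank_transpose] at h1
  have h2 := card_le_rank_incid hc
  have h3 : (cycleMatrix H).rank = Fintype.card (extraLinks H) := by
    have hinj : Function.Injective (cycleMatrix H).mulVecLin := by
      rw [← LinearMap.ker_eq_bot, LinearMap.ker_eq_bot']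
      intro a ha
      exact cycleMatrix_injective hT hH ha
    rw [Matrix.rank, LinearMap.finrank_range_of_inj hinj, Module.finrank_fintype_fun_eq_card]
  have h4 : H.edgeSet.ncard = Fintype.card H.edgeSet := by
    rw [← Nat.card_coe_set_eq, Nat.card_eq_fintype_card]
  have h5 : (extraLinks H).ncard = Fintype.card (extraLinks H) := by
    rw [← Nat.card_coe_set_eq, Nat.card_eq_fintype_card]
  have h6 : Fintype.card T.Face = T.faces.card := by simp
  omega

/-- The rigidity graph of the cut truss has at most as many edges outside `H` as `H` has edges
outside a spanning tree. -/
lemma Labeling.ncard_sdiff_le {m : ℕ} (Λ : Labeling H (Fin m)) (hT : T.StifflyConnected)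
    (hH : H ≤ T.rigidityGraph) (hc : H.Connected) {k : ℕ}
    (hk : (H.comap (Λ.faceEquiv hT hH hc)).edgeSet.ncard + 1 = T.faces.card + k) :
    ((Λ.truss hT hH hc).rigidityGraph.edgeSet \
      (H.comap (Λ.faceEquiv hT hH hc)).edgeSet).ncard ≤ k := by
  set ρ := Λ.faceEquiv hT hH hc
  have e1 : (H.comap ρ).edgeSet.ncard = H.edgeSet.ncard := by
    rw [← Nat.card_coe_set_eq, ← Nat.card_coe_set_eq]
    exact Nat.card_congr (SimpleGraph.Iso.comap ρ H).mapEdgeSet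
  rw [e1] at hk
  refine le_trans ?_ (ncard_extraLinks_le hT hH hc hk)
  refine Set.ncard_le_ncard_of_injOn (Sym2.map ρ) ?_
    (Sym2.map.injective ρ.injective).injOn (Set.toFinite _)
  intro e
  induction e with
  | _ f g =>
    rintro ⟨h1, h2⟩
    exact ⟨ρ f, ρ g, rfl, (Λ.rigidityGraph_truss_adj hT hH hc f g).1 h1, h2⟩

end rank

/-! ### Program logic for the random access machine -/

section machine
variable {W : ℕ}

/-- The program `p` halts within `T` steps in a store that satisfies `Q`. -/
def Runs (W : ℕ) (p : Prog) (s : Store) (T : ℕ) (Q : Store → Prop) : Prop :=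
  ∃ t s', Exec W p s t s' ∧ t ≤ T ∧ Q s'

lemma Runs.mono {p : Prog} {s : Store} {T T' : ℕ} {Q Q' : Store → Prop} (h : Runs W p s T Q)
    (hT : T ≤ T') (hQ : ∀ s', Q s' → Q' s') : Runs W p s T' Q' := by
  obtain ⟨t, s', h1, h2, h3⟩ := h
  exact ⟨t, s', h1, h2.trans hT, hQ _ h3⟩

lemma Runs.seq {p q : Prog} {s : Store} {T T' : ℕ} {Q Q' : Store → Prop} (h : Runs W p s T Q')
    (h' : ∀ s', Q' s' → Runs W q s' T' Q) : Runs W (.seq p q) s (T + T') Q := by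
  obtain ⟨t, s', h1, h2, h3⟩ := h
  obtain ⟨t', s'', h4, h5, h6⟩ := h' s' h3
  exact ⟨t + t', s'', .seq h1 h4, by omega, h6⟩

/-- The word arrays that a program writes. -/
def Prog.words : Prog → List ℕ
  | .skip => []
  | .set a _ _ => [a]
  | .copy _ _ _ _ => []
  | .seq p q => p.words ++ q.words
  | .ite _ p q => p.words ++ q.words
  | .loop _ p => p.words

/-- The real arrays that a program writes. -/
def Prog.reals : Prog → List ℕ
  | .skip => []
  | .set _ _ _ => []
  | .copy a _ _ _ => [a]
  | .seq p q => p.reals ++ q.reals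
  | .ite _ p q => p.reals ++ q.reals
  | .loop _ p => p.reals

/-- The stores agree at the arrays that `p` does not write. -/
structure SameOff (p : Prog) (s s' : Store) : Prop where
  word : ∀ a ∉ p.words, s'.word a = s.word a
  real : ∀ a ∉ p.reals, s'.real a = s.real a

lemma Store.word_setWord (s : Store) (a i x b : ℕ) : (s.setWord a i x).word b =
    if b = a then Function.update (s.word a) i x else s.word b := by
  by_cases h : b = a
  · subst h; simp [Store.setWord]
  · simp [Store.setWord, h]

@[simp] lemma Store.real_setWord (s : Store) (a i x b : ℕ) :
    (s.setWord a i x).real b = s.real b := rfl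

lemma Store.real_setReal (s : Store) (a i : ℕ) (x : ℝ) (b : ℕ) : (s.setReal a i x).real b =
    if b = a then Function.update (s.real a) i x else s.real b := by
  by_cases h : b = a
  · subst h; simp [Store.setReal]
  · simp [Store.setReal, h]

@[simp] lemma Store.word_setReal (s : Store) (a i : ℕ) (x : ℝ) (b : ℕ) :
    (s.setReal a i x).word b = s.word b := rfl

lemma Exec.sameOff {p : Prog} {s s' : Store} {t : ℕ} (h : Exec W p s t s') : SameOff p s s' := by
  induction h with
  | skip => exact ⟨fun _ _ => rfl, fun _ _ => rfl⟩
  | set a idx val s =>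
    exact ⟨fun b hb => by simp [Store.word_setWord, show b ≠ a by simpa [Prog.words] using hb],
      fun _ _ => rfl⟩
  | copy a idx b idx' s =>
    exact ⟨fun _ _ => rfl,
      fun b hb => by simp [Store.real_setReal, show b ≠ a by simpa [Prog.reals] using hb]⟩
  | seq hp hq ih1 ih2 =>
    refine ⟨fun a ha => ?_, fun a ha => ?_⟩ <;>
      simp only [Prog.words, Prog.reals, List.mem_append, not_or] at ha
    · rw [ih2.word a ha.2, ih1.word a ha.1]
    · rw [ih2.real a ha.2, ih1.real a ha.1]
  | ite_true _ _ ih =>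
    refine ⟨fun a ha => ?_, fun a ha => ?_⟩ <;>
      simp only [Prog.words, Prog.reals, List.mem_append, not_or] at ha
    · exact ih.word a ha.1
    · exact ih.real a ha.1
  | ite_false _ _ ih =>
    refine ⟨fun a ha => ?_, fun a ha => ?_⟩ <;>
      simp only [Prog.words, Prog.reals, List.mem_append, not_or] at ha
    · exact ih.word a ha.2
    · exact ih.real a ha.2
  | loop_true _ _ _ ih1 ih2 =>
    exact ⟨fun a ha => (ih2.word a ha).trans (ih1.word a ha),
      fun a ha => (ih2.real a ha).trans (ih1.real a ha)⟩
  | loop_false => exact ⟨fun _ _ => rfl, fun _ _ => rfl⟩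

lemma Runs.sameOff {p : Prog} {s : Store} {T : ℕ} {Q : Store → Prop} (h : Runs W p s T Q) :
    Runs W p s T fun s' => Q s' ∧ SameOff p s s' := by
  obtain ⟨t, s', h1, h2, h3⟩ := h
  exact ⟨t, s', h1, h2, h3, h1.sameOff⟩

/-- A sufficient condition for a program without loops to lead from `s` to `Q`. -/
def Prog.Pre (W : ℕ) (Q : Store → Prop) : Prog → Store → Prop
  | .skip, s => Q s
  | .set a idx val, s => idx.eval s ≤ W ∧ val.eval s ≤ W ∧ Q (s.setWord a (idx.eval s) (val.eval s))
  | .copy a idx b idx', s => idx.eval s ≤ W ∧ Q (s.setReal a (idx.eval s) (s.real b (idx'.eval s)))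
  | .seq p q, s => p.Pre W (q.Pre W Q) s
  | .ite test p q, s => (test.eval s ≠ 0 → p.Pre W Q s) ∧ (test.eval s = 0 → q.Pre W Q s)
  | .loop _ _, _ => False

/-- A bound on the number of steps of a program without loops. -/
def Prog.maxCost : Prog → ℕ
  | .skip => 1
  | .set _ idx val => idx.cost + val.cost + 1
  | .copy _ idx _ idx' => idx.cost + idx'.cost + 1
  | .seq p q => p.maxCost + q.maxCost
  | .ite test p q => test.cost + (p.maxCost + q.maxCost) + 1
  | .loop _ _ => 0

lemma Prog.Pre.runs {p : Prog} {s : Store} {Q : Store → Prop} (h : p.Pre W Q s) {T : ℕ}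
    (hT : p.maxCost ≤ T := by decide) : Runs W p s T Q := by
  suffices h : Runs W p s p.maxCost Q from h.mono hT fun _ h => h
  clear hT
  induction p generalizing s Q with
  | skip => exact ⟨_, _, .skip s, le_rfl, h⟩
  | set a idx val => exact ⟨_, _, .set a idx val s h.1 h.2.1, le_rfl, h.2.2⟩
  | copy a idx b idx' => exact ⟨_, _, .copy a idx b idx' s h.1, le_rfl, h.2⟩
  | seq p q ihp ihq => exact (ihp h).seq fun s' h' => ihq h'
  | ite test p q ihp ihq =>
    by_cases ht : test.eval s = 0
    · obtain ⟨t, s', h1, h2, h3⟩ := ihq (h.2 ht)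
      exact ⟨_, s', .ite_false ht h1, by simp only [Prog.maxCost]; omega, h3⟩
    · obtain ⟨t, s', h1, h2, h3⟩ := ihp (h.1 ht)
      exact ⟨_, s', .ite_true ht h1, by simp only [Prog.maxCost]; omega, h3⟩
  | loop _ _ => exact h.elim

/-- Run `p` with entry `0` of word array `c` counting from `0` up to the bound in entry `j` of
word array `b`. -/
def Prog.count (c b j : ℕ) (p : Prog) : Prog :=
  .seq (.set c (.const 0) (.const 0))
    (.loop (.lt (.read c (.const 0)) (.read b (.const j)))
      (.seq p (.set c (.const 0) (.add (.read c (.const 0)) (.const 1)))))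

/-- Loop rule with an invariant `I` that is insensitive to the counter. Apart from the body, a pass
costs `6` for the test and `6` for the increment; the constant `9` pays for the initialization and
the last test. -/
lemma Runs.count {c b j : ℕ} {p : Prog} {s : Store} {T B : ℕ} (I : ℕ → Store → Prop)
    (hc : c ∉ p.words) (hb : b ∉ c :: p.words) (hB : s.word b j = B) (hW : B ≤ W)
    (h0 : I 0 s) (hI : ∀ k s v, I k s → I k (s.setWord c 0 v))
    (hstep : ∀ k < B, ∀ s', I k s' → s'.word c 0 = k → SameOff (Prog.count c b j p) s s' →
      Runs W p s' T (I (k + 1))) :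
    Runs W (Prog.count c b j p) s (B * (T + 12) + 9) (I B) := by
  have hw : (Prog.count c b j p).words = c :: (p.words ++ [c]) := rfl
  have hr : (Prog.count c b j p).reals = p.reals := by simp [Prog.count, Prog.reals]
  -- Induction on the number `d` of remaining passes.
  have key : ∀ d k, k + d = B → ∀ s', I k s' → s'.word c 0 = k →
      SameOff (Prog.count c b j p) s s' →
      Runs W (.loop (.lt (.read c (.const 0)) (.read b (.const j)))
        (.seq p (.set c (.const 0) (.add (.read c (.const 0)) (.const 1))))) s'
        (d * (T + 12) + 6) (I B) := by
    intro d
    induction d with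
    | zero =>
      intro k hk s' h1 h2 h3
      have hb' := h3.word b (by rw [hw]; simp only [List.mem_cons, List.mem_append, not_or] at hb ⊢; tauto)
      obtain rfl : k = B := by omega
      exact ⟨_, s', .loop_false (by simp [Term.eval, h2, hb', hB]), by simp [Term.cost], h1⟩
    | succ d ih =>
      intro k hk s' h1 h2 h3
      have hb' := h3.word b (by rw [hw]; simp only [List.mem_cons, List.mem_append, not_or] at hb ⊢; tauto)
      obtain ⟨t, s1, e1, ht1, hI1⟩ := hstep k (by omega) s' h1 h2 h3
      have hs1 := e1.sameOff
      have hc1 : s1.word c 0 = k := by rw [hs1.word c hc, h2]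
      have hset : Exec W (.set c (.const 0) (.add (.read c (.const 0)) (.const 1))) s1 6
          (s1.setWord c 0 (k + 1)) := by
        have := Exec.set (W := W) c (.const 0) (.add (.read c (.const 0)) (.const 1)) s1
          (by simp [Term.eval]) (by simp only [Term.eval, hc1]; omega)
        simpa [Term.eval, Term.cost, hc1] using this
      obtain ⟨t2, s2, e2, ht2, hQ⟩ := ih (k + 1) (by omega) (s1.setWord c 0 (k + 1))
        (hI _ _ _ hI1) (by simp [Store.word_setWord]) ⟨fun a ha => by
          rw [hw] at ha
          simp only [List.mem_cons, List.mem_append, not_or] at ha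
          rw [Store.word_setWord, if_neg ha.1, hs1.word a ha.2.1]
          exact h3.word a (by rw [hw]; simp [ha.1, ha.2.1]), fun a ha => by
          rw [Store.real_setWord, hs1.real a (by rwa [hr] at ha)]
          exact h3.real a ha⟩
      refine ⟨_, s2, .loop_true (by simp [Term.eval, h2, hb', hB]; omega) (.seq e1 hset) e2, ?_, hQ⟩
      simp only [Term.cost]
      rw [add_mul]
      omega
  have h1 := key B 0 (by omega) (s.setWord c 0 0) (hI _ _ _ h0) (by simp [Store.word_setWord])
    ⟨fun a ha => by
      rw [hw] at ha
      simp only [List.mem_cons, not_or] at ha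
      rw [Store.word_setWord, if_neg ha.1], fun _ _ => rfl⟩
  obtain ⟨t, s', e, ht, hQ⟩ := h1
  refine ⟨_, s', .seq (.set c (.const 0) (.const 0) s (by simp [Term.eval]) (by simp [Term.eval])) e,
    ?_, hQ⟩
  simp only [Term.cost]
  omega

/-- Counting loops whose passes establish `P 0`, `P 1`, …, without destroying what has been
established before. -/
lemma Runs.count_forall {c b j : ℕ} {p : Prog} {s : Store} {T B : ℕ} (J : Store → Prop)
    (P : ℕ → Store → Prop) (hc : c ∉ p.words) (hb : b ∉ c :: p.words) (hB : s.word b j = B)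
    (hW : B ≤ W) (h0 : J s) (hJ : ∀ s v, J s → J (s.setWord c 0 v))
    (hP : ∀ k s v, P k s → P k (s.setWord c 0 v))
    (hstep : ∀ k < B, ∀ s', J s' → s'.word c 0 = k → SameOff (Prog.count c b j p) s s' →
      Runs W p s' T fun s'' => J s'' ∧ P k s'' ∧ ∀ d < k, P d s' → P d s'') :
    Runs W (Prog.count c b j p) s (B * (T + 12) + 9) fun s' => J s' ∧ ∀ d < B, P d s' := by
  refine Runs.count (fun k s => J s ∧ ∀ d < k, P d s) hc hb hB hW ⟨h0, by simp⟩
    (fun k s v h => ⟨hJ _ _ h.1, fun d hd => hP _ _ _ (h.2 d hd)⟩) ?_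
  intro k hk s' h1 h2 h3
  refine (hstep k hk s' h1.1 h2 h3).mono le_rfl fun s'' h => ⟨h.1, fun d hd => ?_⟩
  rcases Nat.lt_succ_iff_lt_or_eq.1 hd with h' | rfl
  · exact h.2.2 d h' (h1.2 d h')
  · exact h.2.1

/-- The programs in a list, one after the other. -/
def Prog.seqs : List Prog → Prog
  | [] => .skip
  | p :: l => .seq p (Prog.seqs l)

lemma Runs.seqs {α : Type} {f : α → Prog} {l : List α} {s : Store} {T : ℕ} (J : Store → Prop)
    (P : α → Store → Prop) (h0 : J s)
    (hstep : ∀ x ∈ l, ∀ s', J s' → SameOff (Prog.seqs (l.map f)) s s' →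
      Runs W (f x) s' T fun s'' => J s'' ∧ P x s'' ∧ ∀ d, P d s' → P d s'') :
    Runs W (Prog.seqs (l.map f)) s (l.length * T + 1)
      fun s' => J s' ∧ (∀ x ∈ l, P x s') ∧ ∀ d, P d s → P d s' := by
  have key : ∀ (l' : List α) (s' : Store), (∀ x ∈ l', x ∈ l) → J s' →
      SameOff (Prog.seqs (l.map f)) s s' →
      Runs W (Prog.seqs (l'.map f)) s' (l'.length * T + 1)
        fun s'' => J s'' ∧ (∀ x ∈ l', P x s'') ∧ ∀ d, P d s' → P d s'' := by
    have hw : ∀ (l : List α) x, x ∈ l → ∀ a, (a ∈ (f x).words → a ∈ (Prog.seqs (l.map f)).words) ∧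
        (a ∈ (f x).reals → a ∈ (Prog.seqs (l.map f)).reals) := by
      intro l
      induction l with
      | nil => simp
      | cons y l ih =>
        intro x hx a
        simp only [List.map_cons, Prog.seqs, Prog.words, Prog.reals, List.mem_append]
        rcases List.mem_cons.1 hx with rfl | hx
        · exact ⟨Or.inl, Or.inl⟩
        · exact ⟨fun h => Or.inr ((ih x hx a).1 h), fun h => Or.inr ((ih x hx a).2 h)⟩
    intro l'
    induction l' with
    | nil => exact fun s' _ h _ => ⟨1, s', .skip s', by simp, h, by simp, fun _ h => h⟩
    | cons x l' ih =>
      intro s' hl hJ hs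
      refine ((hstep x (hl x (by simp)) s' hJ hs).sameOff.seq fun s1 h1 =>
        (ih s1 (fun y hy => hl y (by simp [hy])) h1.1.1
          ⟨fun a ha => (h1.2.word a fun h => ha ((hw l x (hl x (by simp)) a).1 h)).trans (hs.word a ha),
          fun a ha => (h1.2.real a fun h => ha ((hw l x (hl x (by simp)) a).2 h)).trans
            (hs.real a ha)⟩).mono le_rfl fun s2 h2 => ?_).mono ?_ fun _ h => h
      · refine ⟨h2.1, fun y hy => ?_, fun d hd => h2.2.2 d (h1.1.2.2 d hd)⟩
        rcases List.mem_cons.1 hy with rfl | hy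
        · exact h2.2.2 _ h1.1.2.1
        · exact h2.2.1 y hy
      · simp only [List.length_cons, add_mul]; omega
  exact key l s (fun _ h => h) h0 ⟨fun _ _ => rfl, fun _ _ => rfl⟩

end machine

/-! ### Partial labellings and tables of pairs -/

section tables

/-- `lab` assigns labels `1, …, nlab` to the `tail` numbers below `N` that are listed in `ord`, and
label `0` to the others. Labels tell the components of `R` apart. -/
structure PartialLabels (R : ℕ → ℕ → Prop) (N : ℕ) (lab ord : ℕ → ℕ) (tail nlab : ℕ) : Prop where
  ord_lt : ∀ k < tail, ord k < N
  ord_inj : ∀ k < tail, ∀ l < tail, ord k = ord l → k = l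
  lab_ne_zero : ∀ x, lab x ≠ 0 ↔ ∃ k < tail, ord k = x
  lab_le : ∀ x, lab x ≤ nlab
  lab_surj : ∀ a < nlab, ∃ x, lab x = a + 1
  lab_eq : ∀ x y, lab x ≠ 0 → lab y ≠ 0 → (lab x = lab y ↔ Relation.ReflTransGen R x y)

variable {R : ℕ → ℕ → Prop} {N : ℕ} {lab ord : ℕ → ℕ} {tail nlab : ℕ}

lemma PartialLabels.tail_le (h : PartialLabels R N lab ord tail nlab) : tail ≤ N := by
  have := Finset.card_le_card_of_injOn (s := Finset.range tail) (t := Finset.range N) ord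
    (fun k hk => by
      simp only [Finset.coe_range, mem_Iio] at hk ⊢
      exact h.ord_lt k hk)
    (fun k hk l hl => h.ord_inj k (by simpa using hk) l (by simpa using hl))
  simpa using this

lemma PartialLabels.lt (h : PartialLabels R N lab ord tail nlab) {x : ℕ} (hx : lab x ≠ 0) :
    x < N := by
  obtain ⟨k, hk, rfl⟩ := (h.lab_ne_zero x).1 hx
  exact h.ord_lt k hk

lemma PartialLabels.empty : PartialLabels R N (fun _ => 0) ord 0 0 where
  ord_lt := by simp
  ord_inj := by simp
  lab_ne_zero := by simp
  lab_le := by simp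
  lab_surj := by simp
  lab_eq := by simp

/-- Common core of the two ways to label a number `y`: with the label of a neighbour, or with a new
label. The hypothesis `hs` says that a label can only be added if it is the one just given, so the
labels remain without gaps. -/
lemma PartialLabels.insert (h : PartialLabels R N lab ord tail nlab) (hR : ∀ x y, R x y → R y x)
    {y v nlab' : ℕ} (hy : lab y = 0) (hyN : y < N) (hv0 : v ≠ 0) (hv : v ≤ nlab')
    (hn : nlab ≤ nlab') (hs : ∀ a, nlab ≤ a → a < nlab' → v = a + 1)
    (heq : ∀ x, lab x ≠ 0 → (lab x = v ↔ Relation.ReflTransGen R x y)) :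
    PartialLabels R N (Function.update lab y v) (Function.update ord tail y) (tail + 1) nlab' where
  ord_lt k hk := by
    rw [Function.update_apply]
    split_ifs with h1
    · exact hyN
    · exact h.ord_lt k (by omega)
  ord_inj k hk l hl := by
    have key : ∀ k < tail, ord k ≠ y := fun k hk h' => (h.lab_ne_zero y).2 ⟨k, hk, h'⟩ hy
    rw [Function.update_apply, Function.update_apply]
    split_ifs with h1 h2 h2
    · intro _; omega
    · intro h'; exact absurd h'.symm (key l (by omega))
    · intro h'; exact absurd h' (key k (by omega))
    · exact h.ord_inj k (by omega) l (by omega)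
  lab_ne_zero x := by
    rw [Function.update_apply]
    split_ifs with h1
    · subst h1
      simp only [hv0, ne_eq, not_false_eq_true, true_iff]
      exact ⟨tail, by omega, by simp⟩
    · rw [h.lab_ne_zero]
      constructor
      · rintro ⟨k, hk, rfl⟩
        exact ⟨k, by omega, by rw [Function.update_of_ne (by omega)]⟩
      · rintro ⟨k, hk, h2⟩
        rw [Function.update_apply] at h2
        split_ifs at h2 with h3
        · exact absurd h2.symm h1
        · exact ⟨k, by omega, h2⟩
  lab_le x := by
    rw [Function.update_apply]
    split_ifs
    · exact hv
    · exact (h.lab_le x).trans hn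
  lab_surj a ha := by
    by_cases h1 : a < nlab
    · obtain ⟨x, hx⟩ := h.lab_surj a h1
      refine ⟨x, ?_⟩
      rw [Function.update_of_ne (by rintro rfl; omega), hx]
    · exact ⟨y, by rw [Function.update_self]; exact hs a (by omega) ha⟩
  lab_eq x z hx hz := by
    have hsymm : ∀ {x y}, Relation.ReflTransGen R x y → Relation.ReflTransGen R y x :=
      by
      intro x y h
      have : Std.Symm R := ⟨hR⟩
      exact symm h
    by_cases h1 : x = y <;> by_cases h2 : z = y
    · subst h1; subst h2; simp [Relation.ReflTransGen.refl]
    · subst h1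
      rw [Function.update_of_ne h2] at hz ⊢
      rw [Function.update_self, eq_comm, heq z hz]
      exact ⟨hsymm, hsymm⟩
    · subst h2
      rw [Function.update_of_ne h1] at hx ⊢
      rw [Function.update_self, heq x hx]
    · rw [Function.update_of_ne h1] at hx ⊢
      rw [Function.update_of_ne h2] at hz ⊢
      exact h.lab_eq x z hx hz

lemma PartialLabels.insert_neighbor (h : PartialLabels R N lab ord tail nlab) (hR : ∀ x y, R x y → R y x)
    {x y : ℕ} (hx : lab x ≠ 0) (hy : lab y = 0) (hyN : y < N) (hxy : R x y) :
    PartialLabels R N (Function.update lab y (lab x)) (Function.update ord tail y) (tail + 1)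
      nlab := by
  refine h.insert hR hy hyN hx (h.lab_le x) le_rfl (fun a _ _ => by omega) fun z hz => ?_
  rw [h.lab_eq z x hz hx]
  exact ⟨fun h => h.tail hxy, fun h => h.tail (hR _ _ hxy)⟩

lemma PartialLabels.insert_new (h : PartialLabels R N lab ord tail nlab) (hR : ∀ x y, R x y → R y x)
    {y : ℕ} (hy : lab y = 0) (hyN : y < N)
    (hnew : ∀ x, lab x ≠ 0 → ¬ Relation.ReflTransGen R x y) :
    PartialLabels R N (Function.update lab y (nlab + 1)) (Function.update ord tail y) (tail + 1)
      (nlab + 1) := by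
  refine h.insert hR hy hyN (by omega) le_rfl (by omega) (fun a _ _ => by omega) fun z hz => ?_
  refine iff_of_false (fun h' => ?_) (hnew z hz)
  have := h.lab_le z
  omega

/-- If all neighbours of listed numbers have labels, the labelled set is a union of components. This
is the state of a search with empty queue and justifies a new label. -/
lemma PartialLabels.not_reflTransGen (h : PartialLabels R N lab ord tail nlab)
    (hclosed : ∀ k < tail, ∀ y, R (ord k) y → lab y ≠ 0) {x y : ℕ} (hx : lab x ≠ 0)
    (hy : lab y = 0) : ¬ Relation.ReflTransGen R x y := by
  intro h'
  suffices lab y ≠ 0 from this hy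
  clear hy
  induction h' with
  | refl => exact hx
  | tail _ h1 ih =>
    obtain ⟨k, hk, rfl⟩ := (h.lab_ne_zero _).1 ih
    exact hclosed k hk _ h1

/-- Entry `a * M + b` of `idx` is `t + 1` only if `{a, b} = {e₁ t, e₂ t}` with `t < k`, and it is
`0` only if there is no such `t`. -/
structure IsPairTable (M : ℕ) (idx e₁ e₂ : ℕ → ℕ) (k : ℕ) : Prop where
  sound : ∀ a < M, ∀ b < M, ∀ t, idx (a * M + b) = t + 1 →
    t < k ∧ (e₁ t = a ∧ e₂ t = b ∨ e₁ t = b ∧ e₂ t = a)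
  lt : ∀ t < k, e₁ t < M ∧ e₂ t < M
  ne_zero : ∀ t < k, idx (e₁ t * M + e₂ t) ≠ 0 ∧ idx (e₂ t * M + e₁ t) ≠ 0

variable {M : ℕ} {idx e₁ e₂ : ℕ → ℕ} {k : ℕ}

lemma pair_eq {M a b a' b' : ℕ} (hb : b < M) (hb' : b' < M) (h : a * M + b = a' * M + b') :
    a = a' ∧ b = b' := by
  have h1 := congrArg (· % M) h
  simp only [Nat.mul_add_mod_self_right, Nat.mod_eq_of_lt hb, Nat.mod_eq_of_lt hb'] at h1
  subst h1
  exact ⟨Nat.eq_of_mul_eq_mul_right (by omega) (by omega : a * M = a' * M), rfl⟩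

lemma IsPairTable.empty : IsPairTable M (fun _ => 0) e₁ e₂ 0 where
  sound := by simp
  lt := by simp
  ne_zero := by simp

/-- A repeated pair overwrites its entries by the later index, which is as good as the earlier one.
-/
lemma IsPairTable.insert (h : IsPairTable M idx e₁ e₂ k) {e₁' e₂' : ℕ → ℕ} {a b : ℕ}
    (h1 : ∀ t < k, e₁' t = e₁ t) (h2 : ∀ t < k, e₂' t = e₂ t) (h1' : e₁' k = a) (h2' : e₂' k = b)
    (ha : a < M) (hb : b < M) :
    IsPairTable M (Function.update (Function.update idx (a * M + b) (k + 1)) (b * M + a) (k + 1))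
      e₁' e₂' (k + 1) where
  sound x hx y hy t := by
    rw [Function.update_apply, Function.update_apply]
    split_ifs with h3 h4
    · obtain ⟨rfl, rfl⟩ := pair_eq hy ha h3
      rintro h5
      obtain rfl : k = t := by omega
      exact ⟨by omega, Or.inr ⟨h1', h2'⟩⟩
    · obtain ⟨rfl, rfl⟩ := pair_eq hy hb h4
      rintro h5
      obtain rfl : k = t := by omega
      exact ⟨by omega, Or.inl ⟨h1', h2'⟩⟩
    · intro h5
      obtain ⟨h6, h7⟩ := h.sound x hx y hy t h5
      rw [h1 t h6, h2 t h6]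
      exact ⟨by omega, h7⟩
  lt t ht := by
    rcases Nat.lt_succ_iff_lt_or_eq.1 ht with ht | rfl
    · rw [h1 t ht, h2 t ht]; exact h.lt t ht
    · rw [h1', h2']; exact ⟨ha, hb⟩
  ne_zero t ht := by
    rcases Nat.lt_succ_iff_lt_or_eq.1 ht with ht | rfl
    · rw [h1 t ht, h2 t ht]
      have := h.ne_zero t ht
      constructor <;> rw [Function.update_apply, Function.update_apply] <;> split_ifs <;> omega
    · rw [h1', h2']
      constructor <;> rw [Function.update_apply, Function.update_apply] <;> split_ifs <;> omega

end tables

/-! ### The numerical form of the input -/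

/-- Numerical data: a list of edges, of corners of triangles, of pairs of triangles, of one
triangle for each vertex, and of coordinates and weights. -/
structure Raw where
  n : ℕ
  E : ℕ
  F : ℕ
  K : ℕ
  e₁ : ℕ → ℕ
  e₂ : ℕ → ℕ
  cor : ℕ → ℕ → ℕ
  l₁ : ℕ → ℕ
  l₂ : ℕ → ℕ
  tau : ℕ → ℕ
  x : ℕ → ℝ
  y : ℕ → ℝ
  wt : ℕ → ℝ

namespace Raw
variable (D : Raw)

/-- The number of corner `p` of triangle `t` in a list of all corners. -/
def flag (t p : ℕ) : ℕ := t + p * D.F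

/-- The vertex at a corner. -/
def vertex (z : ℕ) : ℕ := D.cor (z / D.F) (z % D.F)

/-- The corners are at the same vertex and belong to linked triangles. -/
def Link (u v : ℕ) : Prop :=
  ∃ a < D.K, ∃ p < 3, ∃ q < 3, D.cor p (D.l₁ a) = D.cor q (D.l₂ a) ∧
    (u = D.flag (D.l₁ a) p ∧ v = D.flag (D.l₂ a) q ∨ u = D.flag (D.l₂ a) q ∧ v = D.flag (D.l₁ a) p)

/-- What the correctness of the program needs from a truss. By `deg` a corner has at most two
neighbours, so two memory entries suffice for its adjacency list; by `edge` the weight of every side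
of a triangle can be found in the input. -/
structure Valid : Prop where
  e₁_lt : ∀ a < D.E, D.e₁ a < D.n
  e₂_lt : ∀ a < D.E, D.e₂ a < D.n
  l₁_lt : ∀ a < D.K, D.l₁ a < D.F
  l₂_lt : ∀ a < D.K, D.l₂ a < D.F
  tau_lt : ∀ i < D.n, D.tau i < D.F
  cor_lt : ∀ p < 3, ∀ t < D.F, D.cor p t < D.n
  tau_cor : ∀ i < D.n, ∃ p < 3, D.cor p (D.tau i) = i
  deg : ∀ x u v y, D.Link x u → D.Link x v → D.Link x y → u = v ∨ u = y ∨ v = y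
  edge : ∀ t < D.F, ∀ p < 3, ∀ q < 3, p ≠ q → ∃ a < D.E,
    D.e₁ a = D.cor p t ∧ D.e₂ a = D.cor q t ∨ D.e₁ a = D.cor q t ∧ D.e₂ a = D.cor p t

variable {D}

lemma link_symm (u v : ℕ) : D.Link u v → D.Link v u := by
  rintro ⟨a, ha, p, hp, q, hq, h, h'⟩
  exact ⟨a, ha, p, hp, q, hq, h, h'.symm.imp And.symm And.symm⟩

lemma flag_lt {t p : ℕ} (ht : t < D.F) (hp : p < 3) : D.flag t p < 3 * D.F := by
  unfold flag
  interval_cases p <;> omega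

lemma vertex_flag {t p : ℕ} (ht : t < D.F) : D.vertex (D.flag t p) = D.cor p t := by
  unfold vertex flag
  rw [Nat.add_mul_div_right _ _ (by omega), Nat.add_mul_mod_self_right, Nat.div_eq_of_lt ht,
    Nat.mod_eq_of_lt ht, zero_add]

lemma exists_flag {z : ℕ} (hz : z < 3 * D.F) : ∃ t < D.F, ∃ p < 3, z = D.flag t p := by
  have hF : 0 < D.F := by omega
  refine ⟨z % D.F, Nat.mod_lt _ hF, z / D.F, Nat.div_lt_of_lt_mul (by rwa [mul_comm]), ?_⟩
  unfold flag
  rw [mul_comm, Nat.mod_add_div]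

lemma flag_inj {t p t' p' : ℕ} (ht : t < D.F) (ht' : t' < D.F) (h : D.flag t p = D.flag t' p') :
    t = t' ∧ p = p' := by
  unfold flag at h
  exact (pair_eq ht ht' (by omega : p * D.F + t = p' * D.F + t')).symm

lemma Valid.link_lt (hD : D.Valid) {u v : ℕ} (h : D.Link u v) : u < 3 * D.F ∧ v < 3 * D.F := by
  obtain ⟨a, ha, p, hp, q, hq, -, ⟨rfl, rfl⟩ | ⟨rfl, rfl⟩⟩ := h
  · exact ⟨flag_lt (hD.l₁_lt a ha) hp, flag_lt (hD.l₂_lt a ha) hq⟩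
  · exact ⟨flag_lt (hD.l₂_lt a ha) hq, flag_lt (hD.l₁_lt a ha) hp⟩

lemma Valid.vertex_eq_of_link (hD : D.Valid) {u v : ℕ} (h : D.Link u v) :
    D.vertex u = D.vertex v := by
  obtain ⟨a, ha, p, hp, q, hq, h, ⟨rfl, rfl⟩ | ⟨rfl, rfl⟩⟩ := h <;>
    rw [vertex_flag (hD.l₁_lt a ha), vertex_flag (hD.l₂_lt a ha), h]

lemma Valid.vertex_eq_of_reflTransGen (hD : D.Valid) {u v : ℕ}
    (h : Relation.ReflTransGen D.Link u v) : D.vertex u = D.vertex v := by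
  induction h with
  | refl => rfl
  | tail _ h ih => rw [ih, hD.vertex_eq_of_link h]

end Raw

/-- Entry `0` of word array `a`. -/
abbrev Term.reg (a : ℕ) : Term := .read a (.const 0)

/-- A term whose value is `0` if and only if the values of `x` and `y` are equal. -/
def Term.ne (x y : Term) : Term := .add (.lt x y) (.lt y x)

lemma Term.eval_ne_eq_zero {s : Store} {x y : Term} :
    (Term.ne x y).eval s = 0 ↔ x.eval s = y.eval s := by
  rcases lt_trichotomy (x.eval s) (y.eval s) with h | h | h
  · simp [Term.ne, Term.eval, h, h.ne]
  · simp [Term.ne, Term.eval, h]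
  · simp [Term.ne, Term.eval, h, h.ne']

lemma Runs.ite {W : ℕ} {test : Term} {p q : Prog} {s : Store} {T T' : ℕ} {Q : Store → Prop}
    (h : test.eval s ≠ 0 → Runs W p s T Q) (h' : test.eval s = 0 → Runs W q s T' Q) :
    Runs W (.ite test p q) s (test.cost + (T + T') + 1) Q := by
  by_cases ht : test.eval s = 0
  · obtain ⟨t, s', h1, h2, h3⟩ := h' ht
    exact ⟨_, s', .ite_false ht h1, by omega, h3⟩
  · obtain ⟨t, s', h1, h2, h3⟩ := h ht
    exact ⟨_, s', .ite_true ht h1, by omega, h3⟩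

lemma Runs.set {W a : ℕ} {idx val : Term} {s : Store} {Q : Store → Prop} (hi : idx.eval s ≤ W)
    (hv : val.eval s ≤ W) (h : Q (s.setWord a (idx.eval s) (val.eval s))) :
    Runs W (.set a idx val) s (idx.cost + val.cost + 1) Q :=
  ⟨_, _, .set a idx val s hi hv, le_rfl, h⟩

/-! ### Preparation: sums and a multiplication table -/

namespace Raw
variable {D : Raw} {W : ℕ} {s : Store}

/-- A bound for the numbers that are stored. -/
def bound (D : Raw) : ℕ :=
  (D.n + 3 * D.F) * (D.n + 3 * D.F) + (D.n + 3 * D.F) + 6 * D.F + D.E + D.K + 10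

/-- The data are in the input arrays. -/
structure Loaded (D : Raw) (s : Store) : Prop where
  n : s.word 0 0 = D.n
  E : s.word 0 1 = D.E
  F : s.word 0 2 = D.F
  K : s.word 0 3 = D.K
  e₁ : s.word 1 = D.e₁
  e₂ : s.word 2 = D.e₂
  cor : ∀ p < 3, s.word (3 + p) = D.cor p
  l₁ : s.word 6 = D.l₁
  l₂ : s.word 7 = D.l₂
  tau : s.word 8 = D.tau
  x : s.real 0 = D.x
  y : s.real 1 = D.y
  wt : s.real 2 = D.wt

/-- The data are in the input arrays, and word array `20` holds some sums. -/
structure Ready (D : Raw) (s : Store) : Prop extends D.Loaded s where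
  off : ∀ p < 3, s.word 20 p = p * D.F
  total : s.word 20 3 = 3 * D.F
  twice : s.word 20 4 = 6 * D.F
  side : s.word 20 5 = D.n + 3 * D.F

lemma Ready.congr {s s' : Store} (h : D.Ready s) (hw : ∀ a < 9, s'.word a = s.word a)
    (h20 : s'.word 20 = s.word 20) (hr : ∀ a < 3, s'.real a = s.real a) : D.Ready s' where
  n := by rw [hw 0 (by omega), h.n]
  E := by rw [hw 0 (by omega), h.E]
  F := by rw [hw 0 (by omega), h.F]
  K := by rw [hw 0 (by omega), h.K]
  e₁ := by rw [hw 1 (by omega), h.e₁]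
  e₂ := by rw [hw 2 (by omega), h.e₂]
  cor p hp := by rw [hw (3 + p) (by omega), h.cor p hp]
  l₁ := by rw [hw 6 (by omega), h.l₁]
  l₂ := by rw [hw 7 (by omega), h.l₂]
  tau := by rw [hw 8 (by omega), h.tau]
  x := by rw [hr 0 (by omega), h.x]
  y := by rw [hr 1 (by omega), h.y]
  wt := by rw [hr 2 (by omega), h.wt]
  off p hp := by rw [h20, h.off p hp]
  total := by rw [h20, h.total]
  twice := by rw [h20, h.twice]
  side := by rw [h20, h.side]

lemma Ready.of_sameOff {p : Prog} {s s' : Store} (h : D.Ready s) (h' : SameOff p s s')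
    (hw : ∀ a ∈ p.words, 9 ≤ a ∧ a ≠ 20 := by decide) (hr : ∀ a ∈ p.reals, 3 ≤ a := by decide) :
    D.Ready s' :=
  h.congr (fun a ha => h'.word a fun h => by have := hw a h; omega)
    (h'.word 20 fun h => (hw 20 h).2 rfl) (fun a ha => h'.real a fun h => by have := hr a h; omega)

lemma Ready.setWord (h : D.Ready s) {a : ℕ} (i v : ℕ) (ha : 9 ≤ a) (ha' : a ≠ 20) :
    D.Ready (s.setWord a i v) :=
  h.congr (fun b hb => by rw [Store.word_setWord, if_neg (by omega)])
    (by rw [Store.word_setWord, if_neg ha'.symm]) fun _ _ => rfl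

/-- Computation of some sums. -/
def initProg : Prog :=
  .seq (.set 20 (.const 0) (.const 0)) <| .seq (.set 20 (.const 1) (.read 0 (.const 2))) <|
  .seq (.set 20 (.const 2) (.add (.read 0 (.const 2)) (.read 0 (.const 2)))) <|
  .seq (.set 20 (.const 3) (.add (.read 20 (.const 2)) (.read 0 (.const 2)))) <|
  .seq (.set 20 (.const 4) (.add (.read 20 (.const 3)) (.read 20 (.const 3))))
    (.set 20 (.const 5) (.add (.reg 0) (.read 20 (.const 3))))

lemma runs_initProg (hs : D.Loaded s) (hW : D.bound ≤ W) : Runs W initProg s 100 D.Ready := by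
  have h1 := hs.n
  have h2 := hs.F
  unfold bound at hW
  have h3 : 0 ≤ (D.n + 3 * D.F) * (D.n + 3 * D.F) := Nat.zero_le _
  generalize (D.n + 3 * D.F) * (D.n + 3 * D.F) = X at hW h3
  refine Prog.Pre.runs ?_
  simp only [initProg, Prog.Pre, Term.eval, Store.word_setWord, if_true, h1, h2,
    Function.update_self, Function.update_apply, OfNat.zero_ne_ofNat, if_false,
    Nat.reduceEqDiff]
  refine ⟨by omega, by omega, by omega, by omega, by omega, by omega, by omega, by omega, by omega,
    by omega, by omega, by omega, ?_⟩
  exact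
  { n := by simpa [Store.word_setWord] using hs.n
    E := by simpa [Store.word_setWord] using hs.E
    F := by simpa [Store.word_setWord] using hs.F
    K := by simpa [Store.word_setWord] using hs.K
    e₁ := by simpa [Store.word_setWord] using hs.e₁
    e₂ := by simpa [Store.word_setWord] using hs.e₂
    cor := fun p hp => by
      have h := hs.cor p hp
      have : 3 + p ≠ 20 := by omega
      simpa [Store.word_setWord, this] using h
    l₁ := by simpa [Store.word_setWord] using hs.l₁
    l₂ := by simpa [Store.word_setWord] using hs.l₂
    tau := by simpa [Store.word_setWord] using hs.tau
    x := hs.x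
    y := hs.y
    wt := hs.wt
    off := fun p hp => by interval_cases p <;> simp [Store.word_setWord]; omega
    total := by simp [Store.word_setWord]; omega
    twice := by simp [Store.word_setWord]; omega
    side := by simp [Store.word_setWord]; omega }

/-- Multiplication table of `n + 3 F`. -/
def mulProg : Prog :=
  .seq (.set 21 (.const 0) (.const 0)) <| .count 40 20 5 <|
    .set 21 (.add (.reg 40) (.const 1)) (.add (.read 21 (.reg 40)) (.read 20 (.const 5)))

/-- The machine cannot multiply, so the row addresses of the square tables are computed in advance
by repeated addition. The last product is the largest, and the word bound is quadratic for its sake.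
-/
lemma runs_mulProg (hs : D.Ready s) (hW : D.bound ≤ W) :
    Runs W mulProg s (100 * (D.n + 3 * D.F) + 100) fun s' =>
      ∀ a ≤ D.n + 3 * D.F, s'.word 21 a = a * (D.n + 3 * D.F) := by
  unfold bound at hW
  refine (Runs.seq (Runs.set (by simp [Term.eval]) (by simp [Term.eval]) (Q := fun s' =>
    s'.word 21 0 = 0 ∧ s'.word 20 5 = D.n + 3 * D.F) ?_) fun s1 h1 =>
    Runs.count (T := 20) (B := D.n + 3 * D.F)
    (fun k s' => ∀ a ≤ k, s'.word 21 a = a * (D.n + 3 * D.F)) ?_ ?_ ?_ ?_ ?_ ?_ ?_).mono ?_ ?_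
  · simp [Store.word_setWord, hs.side, Term.eval]
  · decide
  · decide
  · exact h1.2
  · omega
  · intro a ha
    obtain rfl : a = 0 := by omega
    simpa using h1.1
  · intro k s v h a ha
    rw [Store.word_setWord, if_neg (by decide), h a ha]
  · intro k hk s2 h2 h3 h4
    have h5 : s2.word 20 5 = D.n + 3 * D.F := by rw [h4.word 20 (by decide), h1.2]
    refine Prog.Pre.runs ?_
    have h6 : k * (D.n + 3 * D.F) + (D.n + 3 * D.F) ≤ (D.n + 3 * D.F) * (D.n + 3 * D.F) := by
      rw [← Nat.succ_mul]; exact Nat.mul_le_mul_right _ hk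
    simp only [Prog.Pre, Term.eval, h3, h5, h2 k le_rfl]
    refine ⟨by omega, by omega, fun a ha => ?_⟩
    rw [Store.word_setWord, if_pos rfl, Function.update_apply]
    split_ifs with h7
    · rw [h7, Nat.succ_mul k]
    · exact h2 a (by omega)
  · simp only [Term.cost]; omega
  · exact fun s' h => h

end Raw
-- Adjacency lists of the corners
namespace Raw
variable {D : Raw} {W : ℕ} {s : Store}

/-- Word arrays `22` and `23` list `v` as a neighbour of `u`. -/
def Listed (s : Store) (u v : ℕ) : Prop := s.word 22 u = v + 1 ∨ s.word 23 u = v + 1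

lemma listed_congr {s s' : Store} (h : s'.word 22 = s.word 22) (h' : s'.word 23 = s.word 23)
    {u v : ℕ} : Listed s' u v ↔ Listed s u v := by
  rw [Listed, h, h', Listed]

lemma listed_setWord {a i x u v : ℕ} (h : 22 ≠ a) (h' : 23 ≠ a) :
    Listed (s.setWord a i x) u v ↔ Listed s u v :=
  listed_congr (by rw [Store.word_setWord, if_neg h]) (by rw [Store.word_setWord, if_neg h'])

/-- List the value of register `b'` as a neighbour of that of register `b`. -/
def addProg (b b' : ℕ) : Prog :=
  .ite (.read 22 (.reg b))
    (.ite (.ne (.read 22 (.reg b)) (.add (.reg b') (.const 1)))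
      (.set 23 (.reg b) (.add (.reg b') (.const 1))) .skip)
    (.set 22 (.reg b) (.add (.reg b') (.const 1)))

/-- Neighbours are stored with `1` added, since `0` marks an unused entry. The second entry may be
overwritten without a test. -/
lemma runs_addProg (hD : D.Valid) (hW : D.bound ≤ W) {b b' x y : ℕ} (hx : s.word b 0 = x)
    (hy : s.word b' 0 = y) (hxy : D.Link x y) (hs : ∀ u v, Listed s u v → D.Link u v) :
    Runs W (addProg b b') s 40 fun s' => (∀ u v, Listed s' u v → D.Link u v) ∧ Listed s' x y ∧
      ∀ u v, Listed s u v → Listed s' u v := by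
  have hlt := hD.link_lt hxy
  unfold bound at hW
  refine Prog.Pre.runs ?_ (by simp [addProg, Prog.maxCost, Term.cost, Term.ne])
  simp only [addProg, Prog.Pre, Term.eval, hx, hy]
  refine ⟨fun h0 => ⟨fun h1 => ⟨by omega, by omega, ?_⟩, fun h1 => ?_⟩, fun h0 =>
    ⟨by omega, by omega, ?_⟩⟩
  · have h1 : s.word 22 x ≠ y + 1 := by
      intro h2; exact h1 (Term.eval_ne_eq_zero.2 (by simp only [Term.eval, hx, hy, h2]))
    obtain ⟨z, hz⟩ := Nat.exists_eq_succ_of_ne_zero h0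
    have hxz := hs x z (Or.inl hz)
    simp only [Listed, Store.word_setWord, if_true, Function.update_apply, Nat.reduceEqDiff, if_false]
    refine ⟨fun u v => ?_, Or.inr (by simp), fun u v => ?_⟩
    · rintro (h | h)
      · exact hs u v (Or.inl h)
      · split_ifs at h with h2
        · subst h2
          obtain rfl : y = v := by omega
          exact hxy
        · exact hs u v (Or.inr h)
    · rintro (h | h)
      · exact Or.inl h
      · split_ifs with h2
        · subst h2
          -- The old second neighbour `v` equals the first one `z` or the new one `y`, because a
          -- corner has only two neighbours and `z ≠ y`. In both cases it is still listed.
          rcases hD.deg u v z y (hs u v (Or.inr h)) hxz hxy with rfl | rfl | rfl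
          · exact Or.inl hz
          · exact Or.inr rfl
          · exact absurd hz h1
        · exact Or.inr h
  · have h1 := Term.eval_ne_eq_zero.1 h1
    simp only [Term.eval, hx, hy] at h1
    exact ⟨hs, Or.inl h1, fun _ _ h => h⟩
  · simp only [Listed, Store.word_setWord, if_true, Function.update_apply, Nat.reduceEqDiff, if_false]
    refine ⟨fun u v => ?_, Or.inl (by simp), fun u v => ?_⟩
    · rintro (h | h)
      · split_ifs at h with h2
        · subst h2
          obtain rfl : y = v := by omega
          exact hxy
        · exact hs u v (Or.inl h)
      · exact hs u v (Or.inr h)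
    · rintro (h | h)
      · split_ifs with h2
        · subst h2; omega
        · exact Or.inl h
      · exact Or.inr h

/-- If corner `p` of the first triangle and corner `q` of the second triangle of a link are at the
same vertex, list them as neighbours. -/
def linkStep (c : ℕ × ℕ) : Prog :=
  .seq (.set 30 (.const 0) (.add (.read 6 (.reg 40)) (.read 20 (.const c.1)))) <|
  .seq (.set 31 (.const 0) (.add (.read 7 (.reg 40)) (.read 20 (.const c.2)))) <|
  .ite (.ne (.read (3 + c.1) (.read 6 (.reg 40))) (.read (3 + c.2) (.read 7 (.reg 40)))) .skip
    (.seq (addProg 30 31) (addProg 31 30))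

/-- The pairs of corner numbers. -/
def cornerPairs : List (ℕ × ℕ) :=
  [(0, 0), (0, 1), (0, 2), (1, 0), (1, 1), (1, 2), (2, 0), (2, 1), (2, 2)]

lemma mem_cornerPairs {c : ℕ × ℕ} : c ∈ cornerPairs ↔ c.1 < 3 ∧ c.2 < 3 := by
  constructor
  · intro h
    simp only [cornerPairs, List.mem_cons, List.not_mem_nil, or_false] at h
    rcases h with rfl | rfl | rfl | rfl | rfl | rfl | rfl | rfl | rfl <;> simp
  · obtain ⟨p, q⟩ := c
    rintro ⟨hp, hq⟩
    interval_cases p <;> interval_cases q <;> decide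

/-- List the neighbours of all corners. -/
def linkProg : Prog := .count 40 0 3 (.seqs (cornerPairs.map linkStep))

lemma runs_linkStep (hD : D.Valid) (hs : D.Ready s) (hW : D.bound ≤ W) {k : ℕ} (hk : k < D.K)
    (h40 : s.word 40 0 = k) {c : ℕ × ℕ} (hc : c.1 < 3 ∧ c.2 < 3)
    (hJ : ∀ u v, Listed s u v → D.Link u v) :
    Runs W (linkStep c) s 200 fun s' => (∀ u v, Listed s' u v → D.Link u v) ∧
      (D.cor c.1 (D.l₁ k) = D.cor c.2 (D.l₂ k) →
        Listed s' (D.flag (D.l₁ k) c.1) (D.flag (D.l₂ k) c.2) ∧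
        Listed s' (D.flag (D.l₂ k) c.2) (D.flag (D.l₁ k) c.1)) ∧
      ∀ u v, Listed s u v → Listed s' u v := by
  obtain ⟨p, q⟩ := c
  obtain ⟨hp, hq⟩ := hc
  simp only at hp hq
  have h1 := flag_lt (hD.l₁_lt k hk) hp
  have h2 := flag_lt (hD.l₂_lt k hk) hq
  have e1 : s.word 6 k + s.word 20 p = D.flag (D.l₁ k) p := by rw [hs.l₁, hs.off p hp, flag]
  have e2 : s.word 7 k + s.word 20 q = D.flag (D.l₂ k) q := by rw [hs.l₂, hs.off q hq, flag]
  have hW' := hW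
  unfold bound at hW
  refine ((Runs.set (by simp [Term.eval]) (by simp only [Term.eval, h40, e1]; omega) rfl).seq
    fun s1 h3 => (Runs.set (by simp [Term.eval]) ?_ rfl).seq fun s2 h4 =>
    Runs.ite (T := 1) (T' := 80) (fun h => ?_) fun h => ?_).mono
    (by simp [Term.cost, Term.ne]) fun _ h => h
  · subst h3
    simp only [Term.eval, Store.word_setWord, Nat.reduceEqDiff, if_false, h40, e2]
    omega
  all_goals
    have hs2 : D.Ready s2 := by
      rw [← h4, ← h3]; exact (hs.setWord _ _ (by omega) (by omega)).setWord _ _ (by omega) (by omega)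
    have h40' : s2.word 40 0 = k := by
      rw [← h4, ← h3]; simpa [Store.word_setWord] using h40
    have hL : ∀ u v, Listed s2 u v ↔ Listed s u v := by
      intro u v
      rw [← h4, ← h3, listed_setWord (by decide) (by decide), listed_setWord (by decide) (by decide)]
  · have hne : D.cor p (D.l₁ k) ≠ D.cor q (D.l₂ k) := by
      intro h'
      refine h (Term.eval_ne_eq_zero.2 ?_)
      simp only [Term.eval, h40', hs2.l₁, hs2.l₂, hs2.cor p hp, hs2.cor q hq, h']
    exact ⟨_, _, .skip _, le_rfl, fun u v h => hJ u v ((hL u v).1 h), fun h => absurd h hne,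
      fun u v h => (hL u v).2 h⟩
  · have heq := Term.eval_ne_eq_zero.1 h
    simp only [Term.eval, h40', hs2.l₁, hs2.l₂, hs2.cor p hp, hs2.cor q hq] at heq
    have h30 : s2.word 30 0 = D.flag (D.l₁ k) p := by
      rw [← h4, ← h3]; simp [Store.word_setWord, Term.eval, h40, e1]
    have h31 : s2.word 31 0 = D.flag (D.l₂ k) q := by
      rw [← h4, ← h3]; simp [Store.word_setWord, Term.eval, h40, e2]
    have hlink : D.Link (D.flag (D.l₁ k) p) (D.flag (D.l₂ k) q) :=
      ⟨k, hk, p, hp, q, hq, heq, Or.inl ⟨rfl, rfl⟩⟩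
    refine (runs_addProg hD hW' h30 h31 hlink
      fun u v h => hJ u v ((hL u v).1 h)).sameOff.seq (T' := 40) fun s3 h5 =>
      (runs_addProg hD hW' (x := D.flag (D.l₂ k) q) (y := D.flag (D.l₁ k) p) ?_ ?_
        (link_symm _ _ hlink) h5.1.1).mono le_rfl fun s4 h6 => ?_
    · rw [h5.2.word 31 (by decide), h31]
    · rw [h5.2.word 30 (by decide), h30]
    · exact ⟨h6.1, fun _ => ⟨h6.2.2 _ _ h5.1.2.1, h6.2.1⟩,
        fun u v h => h6.2.2 _ _ (h5.1.2.2 _ _ ((hL u v).2 h))⟩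

lemma runs_linkProg (hD : D.Valid) (hs : D.Ready s) (hW : D.bound ≤ W) (h22 : s.word 22 = 0)
    (h23 : s.word 23 = 0) :
    Runs W linkProg s (2000 * D.K + 100) fun s' => ∀ u v, Listed s' u v ↔ D.Link u v := by
  refine (Runs.count_forall (T := 9 * 200 + 1) (fun s => ∀ u v, Listed s u v → D.Link u v)
    (fun k s => ∀ c : ℕ × ℕ, c.1 < 3 ∧ c.2 < 3 → D.cor c.1 (D.l₁ k) = D.cor c.2 (D.l₂ k) →
        Listed s (D.flag (D.l₁ k) c.1) (D.flag (D.l₂ k) c.2) ∧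
        Listed s (D.flag (D.l₂ k) c.2) (D.flag (D.l₁ k) c.1))
    (by decide) (by decide) hs.K (by unfold bound at hW; omega) ?_ ?_ ?_ ?_).mono (by omega) ?_
  · intro u v h
    simp [Listed, h22, h23] at h
  · intro s v h a b h1
    rw [listed_setWord (by decide) (by decide)] at h1
    exact h a b h1
  · intro k s v h c hc h1
    rw [listed_setWord (by decide) (by decide), listed_setWord (by decide) (by decide)]
    exact h c hc h1
  · intro k hk s1 h1 h2 h3
    have hs1 : D.Ready s1 := hs.of_sameOff h3
    refine (Runs.seqs (f := linkStep) (T := 200) (l := cornerPairs)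
      (fun s2 => (∀ u v, Listed s2 u v → D.Link u v) ∧ ∀ u v, Listed s1 u v → Listed s2 u v)
      (fun c s => D.cor c.1 (D.l₁ k) = D.cor c.2 (D.l₂ k) →
        Listed s (D.flag (D.l₁ k) c.1) (D.flag (D.l₂ k) c.2) ∧
        Listed s (D.flag (D.l₂ k) c.2) (D.flag (D.l₁ k) c.1)) ⟨h1, fun _ _ h => h⟩ ?_).mono
        (by decide) fun s2 h4 => ?_
    · intro c hc s2 h4 h5
      refine (runs_linkStep hD (hs1.of_sameOff h5) hW hk ?_ (mem_cornerPairs.1 hc) h4.1).mono le_rfl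
        fun s3 h6 => ⟨⟨h6.1, fun u v h => h6.2.2 u v (h4.2 u v h)⟩, h6.2.1, fun d h7 h8 =>
          ⟨h6.2.2 _ _ (h7 h8).1, h6.2.2 _ _ (h7 h8).2⟩⟩
      rw [h5.word 40 (by decide), h2]
    · exact ⟨h4.1.1, fun c hc => h4.2.1 c (mem_cornerPairs.2 hc), fun d _ h5 c hc h6 =>
        ⟨h4.1.2 _ _ (h5 c hc h6).1, h4.1.2 _ _ (h5 c hc h6).2⟩⟩
  · rintro s' ⟨h1, h2⟩ u v
    refine ⟨h1 u v, ?_⟩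
    rintro ⟨a, ha, p, hp, q, hq, h, ⟨rfl, rfl⟩ | ⟨rfl, rfl⟩⟩
    · exact (h2 a ha (p, q) ⟨hp, hq⟩ h).1
    · exact (h2 a ha (p, q) ⟨hp, hq⟩ h).2

end Raw

lemma PartialLabels.nlab_le {R : ℕ → ℕ → Prop} {N : ℕ} {lab ord : ℕ → ℕ} {tail nlab : ℕ}
    (h : PartialLabels R N lab ord tail nlab) : nlab ≤ N := by
  choose! f hf using h.lab_surj
  have := Finset.card_le_card_of_injOn (s := Finset.range nlab) (t := Finset.range N) f
    (fun a ha => by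
      have ha' : a < nlab := by simpa using ha
      have h1 : lab (f a) ≠ 0 := by rw [hf a ha']; omega
      simpa using h.lt h1)
    (fun a ha b hb hab => by
      have h1 := hf a (by simpa using ha)
      have h2 := hf b (by simpa using hb)
      rw [hab] at h1; omega)
  simpa using this

/-! ### Breadth-first search for the components -/

namespace Raw
variable {D : Raw} {W : ℕ} {s : Store}

/-- Put the number of the corner at vertex `k` of the triangle assigned to `k` into register `30`. -/
def cornerProg : Prog :=
  .ite (.ne (.read 3 (.read 8 (.reg 40))) (.reg 40))
    (.ite (.ne (.read 4 (.read 8 (.reg 40))) (.reg 40))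
      (.set 30 (.const 0) (.add (.read 8 (.reg 40)) (.read 20 (.const 2))))
      (.set 30 (.const 0) (.add (.read 8 (.reg 40)) (.read 20 (.const 1)))))
    (.set 30 (.const 0) (.add (.read 8 (.reg 40)) (.read 20 (.const 0))))

lemma runs_cornerProg (hD : D.Valid) (hs : D.Ready s) (hW : D.bound ≤ W) {k : ℕ} (hk : k < D.n)
    (h40 : s.word 40 0 = k) :
    Runs W cornerProg s 60 fun s' => ∃ p < 3, D.cor p (D.tau k) = k ∧
      s'.word 30 0 = D.flag (D.tau k) p := by
  have ht := hD.tau_lt k hk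
  unfold bound at hW
  have e0 := hs.off 0 (by omega)
  have e1 := hs.off 1 (by omega)
  have e2 := hs.off 2 (by omega)
  have c0 := hs.cor 0 (by omega)
  have c1 := hs.cor 1 (by omega)
  simp only [Nat.add_zero, Nat.reduceAdd] at c0 c1
  have hlt : ∀ p < 3, D.tau k + p * D.F < 3 * D.F := fun p hp => flag_lt ht hp
  refine Prog.Pre.runs ?_
  simp only [cornerProg, Prog.Pre, Term.eval, h40, hs.tau, e0, e1, e2]
  refine ⟨fun h1 => ⟨fun h2 => ⟨by omega, ?_, ?_⟩, fun h2 => ⟨by omega, ?_, ?_⟩⟩, fun h1 =>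
    ⟨by omega, ?_, ?_⟩⟩
  · have := hlt 2 (by omega); omega
  · obtain ⟨p, hp, hpk⟩ := hD.tau_cor k hk
    refine ⟨p, hp, hpk, ?_⟩
    have hp0 : p ≠ 0 := by
      rintro rfl
      exact h1 (Term.eval_ne_eq_zero.2 (by simp only [Term.eval, h40, hs.tau, c0, hpk]))
    have hp1 : p ≠ 1 := by
      rintro rfl
      exact h2 (Term.eval_ne_eq_zero.2 (by simp only [Term.eval, h40, hs.tau, c1, hpk]))
    obtain rfl : p = 2 := by omega
    simp [Store.word_setWord, flag]
  · have := hlt 1 (by omega); omega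
  · have h2 := Term.eval_ne_eq_zero.1 h2
    simp only [Term.eval, h40, hs.tau, c1] at h2
    exact ⟨1, by omega, h2, by simp [Store.word_setWord, flag]⟩
  · have := hlt 0 (by omega); omega
  · have h2 := Term.eval_ne_eq_zero.1 h1
    simp only [Term.eval, h40, hs.tau, c0] at h2
    exact ⟨0, by omega, h2, by simp [Store.word_setWord, flag]⟩

/-- The first `k` labels are those of the original copies of vertices. -/
def Original (D : Raw) (k : ℕ) (lab : ℕ → ℕ) : Prop :=
  ∀ i < k, ∃ p < 3, D.cor p (D.tau i) = i ∧ lab (D.flag (D.tau i) p) = i + 1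

/-- Label one corner at each vertex. -/
def seedProg : Prog :=
  .seq (.count 40 0 0 <| .seq cornerProg <|
    .seq (.set 24 (.reg 30) (.add (.reg 40) (.const 1))) (.set 25 (.reg 40) (.reg 30))) <|
  .seq (.set 26 (.const 0) (.reg 0)) <| .seq (.set 27 (.const 0) (.reg 0)) <|
  .seq (.set 28 (.const 0) (.const 0)) (.set 29 (.const 0) (.const 0))

/-- Links join corners at the same vertex only, so corners chosen at different vertices are in
different components and may receive different labels. Vertex `i` gives label `i + 1` to its corner
in the face `τ i`, which makes that copy the original one. All seeds are put into the queue. -/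
lemma runs_seedProg (hD : D.Valid) (hs : D.Ready s) (hW : D.bound ≤ W) (h24 : s.word 24 = 0) :
    Runs W seedProg s (200 * D.n + 100) fun s' =>
      PartialLabels D.Link (3 * D.F) (s'.word 24) (s'.word 25) D.n D.n ∧
      D.Original D.n (s'.word 24) ∧ s'.word 26 0 = D.n ∧ s'.word 27 0 = D.n ∧ s'.word 28 0 = 0 ∧
      s'.word 29 0 = 0 := by
  have hW' := hW
  unfold bound at hW
  refine ((Runs.count (T := 100) (fun k s' =>
      PartialLabels D.Link (3 * D.F) (s'.word 24) (s'.word 25) k k ∧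
      D.Original k (s'.word 24) ∧ ∀ x, s'.word 24 x ≠ 0 → D.vertex x < k)
      (by decide) (by decide) hs.n (by omega) ?_ ?_ ?_).sameOff.seq (T' := 20)
      fun s1 h1 => ?_).mono (by omega) fun _ h => h
  · rw [h24]
    exact ⟨PartialLabels.empty, by simp [Original], by simp⟩
  · intro k s v h
    simpa [Store.word_setWord] using h
  · intro k hk s1 h1 h2 h3
    have hs1 := hs.of_sameOff h3
    refine ((runs_cornerProg hD hs1 hW' hk h2).sameOff.seq (T' := 20) fun s2 h4 => ?_).mono
      (by omega) fun _ h => h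
    obtain ⟨⟨p, hp, hpk, h30⟩, h4⟩ := h4
    have ht := hD.tau_lt k hk
    have hlt := flag_lt ht hp
    have hv : D.vertex (D.flag (D.tau k) p) = k := by rw [vertex_flag ht, hpk]
    have h40 : s2.word 40 0 = k := by rw [h4.word 40 (by decide), h2]
    refine Prog.Pre.runs ?_
    simp only [Prog.Pre, Term.eval, Store.word_setWord, if_true, Nat.reduceEqDiff, if_false, h30,
      h40, h4.word 24 (by decide), h4.word 25 (by decide)]
    have h0 : s1.word 24 (D.flag (D.tau k) p) = 0 := by
      by_contra h
      have := h1.2.2 _ h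
      omega
    refine ⟨by omega, by omega, by omega, by omega, h1.1.insert_new link_symm h0 hlt ?_, ?_, ?_⟩
    · intro x hx h'
      have := h1.2.2 x hx
      rw [hD.vertex_eq_of_reflTransGen h', hv] at this
      omega
    · intro i hi
      by_cases hik : i = k
      · subst hik
        exact ⟨p, hp, hpk, by simp⟩
      · obtain ⟨q, hq, hqi, h5⟩ := h1.2.1 i (by omega)
        refine ⟨q, hq, hqi, ?_⟩
        rw [Function.update_of_ne, h5]
        intro h6
        have h7 := vertex_flag (hD.tau_lt i (by omega)) (p := q)
        rw [h6, hv, hqi] at h7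
        exact hik h7.symm
    · intro x
      rw [Function.update_apply]
      split_ifs with h5
      · intro _; rw [h5, hv]; omega
      · intro h; have := h1.2.2 x h; omega
  · have h0 : s1.word 0 0 = D.n := by rw [h1.2.word 0 (by decide), hs.n]
    refine Prog.Pre.runs ?_
    simp only [Prog.Pre, Term.eval, Store.word_setWord, if_true, Nat.reduceEqDiff, if_false, h0,
      Function.update_self, OfNat.zero_ne_ofNat]
    exact ⟨by omega, by omega, by omega, by omega, by omega, by omega, by omega, by omega,
      h1.1.1, h1.1.2.1, by simp⟩

/-- If the neighbour in array `b` of the corner in register `30` has no label, then give it the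
same label. -/
def visitProg (b : ℕ) : Prog :=
  .ite (.read b (.reg 30))
    (.seq (.set 31 (.const 0) (.sub (.read b (.reg 30)) (.const 1))) <|
      .ite (.read 24 (.reg 31)) .skip <|
      .seq (.set 24 (.reg 31) (.read 24 (.reg 30))) <| .seq (.set 25 (.reg 26) (.reg 31))
        (.set 26 (.const 0) (.add (.reg 26) (.const 1))))
    .skip

/-- In `s'`, at least as many corners are labelled as in `s`, with the same labels. -/
structure Continues (D : Raw) (s s' : Store) (nlab nlab' : ℕ) : Prop where
  part : PartialLabels D.Link (3 * D.F) (s'.word 24) (s'.word 25) (s'.word 26 0) nlab'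
  lab_eq : ∀ z, s.word 24 z ≠ 0 → s'.word 24 z = s.word 24 z
  ord_eq : ∀ k < s.word 26 0, s'.word 25 k = s.word 25 k
  tail_le : s.word 26 0 ≤ s'.word 26 0

lemma Continues.refl {nlab : ℕ}
    (h : PartialLabels D.Link (3 * D.F) (s.word 24) (s.word 25) (s.word 26 0) nlab) :
    D.Continues s s nlab nlab :=
  ⟨h, fun _ _ => rfl, fun _ _ => rfl, le_rfl⟩

lemma Continues.trans {s' s'' : Store} {a b c : ℕ} (h : D.Continues s s' a b)
    (h' : D.Continues s' s'' b c) : D.Continues s s'' a c where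
  part := h'.part
  lab_eq z hz := by rw [h'.lab_eq z (by rwa [h.lab_eq z hz]), h.lab_eq z hz]
  ord_eq k hk := by rw [h'.ord_eq k (hk.trans_le h.tail_le), h.ord_eq k hk]
  tail_le := h.tail_le.trans h'.tail_le

/-- Storing a label for a corner without label and putting the corner into the queue. -/
lemma continues_push {s' : Store} {nlab nlab' y v : ℕ} (hy : s.word 24 y = 0)
    (h24 : s'.word 24 = Function.update (s.word 24) y v)
    (h25 : s'.word 25 = Function.update (s.word 25) (s.word 26 0) y)
    (h26 : s'.word 26 0 = s.word 26 0 + 1)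
    (h : PartialLabels D.Link (3 * D.F) (Function.update (s.word 24) y v)
      (Function.update (s.word 25) (s.word 26 0) y) (s.word 26 0 + 1) nlab') :
    D.Continues s s' nlab nlab' where
  part := by rw [h24, h25, h26]; exact h
  lab_eq z hz := by rw [h24, Function.update_of_ne]; rintro rfl; exact hz hy
  ord_eq k hk := by rw [h25, Function.update_of_ne (by omega)]
  tail_le := by omega

lemma runs_visitProg (hD : D.Valid) (hW : D.bound ≤ W) {b x nlab : ℕ}
    (h : PartialLabels D.Link (3 * D.F) (s.word 24) (s.word 25) (s.word 26 0) nlab)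
    (hb : ∀ y, s.word b x = y + 1 → D.Link x y) (h30 : s.word 30 0 = x) (hx : s.word 24 x ≠ 0) :
    Runs W (visitProg b) s 60 fun s' => D.Continues s s' nlab nlab ∧
      ∀ y, s.word b x = y + 1 → s'.word 24 y ≠ 0 := by
  unfold bound at hW
  refine Prog.Pre.runs ?_ (by simp [visitProg, Prog.maxCost, Term.cost])
  simp only [visitProg, Prog.Pre, Term.eval, Store.word_setWord, if_true, Nat.reduceEqDiff, if_false,
    h30, Function.update_self]
  have h1 := h.tail_le
  have h2 := h.nlab_le
  have h3 := h.lab_le x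
  refine ⟨fun h0 => ?_, fun h0 => ⟨Continues.refl h, by simp [h0]⟩⟩
  obtain ⟨y, hy⟩ := Nat.exists_eq_succ_of_ne_zero h0
  have hxy := hb y hy
  have hlt := (hD.link_lt hxy).2
  rw [hy, Nat.succ_sub_one]
  refine ⟨by omega, by omega, fun h4 => ⟨⟨h, fun _ _ => rfl, fun _ _ => rfl, le_rfl⟩,
    fun z hz => ?_⟩, fun h4 => ?_⟩
  · obtain rfl : y = z := by omega
    simpa [Store.word_setWord] using h4
  · have hp := h.insert_neighbor link_symm hx h4 hlt hxy
    refine ⟨by omega, by omega, by omega, by omega, by omega, by omega,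
      continues_push (y := y) h4 (by simp [Store.word_setWord]) (by simp [Store.word_setWord])
      (by simp [Store.word_setWord]) hp, fun z hz => ?_⟩
    obtain rfl : y = z := by omega
    simpa [Store.word_setWord] using hx

/-- One step of a breadth-first search: visit the neighbours of the next corner in the queue, or,
if the queue is empty, give a new label to the next corner unless it has a label. -/
def searchStep : Prog :=
  .ite (.lt (.reg 28) (.reg 26))
    (.seq (.set 30 (.const 0) (.read 25 (.reg 28))) <| .seq (visitProg 22) <| .seq (visitProg 23)
      (.set 28 (.const 0) (.add (.reg 28) (.const 1))))
    (.seq (.ite (.read 24 (.reg 29)) .skip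
      (.seq (.set 27 (.const 0) (.add (.reg 27) (.const 1))) <|
        .seq (.set 24 (.reg 29) (.reg 27)) <| .seq (.set 25 (.reg 26) (.reg 29))
          (.set 26 (.const 0) (.add (.reg 26) (.const 1)))))
      (.set 29 (.const 0) (.add (.reg 29) (.const 1))))

/-- The state of the search after `k` steps. -/
structure Search (D : Raw) (lab₀ : ℕ → ℕ) (k : ℕ) (s : Store) : Prop where
  part : PartialLabels D.Link (3 * D.F) (s.word 24) (s.word 25) (s.word 26 0) (s.word 27 0)
  keep : ∀ z, lab₀ z ≠ 0 → s.word 24 z = lab₀ z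
  head_le : s.word 28 0 ≤ s.word 26 0
  closed : ∀ j < s.word 28 0, ∀ y, D.Link (s.word 25 j) y → s.word 24 y ≠ 0
  swept : ∀ z < s.word 29 0, s.word 24 z ≠ 0
  swept_le : s.word 29 0 ≤ 3 * D.F
  steps : s.word 28 0 + s.word 29 0 = k

/-- Every step advances either the head of the queue (register `28`) or the sweep over all corners
(register `29`). Both are at most `3 F`, which explains the total of `6 F` steps. The sweep opens a
new component only when the queue is empty. -/
lemma runs_searchStep (hD : D.Valid) (hW : D.bound ≤ W) (hnb : ∀ u v, Listed s u v ↔ D.Link u v)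
    {lab₀ : ℕ → ℕ} {k : ℕ} (hk : k < 6 * D.F) (h : D.Search lab₀ k s) :
    Runs W searchStep s 300 (D.Search lab₀ (k + 1)) := by
  have hW' := hW
  unfold bound at hW
  have h1 := h.part.tail_le
  have h2 := h.part.nlab_le
  have h3 := h.head_le
  have h4 := h.swept_le
  have h5 := h.steps
  refine (Runs.ite (T := 200) (T' := 80) (fun ht => ?_) fun ht => ?_).mono
    (by simp [Term.cost]) fun _ h => h
  · have ht : s.word 28 0 < s.word 26 0 := by
      by_contra h'; exact ht (by simp [Term.eval, h'])
    have hord := h.part.ord_lt _ ht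
    set x := s.word 25 (s.word 28 0) with hx
    have hxl : s.word 24 x ≠ 0 := (h.part.lab_ne_zero x).2 ⟨_, ht, rfl⟩
    refine ((Runs.set (Q := fun s' => s' = s.setWord 30 0 x) (by simp [Term.eval])
      (by simp only [Term.eval]; omega) (by simp [Term.eval, hx])).seq
      fun s1 h6 => (runs_visitProg hD hW' (b := 22) (x := x) (nlab := s.word 27 0) ?_ ?_ ?_
        ?_).sameOff.seq (T' := 70) fun s2 h7 => ?_).mono (by simp [Term.cost]) fun _ h => h
    · rw [h6]; simpa [Store.word_setWord] using h.part
    · intro y hy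
      rw [← hnb]
      rw [h6] at hy
      exact Or.inl (by simpa [Store.word_setWord] using hy)
    · rw [h6]; simp [Store.word_setWord]
    · rw [h6]; simpa [Store.word_setWord] using hxl
    · obtain ⟨⟨h8, h9⟩, h10⟩ := h7
      have c1 : D.Continues s s1 (s.word 27 0) (s.word 27 0) := by
        rw [h6]
        exact ⟨by simpa [Store.word_setWord] using h.part, by simp [Store.word_setWord],
          by simp [Store.word_setWord], by simp [Store.word_setWord]⟩
      have c2 := c1.trans h8
      have h23 : s2.word 23 = s.word 23 := by
        rw [h10.word 23 (by decide), h6]; simp [Store.word_setWord]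
      refine ((runs_visitProg hD hW' (b := 23) (x := x) h8.part ?_ ?_ ?_).sameOff.seq
        (T' := 10) fun s3 h11 => ?_).mono (by omega) fun _ h => h
      · intro y hy
        rw [← hnb]
        exact Or.inr (by rwa [← h23])
      · rw [h10.word 30 (by decide), h6]; simp [Store.word_setWord]
      · rwa [c2.lab_eq x hxl]
      · obtain ⟨⟨h12, h13⟩, h14⟩ := h11
        have c3 := c2.trans h12
        have hsame : ∀ a ∈ [27, 28, 29], s3.word a = s.word a := by
          intro a ha
          simp only [List.mem_cons, List.not_mem_nil, or_false] at ha
          rcases ha with rfl | rfl | rfl <;>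
            rw [h14.word _ (by decide), h10.word _ (by decide), h6] <;> simp [Store.word_setWord]
        have e27 := hsame 27 (by simp)
        have e28 := hsame 28 (by simp)
        have e29 := hsame 29 (by simp)
        refine Prog.Pre.runs ?_
        simp only [Prog.Pre, Term.eval, e28]
        refine ⟨by omega, by omega, ?_⟩
        have hle := c3.tail_le
        constructor <;> simp only [Store.word_setWord, if_true, Nat.reduceEqDiff, if_false, e27, e29,
          Function.update_self]
        · exact c3.part
        · intro z hz
          have h0 := h.keep z hz
          rw [c3.lab_eq z (by rwa [h0]), h0]
        · omega
        · intro j hj y hy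
          rw [c3.ord_eq j (by omega)] at hy
          by_cases hj' : j < s.word 28 0
          · have := h.closed j hj' y hy
            rwa [c3.lab_eq y this]
          · obtain rfl : j = s.word 28 0 := by omega
            rcases (hnb _ _).2 hy with h' | h'
            · have h0 := h9 y (by rw [h6]; simpa [Store.word_setWord] using h')
              rwa [h12.lab_eq y h0]
            · exact h13 y (by rw [h23]; exact h')
        · intro z hz
          have := h.swept z hz
          rwa [c3.lab_eq z this]
        · exact h4
        · omega
  · have ht : s.word 26 0 = s.word 28 0 := by
      have h' : ¬ s.word 28 0 < s.word 26 0 := fun h' => by simp [Term.eval, h'] at ht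
      omega
    -- Were the sweep complete, all `3 F` corners would have labels and would have been processed
    -- from the queue, which takes `6 F` steps in total.
    have hr : s.word 29 0 < 3 * D.F := by
      by_contra hr
      have h6 : 3 * D.F ≤ s.word 26 0 := by
        choose! f hf using fun x (hx : s.word 24 x ≠ 0) => (h.part.lab_ne_zero x).1 hx
        have hf' : ∀ x < 3 * D.F, _ := fun x hx => hf x (h.swept x (by omega))
        have := Finset.card_le_card_of_injOn (s := Finset.range (3 * D.F))
          (t := Finset.range (s.word 26 0)) f
          (fun x hx => by simpa using (hf' x (by simpa using hx)).1)
          (fun x hx y hy hxy => by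
            rw [← (hf' x (by simpa using hx)).2, hxy, (hf' y (by simpa using hy)).2])
        simpa using this
      omega
    refine ((Runs.ite (T := 1) (T' := 40) (Q := fun s' => ∃ nlab',
        D.Continues s s' (s.word 27 0) nlab' ∧ s'.word 27 0 = nlab' ∧ s'.word 28 = s.word 28 ∧
        s'.word 29 = s.word 29 ∧ s'.word 24 (s.word 29 0) ≠ 0) (fun h6 => ?_) fun h6 => ?_).seq
        (T' := 10) fun s1 h7 => ?_).mono (by simp [Term.cost]) fun _ h => h
    · exact ⟨1, s, .skip s, le_rfl, _, Continues.refl h.part, rfl, rfl, rfl, h6⟩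
    · simp only [Term.eval] at h6
      -- The queue is empty, so the labelled corners are a union of components and the next corner
      -- belongs to a new one.
      have hp := h.part.insert_new link_symm h6 hr fun x hx => h.part.not_reflTransGen
        (fun j hj => h.closed j (by omega)) hx h6
      have h7 := hp.tail_le
      refine Prog.Pre.runs ?_
      simp only [Prog.Pre, Term.eval, Store.word_setWord, if_true, Nat.reduceEqDiff, if_false,
        Function.update_self]
      refine ⟨by omega, by omega, by omega, by omega, by omega, by omega, by omega, by omega,
        _, continues_push h6 (by simp [Store.word_setWord]) (by simp [Store.word_setWord])
          (by simp [Store.word_setWord]) hp, by simp, trivial, trivial, by simp⟩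
    · obtain ⟨nlab', c, h8, h9, h10, h11⟩ := h7
      refine Prog.Pre.runs ?_
      simp only [Prog.Pre, Term.eval, h10]
      refine ⟨by omega, by omega, ?_⟩
      have hle := c.tail_le
      constructor <;> simp only [Store.word_setWord, if_true, Nat.reduceEqDiff, if_false, h9,
        Function.update_self]
      · rw [h8]; exact c.part
      · intro z hz
        have h0 := h.keep z hz
        rw [c.lab_eq z (by rwa [h0]), h0]
      · omega
      · intro j hj y hy
        rw [c.ord_eq j (by omega)] at hy
        have := h.closed j hj y hy
        rwa [c.lab_eq y this]
      · intro z hz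
        by_cases hz' : z < s.word 29 0
        · have := h.swept z hz'
          rwa [c.lab_eq z this]
        · obtain rfl : z = s.word 29 0 := by omega
          exact h11
      · omega
      · omega

/-- The labels tell the components of `D.Link` apart. -/
structure Labels (D : Raw) (lab : ℕ → ℕ) (m : ℕ) : Prop where
  ne_zero : ∀ z < 3 * D.F, lab z ≠ 0
  le : ∀ z, lab z ≤ m
  surj : ∀ a < m, ∃ z < 3 * D.F, lab z = a + 1
  eq_iff : ∀ u < 3 * D.F, ∀ v < 3 * D.F, lab u = lab v ↔ Relation.ReflTransGen D.Link u v
  le_total : m ≤ 3 * D.F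
  original : D.Original D.n lab

lemma Labels.n_le {lab : ℕ → ℕ} {m : ℕ} (h : D.Labels lab m) : D.n ≤ m := by
  by_cases h0 : D.n = 0
  · omega
  · obtain ⟨p, hp, -, h1⟩ := h.original (D.n - 1) (by omega)
    have := h.le (D.flag (D.tau (D.n - 1)) p)
    omega

/-- Breadth-first search. -/
def searchProg : Prog := .count 40 20 4 searchStep

lemma runs_searchProg (hD : D.Valid) (hs : D.Ready s) (hW : D.bound ≤ W)
    (hnb : ∀ u v, Listed s u v ↔ D.Link u v)
    (hp : PartialLabels D.Link (3 * D.F) (s.word 24) (s.word 25) D.n D.n)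
    (ho : D.Original D.n (s.word 24)) (h26 : s.word 26 0 = D.n) (h27 : s.word 27 0 = D.n)
    (h28 : s.word 28 0 = 0) (h29 : s.word 29 0 = 0) :
    Runs W searchProg s (6 * D.F * 320 + 100) fun s' => D.Labels (s'.word 24) (s'.word 27 0) := by
  refine (Runs.count (T := 300) (D.Search (s.word 24)) (by decide) (by decide) hs.twice
    (by unfold bound at hW; omega) ?_ ?_ ?_).mono (by omega) fun s' h => ?_
  · constructor
    · rw [h26, h27]; exact hp
    · exact fun _ _ => rfl
    · omega
    · intro j hj; omega
    · intro z hz; omega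
    · omega
    · omega
  · intro k s v h
    constructor <;> simp only [Store.word_setWord, Nat.reduceEqDiff, if_false]
    exacts [h.part, h.keep, h.head_le, h.closed, h.swept, h.swept_le, h.steps]
  · intro k hk s1 h1 h2 h3
    refine runs_searchStep hD hW (fun u v => ?_) hk h1
    rw [listed_congr (h3.word 22 (by decide)) (h3.word 23 (by decide)), hnb]
  · have h1 := h.part.tail_le
    have h2 := h.head_le
    have h3 := h.swept_le
    have h4 := h.steps
    -- Head and sweep are at most `3 F` and their sum is `6 F`, so the sweep has passed all corners.
    have hne : ∀ z < 3 * D.F, s'.word 24 z ≠ 0 := fun z hz => h.swept z (by omega)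
    refine ⟨hne, h.part.lab_le, fun a ha => ?_, fun u hu v hv =>
      h.part.lab_eq u v (hne u hu) (hne v hv), h.part.nlab_le, fun i hi => ?_⟩
    · obtain ⟨x, hx⟩ := h.part.lab_surj a ha
      exact ⟨x, h.part.lt (by omega), hx⟩
    · obtain ⟨p, hp, h5, h6⟩ := ho i hi
      exact ⟨p, hp, h5, by rw [h.keep _ (by omega), h6]⟩

end Raw

/-- Different pairs have different addresses below `M * M`. This bounds the number of edges put out
so far by a number that fits into a word. -/
lemma IsPairTable.le {M k : ℕ} {idx e₁ e₂ : ℕ → ℕ} (h : IsPairTable M idx e₁ e₂ k)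
    (hinj : ∀ i < k, ∀ j < k, s(e₁ i, e₂ i) = s(e₁ j, e₂ j) → i = j) : k ≤ M * M := by
  have := Finset.card_le_card_of_injOn (s := Finset.range k) (t := Finset.range (M * M))
    (fun i => e₁ i * M + e₂ i)
    (fun i hi => by
      have h1 := h.lt i (by simpa using hi)
      have h2 : (e₁ i + 1) * M ≤ M * M := Nat.mul_le_mul_right _ h1.1
      rw [Nat.succ_mul] at h2
      simp only [Finset.coe_range, mem_Iio]
      omega)
    (fun i hi j hj hij => by
      have hi : i < k := by simpa using hi
      have hj : j < k := by simpa using hj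
      obtain ⟨h1, h2⟩ := pair_eq (h.lt i hi).2 (h.lt j hj).2 hij
      exact hinj i hi j hj (by rw [h1, h2]))
  simpa using this

lemma IsPairTable.ne_zero_symm {M k a b : ℕ} {idx e₁ e₂ : ℕ → ℕ} (h : IsPairTable M idx e₁ e₂ k)
    (ha : a < M) (hb : b < M) (h' : idx (a * M + b) ≠ 0) : idx (b * M + a) ≠ 0 := by
  obtain ⟨t, ht⟩ := Nat.exists_eq_succ_of_ne_zero h'
  obtain ⟨h1, ⟨rfl, rfl⟩ | ⟨rfl, rfl⟩⟩ := h.sound a ha b hb t ht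
  · exact (h.ne_zero t h1).2
  · exact (h.ne_zero t h1).1

/-! ### Writing the new truss to the output -/

namespace Raw
variable {D : Raw} {W : ℕ} {s : Store} {lab : ℕ → ℕ} {m : ℕ}

/-- Copy the label of a corner to the output, and the vertex and its coordinates to the entry for
the label. -/
def copyStep (p : ℕ) : Prog :=
  .seq (.set 30 (.const 0) (.sub (.read 24 (.add (.reg 40) (.read 20 (.const p)))) (.const 1))) <|
  .seq (.set 33 (.reg 30) (.read (3 + p) (.reg 40))) <|
  .seq (.copy 3 (.reg 30) 0 (.read (3 + p) (.reg 40))) <|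
  .seq (.copy 4 (.reg 30) 1 (.read (3 + p) (.reg 40)))
    (.set (12 + p) (.reg 40) (.reg 30))

structure Copied (D : Raw) (lab : ℕ → ℕ) (s : Store) (t p : ℕ) : Prop where
  corner : s.word (12 + p) t = lab (D.flag t p) - 1
  proj : s.word 33 (lab (D.flag t p) - 1) = D.cor p t
  x : s.real 3 (lab (D.flag t p) - 1) = D.x (D.cor p t)
  y : s.real 4 (lab (D.flag t p) - 1) = D.y (D.cor p t)

lemma Copied.congr {s s' : Store} {t p : ℕ} (h : D.Copied lab s t p)
    (hc : s'.word (12 + p) = s.word (12 + p)) (hp : s'.word 33 = s.word 33)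
    (hx : s'.real 3 = s.real 3) (hy : s'.real 4 = s.real 4) : D.Copied lab s' t p := by
  constructor
  · rw [hc, h.corner]
  · rw [hp, h.proj]
  · rw [hx, h.x]
  · rw [hy, h.y]

/-- The entry of a new vertex is written once for each of its corners. Equal labels imply equal
underlying vertices, so all these writes agree. -/
lemma runs_copyStep (hD : D.Valid) (hs : D.Ready s) (hW : D.bound ≤ W) (hlab : D.Labels lab m)
    (h24 : s.word 24 = lab) {t p : ℕ} (ht : t < D.F) (hp : p < 3) (h40 : s.word 40 0 = t) :
    Runs W (copyStep p) s 50 fun s' => D.Copied lab s' t p ∧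
      ∀ t' < D.F, ∀ p' < 3, D.Copied lab s t' p' → D.Copied lab s' t' p' := by
  have h1 := hlab.le (D.flag t p)
  have h2 := hlab.le_total
  have h3 := hD.cor_lt p hp t ht
  unfold bound at hW
  have e1 : t + s.word 20 p = D.flag t p := by rw [hs.off p hp, flag]
  have hne1 : 3 + p ≠ 30 := by omega
  have hne2 : 3 + p ≠ 33 := by omega
  have hne3 : 33 ≠ 12 + p := by omega
  have key : ∀ t' < D.F, ∀ p' < 3, lab (D.flag t' p') - 1 = lab (D.flag t p) - 1 →
      D.cor p' t' = D.cor p t := by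
    intro t' ht' p' hp' h
    have h5 := hlab.ne_zero _ (flag_lt ht' hp')
    have h6 := hlab.ne_zero _ (flag_lt ht hp)
    have h7 := (hlab.eq_iff _ (flag_lt ht' hp') _ (flag_lt ht hp)).1 (by omega)
    rw [← vertex_flag ht', ← vertex_flag ht, hD.vertex_eq_of_reflTransGen h7]
  refine Prog.Pre.runs ?_ (by simp [copyStep, Prog.maxCost, Term.cost])
  simp only [copyStep, Prog.Pre, Term.eval, Store.word_setWord, Store.real_setWord,
    Store.word_setReal, if_true, Nat.reduceEqDiff, if_false, h40, e1, h24, hne1, hne2,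
    Function.update_self, hs.cor p hp, Store.real_setReal]
  refine ⟨by omega, by omega, by omega, by omega, by omega, by omega, by omega, by omega, ?_, ?_⟩
  · constructor
    · simp [Store.word_setWord]
    · simp [Store.word_setWord, hne3]
    · simp [Store.real_setReal, hs.x]
    · simp [Store.real_setReal, hs.y]
  · intro t' ht' p' hp' h
    have hne4 : 12 + p' ≠ 30 := by omega
    have hne5 : 12 + p' ≠ 33 := by omega
    constructor
    · have h6 := h.corner
      by_cases h5 : p' = p
      · subst h5
        simp only [Store.word_setWord, Store.word_setReal, hne4, hne5, if_false, if_true,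
          Function.update_apply]
        split_ifs with h7
        · rw [h7]
        · exact h6
      · simp only [Store.word_setWord, Store.word_setReal, Nat.add_left_cancel_iff, hne4, hne5, h5,
          if_false, h6]
    · simp only [Store.word_setWord, Store.word_setReal, hne3, if_false, if_true,
        Function.update_apply, Nat.reduceEqDiff]
      split_ifs with h5
      · exact (key t' ht' p' hp' h5).symm
      · exact h.proj
    · simp only [Store.real_setReal, Store.real_setWord, if_false, if_true,
        Function.update_apply, Nat.reduceEqDiff]
      split_ifs with h5
      · rw [key t' ht' p' hp' h5, hs.x]
      · exact h.x
    · simp only [Store.real_setReal, Store.real_setWord, if_false, if_true,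
        Function.update_apply, Nat.reduceEqDiff]
      split_ifs with h5
      · rw [key t' ht' p' hp' h5, hs.y]
      · exact h.y

/-- Put the corners and coordinates of the new vertices into the output. -/
def copyProg : Prog := .count 40 0 2 (.seqs ([0, 1, 2].map copyStep))

lemma runs_copyProg (hD : D.Valid) (hs : D.Ready s) (hW : D.bound ≤ W) (hlab : D.Labels lab m)
    (h24 : s.word 24 = lab) :
    Runs W copyProg s (170 * D.F + 100) fun s' => ∀ t < D.F, ∀ p < 3, D.Copied lab s' t p := by
  refine (Runs.count_forall (T := 3 * 50 + 1) (fun _ => True)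
    (fun t s => t < D.F → ∀ p < 3, D.Copied lab s t p) (by decide) (by decide) hs.F
    (by unfold bound at hW; omega) trivial (fun _ _ _ => trivial) ?_ ?_).mono (by omega)
    fun s' h t ht p hp => h.2 t ht ht p hp
  · intro t s v h ht p hp
    refine (h ht p hp).congr ?_ (by simp [Store.word_setWord]) rfl rfl
    rw [Store.word_setWord, if_neg (by omega)]
  · intro t ht s1 _ h2 h3
    have hs1 : D.Ready s1 := hs.of_sameOff h3
    refine (Runs.seqs (f := copyStep) (T := 50) (l := [0, 1, 2])
      (fun s2 => ∀ t' < D.F, ∀ p < 3, D.Copied lab s1 t' p → D.Copied lab s2 t' p)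
      (fun p s => p < 3 → D.Copied lab s t p) (fun _ _ _ _ h => h) ?_).mono (by simp) fun s2 h4 => ?_
    · intro p hp s2 h4 h5
      have hp : p < 3 := by
        simp only [List.mem_cons, List.not_mem_nil, or_false] at hp; omega
      refine (runs_copyStep hD (hs1.of_sameOff h5) hW hlab ?_ ht hp ?_).mono le_rfl fun s3 h6 =>
        ⟨fun t' ht' q hq h => h6.2 t' ht' q hq (h4 t' ht' q hq h), fun _ => h6.1,
          fun q h hq => h6.2 t ht q hq (h hq)⟩
      · rw [h5.word 24 (by decide), h3.word 24 (by decide), h24]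
      · rw [h5.word 40 (by decide), h2]
    · refine ⟨trivial, fun _ p hp => h4.2.1 p ?_ hp, fun d _ h hd p hp => h4.1 d hd p hp (h hd p hp)⟩
      simp only [List.mem_cons, List.not_mem_nil, or_false]
      omega

/-- Tabulate the numbers of the edges. -/
def tableProg : Prog :=
  .count 40 0 1 <|
    .seq (.set 34 (.add (.read 21 (.read 1 (.reg 40))) (.read 2 (.reg 40)))
      (.add (.reg 40) (.const 1)))
    (.set 34 (.add (.read 21 (.read 2 (.reg 40))) (.read 1 (.reg 40))) (.add (.reg 40) (.const 1)))

lemma index_le_bound {a b : ℕ} (ha : a < D.n + 3 * D.F) (hb : b < D.n + 3 * D.F) :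
    a * (D.n + 3 * D.F) + b ≤ D.bound := by
  have h2 : (a + 1) * (D.n + 3 * D.F) ≤ (D.n + 3 * D.F) * (D.n + 3 * D.F) :=
    Nat.mul_le_mul_right _ ha
  rw [Nat.succ_mul] at h2
  unfold bound
  omega

/-- Array `34` finds the number of an input edge, and so its weight, from the two ends. The table is
square, but only two entries per edge are written; all others are initially zero. -/
lemma runs_tableProg (hD : D.Valid) (hs : D.Ready s) (hW : D.bound ≤ W) (h34 : s.word 34 = 0)
    (h21 : ∀ a ≤ D.n + 3 * D.F, s.word 21 a = a * (D.n + 3 * D.F)) :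
    Runs W tableProg s (100 * D.E + 100) fun s' =>
      IsPairTable (D.n + 3 * D.F) (s'.word 34) D.e₁ D.e₂ D.E := by
  refine (Runs.count (T := 40) (fun k s' => IsPairTable (D.n + 3 * D.F) (s'.word 34) D.e₁ D.e₂ k)
    (by decide) (by decide) hs.E (by unfold bound at hW; omega) ?_ ?_ ?_).mono (by omega) fun _ h => h
  · rw [h34]; exact IsPairTable.empty
  · intro k s v h
    simpa [Store.word_setWord] using h
  · intro k hk s1 h1 h2 h3
    have hs1 : D.Ready s1 := hs.of_sameOff h3
    have ha : D.e₁ k < D.n + 3 * D.F := (hD.e₁_lt k hk).trans_le (by omega)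
    have hb : D.e₂ k < D.n + 3 * D.F := (hD.e₂_lt k hk).trans_le (by omega)
    have h4 := index_le_bound ha hb
    have h5 := index_le_bound hb ha
    have hkW : k + 1 ≤ W := by unfold bound at hW; omega
    have e21 : s1.word 21 = s.word 21 := h3.word 21 (by decide)
    refine Prog.Pre.runs ?_
    simp only [Prog.Pre, Term.eval, Store.word_setWord, if_true, Nat.reduceEqDiff, if_false, h2,
      hs1.e₁, hs1.e₂, e21, h21 _ ha.le, h21 _ hb.le]
    exact ⟨by omega, by omega, by omega, by omega,
      h1.insert (fun _ _ => rfl) (fun _ _ => rfl) rfl rfl ha hb⟩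

/-- If the edge between two corners of a triangle is not in the output, then put it there. -/
def edgeStep (c : ℕ × ℕ) : Prog :=
  .seq (.set 30 (.const 0) (.read (12 + c.1) (.reg 40))) <|
  .seq (.set 31 (.const 0) (.read (12 + c.2) (.reg 40))) <|
  .ite (.read 35 (.add (.read 21 (.reg 30)) (.reg 31))) .skip <|
  .seq (.set 10 (.read 9 (.const 1)) (.reg 30)) <|
  .seq (.set 11 (.read 9 (.const 1)) (.reg 31)) <|
  .seq (.copy 5 (.read 9 (.const 1)) 2 (.sub (.read 34
    (.add (.read 21 (.read 33 (.reg 30))) (.read 33 (.reg 31)))) (.const 1))) <|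
  .seq (.set 9 (.const 1) (.add (.read 9 (.const 1)) (.const 1))) <|
  .seq (.set 35 (.add (.read 21 (.reg 30)) (.reg 31)) (.read 9 (.const 1)))
    (.set 35 (.add (.read 21 (.reg 31)) (.reg 30)) (.read 9 (.const 1)))

/-- Entry `j` of the output arrays for edges is an edge with its weight. -/
def IsEdgeEntry (D : Raw) (lab : ℕ → ℕ) (u v : ℕ) (w : ℝ) : Prop :=
  ∃ t < D.F, ∃ p < 3, ∃ q < 3, p ≠ q ∧ u = lab (D.flag t p) - 1 ∧ v = lab (D.flag t q) - 1 ∧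
    ∃ a < D.E, w = D.wt a ∧
      (D.e₁ a = D.cor p t ∧ D.e₂ a = D.cor q t ∨ D.e₁ a = D.cor q t ∧ D.e₂ a = D.cor p t)

structure EdgesListed (D : Raw) (lab : ℕ → ℕ) (s : Store) : Prop where
  table : IsPairTable (D.n + 3 * D.F) (s.word 35) (s.word 10) (s.word 11) (s.word 9 1)
  inj : ∀ i < s.word 9 1, ∀ j < s.word 9 1,
    s(s.word 10 i, s.word 11 i) = s(s.word 10 j, s.word 11 j) → i = j
  entry : ∀ j < s.word 9 1, D.IsEdgeEntry lab (s.word 10 j) (s.word 11 j) (s.real 5 j)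

/-- Array `35` records the pairs of new vertices that are already listed as edges, so a side shared
by two faces of the new truss is put out once. The weight is looked up through the underlying
vertices in arrays `33` and `34`. -/
lemma runs_edgeStep (hD : D.Valid) (hs : D.Ready s) (hW : D.bound ≤ W) (hlab : D.Labels lab m)
    (hcop : ∀ t < D.F, ∀ p < 3, D.Copied lab s t p)
    (h21 : ∀ a ≤ D.n + 3 * D.F, s.word 21 a = a * (D.n + 3 * D.F))
    (h34 : IsPairTable (D.n + 3 * D.F) (s.word 34) D.e₁ D.e₂ D.E) {t p q : ℕ} (ht : t < D.F)
    (hp : p < 3) (hq : q < 3) (hpq : p ≠ q) (h40 : s.word 40 0 = t) (hJ : D.EdgesListed lab s) :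
    Runs W (edgeStep (p, q)) s 100 fun s' => D.EdgesListed lab s' ∧
      s'.word 35 ((lab (D.flag t p) - 1) * (D.n + 3 * D.F) + (lab (D.flag t q) - 1)) ≠ 0 ∧
      ∀ z, s.word 35 z ≠ 0 → s'.word 35 z ≠ 0 := by
  have hlt : ∀ p, lab (D.flag t p) - 1 < D.n + 3 * D.F := by
    intro p
    have h1 := hlab.le (D.flag t p)
    have h2 := hlab.le_total
    omega
  have ha := hlt p
  have hb := hlt q
  have hu := hD.cor_lt p hp t ht
  have hv := hD.cor_lt q hq t ht
  have hca := hcop t ht p hp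
  have hcb := hcop t ht q hq
  have h1 := index_le_bound ha hb
  have h2 := index_le_bound hb ha
  have h3 := hJ.table.le hJ.inj
  have h4 : s.word 9 1 + 1 ≤ W := by unfold bound at hW; omega
  have hne1 : 12 + q ≠ 30 := by omega
  have h5 : D.n + 3 * D.F ≤ D.bound := by unfold bound; omega
  have e1 := hca.corner
  have e2 := hcb.corner
  have e3 := hca.proj
  have e4 := hcb.proj
  set a := lab (D.flag t p) - 1 with ha'
  set b := lab (D.flag t q) - 1 with hb'
  refine Prog.Pre.runs ?_ (by simp [edgeStep, Prog.maxCost, Term.cost])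
  simp only [edgeStep, Prog.Pre, Term.eval, Store.word_setWord, Store.real_setWord,
    Store.word_setReal, if_true, Nat.reduceEqDiff, if_false, h40, e1, e2, e3, e4, hne1,
    Function.update_self, h21 _ ha.le, h21 _ hb.le,
    h21 _ (show D.cor p t ≤ D.n + 3 * D.F by omega)]
  refine ⟨by omega, by omega, by omega, by omega, fun h0 => ⟨⟨hJ.table, hJ.inj, hJ.entry⟩, h0,
    fun _ h => h⟩, fun h0 => ⟨by omega, by omega, by omega, by omega, by omega, by omega, by omega,
    by omega, by omega, by omega, by omega, ⟨?_, ?_, ?_⟩, ?_, ?_⟩⟩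
  · simp only [Store.word_setWord, Store.word_setReal, if_true, Nat.reduceEqDiff, if_false,
      Function.update_self]
    refine hJ.table.insert (fun i hi => ?_) (fun i hi => ?_) (by simp) (by simp) ha hb
    · rw [Function.update_of_ne (by omega)]
    · rw [Function.update_of_ne (by omega)]
  · simp only [Store.word_setWord, Store.word_setReal, if_true, Nat.reduceEqDiff, if_false,
      Function.update_self]
    have key : ∀ i < s.word 9 1, s(s.word 10 i, s.word 11 i) ≠ s(a, b) := by
      intro i hi h
      have := hJ.table.ne_zero i hi
      rcases Sym2.eq_iff.1 h with ⟨h6, h7⟩ | ⟨h6, h7⟩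
      · rw [h6, h7] at this; exact this.1 h0
      · rw [h6, h7] at this; exact this.2 h0
    intro i hi j hj
    simp only [Function.update_apply]
    split_ifs with h6 h7 h7
    · intro _; omega
    · intro h; exact absurd h.symm (key j (by omega))
    · intro h; exact absurd h (key i (by omega))
    · exact hJ.inj i (by omega) j (by omega)
  · simp only [Store.word_setWord, Store.word_setReal, Store.real_setWord, Store.real_setReal,
      if_true, Nat.reduceEqDiff, if_false, Function.update_self]
    intro j hj
    simp only [Function.update_apply]
    split_ifs with h6
    · refine ⟨t, ht, p, hp, q, hq, hpq, ha', hb', ?_⟩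
      obtain ⟨c, hc, h7⟩ := hD.edge t ht p hp q hq hpq
      -- The side is an input edge, so the entry is not the default `0` and the subtraction of `1`
      -- gives a genuine edge number.
      have h8 : s.word 34 (D.cor p t * (D.n + 3 * D.F) + D.cor q t) ≠ 0 := by
        have := h34.ne_zero c hc
        rcases h7 with ⟨h7, h7'⟩ | ⟨h7, h7'⟩
        · rw [h7, h7'] at this; exact this.1
        · rw [h7, h7'] at this; exact this.2
      obtain ⟨d, hd⟩ := Nat.exists_eq_succ_of_ne_zero h8
      obtain ⟨h9, h10⟩ := h34.sound _ (by omega) _ (by omega) d hd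
      exact ⟨d, h9, by rw [hd, hs.wt, Nat.succ_sub_one], h10⟩
    · exact hJ.entry j (by omega)
  · simp only [if_true, Function.update_apply]
    split_ifs <;> omega
  · intro z hz
    simp only [Function.update_apply]
    split_ifs <;> omega

/-- Put the edges of the new truss into the output. -/
def edgeProg : Prog := .count 40 0 2 (.seqs ([(0, 1), (0, 2), (1, 2)].map edgeStep))

lemma runs_edgeProg (hD : D.Valid) (hs : D.Ready s) (hW : D.bound ≤ W) (hlab : D.Labels lab m)
    (hcop : ∀ t < D.F, ∀ p < 3, D.Copied lab s t p)
    (h21 : ∀ a ≤ D.n + 3 * D.F, s.word 21 a = a * (D.n + 3 * D.F))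
    (h34 : IsPairTable (D.n + 3 * D.F) (s.word 34) D.e₁ D.e₂ D.E) (h35 : s.word 35 = 0)
    (h9 : s.word 9 1 = 0) :
    Runs W edgeProg s (400 * D.F + 100) fun s' => D.EdgesListed lab s' ∧
      ∀ t < D.F, ∀ p < 3, ∀ q < 3, p ≠ q → ∃ j < s'.word 9 1,
        s(s'.word 10 j, s'.word 11 j) = s(lab (D.flag t p) - 1, lab (D.flag t q) - 1) := by
  have hmem : ∀ c ∈ [(0, 1), (0, 2), (1, 2)], c.1 < 3 ∧ c.2 < 3 ∧ c.1 ≠ c.2 := by decide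
  refine (Runs.count_forall (T := 3 * 100 + 1) (D.EdgesListed lab)
    (fun t s => ∀ c ∈ [(0, 1), (0, 2), (1, 2)], s.word 35 ((lab (D.flag t c.1) - 1) *
      (D.n + 3 * D.F) + (lab (D.flag t c.2) - 1)) ≠ 0) (by decide) (by decide) hs.F
    (by unfold bound at hW; omega) ?_ ?_ ?_ ?_).mono (by omega) ?_
  · refine ⟨?_, ?_, ?_⟩ <;> rw [h9]
    · rw [h35]; exact IsPairTable.empty
    · intro i hi; omega
    · intro i hi; omega
  · intro s v h
    constructor <;> simp only [Store.word_setWord, Store.real_setWord, Nat.reduceEqDiff, if_false]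
    exacts [h.table, h.inj, h.entry]
  · intro t s v h
    simpa [Store.word_setWord] using h
  · intro t ht s1 h1 h2 h3
    have hs1 : D.Ready s1 := hs.of_sameOff h3
    refine (Runs.seqs (f := edgeStep) (T := 100) (l := [(0, 1), (0, 2), (1, 2)])
      (fun s2 => D.EdgesListed lab s2 ∧ ∀ z, s1.word 35 z ≠ 0 → s2.word 35 z ≠ 0)
      (fun c s => s.word 35 ((lab (D.flag t c.1) - 1) *
        (D.n + 3 * D.F) + (lab (D.flag t c.2) - 1)) ≠ 0) ⟨h1, fun _ h => h⟩ ?_).mono (by simp)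
        fun s2 h4 => ?_
    · intro c hc s2 h4 h5
      obtain ⟨hp, hq, hpq⟩ := hmem c hc
      have e21 : s2.word 21 = s.word 21 := by
        rw [h5.word 21 (by decide), h3.word 21 (by decide)]
      have e34 : s2.word 34 = s.word 34 := by
        rw [h5.word 34 (by decide), h3.word 34 (by decide)]
      refine (runs_edgeStep hD (hs1.of_sameOff h5) hW hlab (fun t ht p hp => ?_) (by rwa [e21])
        (by rwa [e34]) ht hp hq hpq ?_ h4.1).mono le_rfl fun s3 h6 =>
        ⟨⟨h6.1, fun z hz => h6.2.2 z (h4.2 z hz)⟩, h6.2.1, fun d hd => h6.2.2 _ hd⟩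
      · have e12 : ∀ p < 3, s2.word (12 + p) = s.word (12 + p) := by
          intro p hp
          interval_cases p <;> rw [h5.word _ (by decide), h3.word _ (by decide)]
        refine (hcop t ht p hp).congr (e12 p hp) ?_ ?_ ?_
        · rw [h5.word _ (by decide), h3.word _ (by decide)]
        · rw [h5.real _ (by decide), h3.real _ (by decide)]
        · rw [h5.real _ (by decide), h3.real _ (by decide)]
      · rw [h5.word 40 (by decide), h2]
    · exact ⟨h4.1.1, h4.2.1, fun d _ h c hc => h4.1.2 _ (h c hc)⟩
  · rintro s' ⟨h1, h2⟩
    refine ⟨h1, fun t ht p hp q hq hpq => ?_⟩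
    have hlt : ∀ p, lab (D.flag t p) - 1 < D.n + 3 * D.F := by
      intro p
      have h1 := hlab.le (D.flag t p)
      have h2 := hlab.le_total
      omega
    have key : s'.word 35 ((lab (D.flag t p) - 1) * (D.n + 3 * D.F) +
        (lab (D.flag t q) - 1)) ≠ 0 := by
      rcases lt_or_gt_of_ne hpq with h | h
      · refine h2 t ht (p, q) ?_
        interval_cases q <;> interval_cases p <;> simp_all
      · refine h1.table.ne_zero_symm (hlt q) (hlt p) (h2 t ht (q, p) ?_)
        interval_cases p <;> interval_cases q <;> simp_all
    obtain ⟨j, hj⟩ := Nat.exists_eq_succ_of_ne_zero key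
    obtain ⟨h3, h4⟩ := h1.table.sound _ (hlt p) _ (hlt q) j hj
    exact ⟨j, h3, Sym2.eq_iff.2 h4⟩

end Raw
namespace Raw
variable {D : Raw} {W : ℕ} {s : Store} {lab : ℕ → ℕ} {m : ℕ}

/-- Put the numbers of vertices and faces into the output. -/
def sizeProg : Prog := .seq (.set 9 (.const 0) (.reg 27)) (.set 9 (.const 2) (.read 0 (.const 2)))

lemma runs_sizeProg (hs : D.Ready s) (hW : D.bound ≤ W) (h27 : s.word 27 0 ≤ 3 * D.F) :
    Runs W sizeProg s 20 fun s' => s'.word 9 0 = s.word 27 0 ∧ s'.word 9 1 = s.word 9 1 ∧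
      s'.word 9 2 = D.F := by
  unfold bound at hW
  refine Prog.Pre.runs ?_
  simp only [sizeProg, Prog.Pre, Term.eval, Store.word_setWord, if_true, if_false,
    OfNat.zero_ne_ofNat, hs.F]
  refine ⟨by omega, by omega, by omega, by omega, ?_⟩
  simp

/-- The output is the complex with the given labels of corners. -/
structure Result (D : Raw) (lab : ℕ → ℕ) (m : ℕ) (s : Store) : Prop where
  labels : D.Labels lab m
  num_vertices : s.word 9 0 = m
  num_faces : s.word 9 2 = D.F
  copied : ∀ t < D.F, ∀ p < 3, D.Copied lab s t p
  edge_inj : ∀ i < s.word 9 1, ∀ j < s.word 9 1,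
    s(s.word 10 i, s.word 11 i) = s(s.word 10 j, s.word 11 j) → i = j
  edge_entry : ∀ j < s.word 9 1, D.IsEdgeEntry lab (s.word 10 j) (s.word 11 j) (s.real 5 j)
  edge_complete : ∀ t < D.F, ∀ p < 3, ∀ q < 3, p ≠ q → ∃ j < s.word 9 1,
    s(s.word 10 j, s.word 11 j) = s(lab (D.flag t p) - 1, lab (D.flag t q) - 1)

/-- The fretsaw algorithm. -/
def fretsawProg : Prog :=
  .seq initProg <| .seq mulProg <| .seq linkProg <| .seq seedProg <| .seq searchProg <|
  .seq copyProg <| .seq tableProg <| .seq edgeProg sizeProg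

/-- The zeros in the working arrays at the start are essential: clearing the square tables would not
be possible in linear time. -/
lemma runs_fretsawProg (hD : D.Valid) (hs : D.Loaded s) (h0 : ∀ a, 9 ≤ a → s.word a = 0)
    (hW : D.bound ≤ W) :
    Runs W fretsawProg s (4000 * (D.n + D.E + D.F + D.K) + 1000) fun s' =>
      ∃ lab m, D.Result lab m s' := by
  obtain ⟨t1, s1, x1, b1, r1⟩ := runs_initProg hs hW
  have f1 := x1.sameOff
  obtain ⟨t2, s2, x2, b2, h21⟩ := runs_mulProg r1 hW
  have f2 := x2.sameOff
  have r2 : D.Ready s2 := r1.of_sameOff f2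
  obtain ⟨t3, s3, x3, b3, hnb⟩ := runs_linkProg hD r2 hW
    (by rw [f2.word 22 (by decide), f1.word 22 (by decide), h0 22 (by decide)])
    (by rw [f2.word 23 (by decide), f1.word 23 (by decide), h0 23 (by decide)])
  have f3 := x3.sameOff
  have r3 : D.Ready s3 := r2.of_sameOff f3
  obtain ⟨t4, s4, x4, b4, hp, ho, h26, h27, h28, h29⟩ := runs_seedProg hD r3 hW
    (by rw [f3.word 24 (by decide), f2.word 24 (by decide), f1.word 24 (by decide),
      h0 24 (by decide)])
  have f4 := x4.sameOff
  have r4 : D.Ready s4 := r3.of_sameOff f4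
  obtain ⟨t5, s5, x5, b5, hlab⟩ := runs_searchProg hD r4 hW (fun u v => by
    rw [listed_congr (f4.word 22 (by decide)) (f4.word 23 (by decide)), hnb]) hp ho h26 h27 h28 h29
  have f5 := x5.sameOff
  have r5 : D.Ready s5 := r4.of_sameOff f5
  obtain ⟨t6, s6, x6, b6, hcop⟩ := runs_copyProg hD r5 hW hlab rfl
  have f6 := x6.sameOff
  have r6 : D.Ready s6 := r5.of_sameOff f6
  have e21 : s6.word 21 = s2.word 21 := by
    rw [f6.word 21 (by decide), f5.word 21 (by decide), f4.word 21 (by decide),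
      f3.word 21 (by decide)]
  obtain ⟨t7, s7, x7, b7, h34⟩ := runs_tableProg hD r6 hW (by
    rw [f6.word 34 (by decide), f5.word 34 (by decide), f4.word 34 (by decide),
      f3.word 34 (by decide), f2.word 34 (by decide), f1.word 34 (by decide), h0 34 (by decide)])
    (by rwa [e21])
  have f7 := x7.sameOff
  have r7 : D.Ready s7 := r6.of_sameOff f7
  have hcop7 : ∀ t < D.F, ∀ p < 3, D.Copied (s5.word 24) s7 t p := fun t ht p hp =>
    (hcop t ht p hp).congr (by interval_cases p <;> exact f7.word _ (by decide))
      (f7.word 33 (by decide)) (f7.real 3 (by decide)) (f7.real 4 (by decide))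
  obtain ⟨t8, s8, x8, b8, hE, hcomp⟩ := runs_edgeProg hD r7 hW hlab hcop7
    (by rwa [f7.word 21 (by decide), e21]) h34
    (by
      rw [f7.word 35 (by decide), f6.word 35 (by decide), f5.word 35 (by decide),
        f4.word 35 (by decide), f3.word 35 (by decide), f2.word 35 (by decide),
        f1.word 35 (by decide), h0 35 (by decide)])
    (by
      rw [f7.word 9 (by decide), f6.word 9 (by decide), f5.word 9 (by decide),
        f4.word 9 (by decide), f3.word 9 (by decide), f2.word 9 (by decide),
        f1.word 9 (by decide), h0 9 (by decide)]
      rfl)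
  have f8 := x8.sameOff
  have r8 : D.Ready s8 := r7.of_sameOff f8
  have e27 : s8.word 27 0 = s5.word 27 0 := by
    rw [f8.word 27 (by decide), f7.word 27 (by decide), f6.word 27 (by decide)]
  obtain ⟨t9, s9, x9, b9, h90, h91, h92⟩ := runs_sizeProg r8 hW (by rw [e27]; exact hlab.le_total)
  have f9 := x9.sameOff
  refine ⟨_, s9, .seq x1 (.seq x2 (.seq x3 (.seq x4 (.seq x5 (.seq x6 (.seq x7 (.seq x8 x9))))))),
    by omega, s5.word 24, s5.word 27 0, hlab, by rw [h90, e27], h92, fun t ht p hp => ?_, ?_, ?_, ?_⟩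
  · refine (hcop7 t ht p hp).congr ?_ ?_ ?_ ?_
    · interval_cases p <;> rw [f9.word _ (by decide), f8.word _ (by decide)]
    · rw [f9.word _ (by decide), f8.word _ (by decide)]
    · rw [f9.real _ (by decide), f8.real _ (by decide)]
    · rw [f9.real _ (by decide), f8.real _ (by decide)]
  · rw [h91, f9.word 10 (by decide), f9.word 11 (by decide)]
    exact hE.inj
  · rw [h91, f9.word 10 (by decide), f9.word 11 (by decide), f9.real 5 (by decide)]
    exact hE.entry
  · rw [h91, f9.word 10 (by decide), f9.word 11 (by decide)]
    exact hcomp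

end Raw

/-! ### Input listings as numerical data -/

section encoding
variable {n : ℕ} {T : Truss n} {H : SimpleGraph T.Face}

/-- The corners of triangle `t`, as a function of natural numbers. -/
def Truss.Listing.cornerOf (L : T.Listing) (p t : ℕ) : ℕ :=
  if hp : p < 3 then pad (fun t => (L.corner t ⟨p, hp⟩ : ℕ)) t else 0

/-- The numerical data of an input. -/
noncomputable def InputListing.raw (L : InputListing T H) (τ : Fin n → T.Face) : Raw where
  n := n
  E := L.numEdges
  F := L.numFaces
  K := L.numLinks
  e₁ := pad fun a => ((L.edge a).1 : ℕ)
  e₂ := pad fun a => ((L.edge a).2 : ℕ)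
  cor := L.cornerOf
  l₁ := pad fun a => ((L.link a).1 : ℕ)
  l₂ := pad fun a => ((L.link a).2 : ℕ)
  tau := pad fun i => (L.face.symm (τ i) : ℕ)
  x := pad fun i => T.pos i 0
  y := pad fun i => T.pos i 1
  wt := pad fun a => T.weight s((L.edge a).1, (L.edge a).2)

lemma InputListing.raw_e₁ (L : InputListing T H) (τ : Fin n → T.Face) (a : Fin L.numEdges) :
    (L.raw τ).e₁ a = (L.edge a).1 := dif_pos a.2

lemma InputListing.raw_e₂ (L : InputListing T H) (τ : Fin n → T.Face) (a : Fin L.numEdges) :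
    (L.raw τ).e₂ a = (L.edge a).2 := dif_pos a.2

lemma InputListing.raw_l₁ (L : InputListing T H) (τ : Fin n → T.Face) (a : Fin L.numLinks) :
    (L.raw τ).l₁ a = (L.link a).1 := dif_pos a.2

lemma InputListing.raw_l₂ (L : InputListing T H) (τ : Fin n → T.Face) (a : Fin L.numLinks) :
    (L.raw τ).l₂ a = (L.link a).2 := dif_pos a.2

lemma InputListing.raw_tau (L : InputListing T H) (τ : Fin n → T.Face) (i : Fin n) :
    (L.raw τ).tau i = L.face.symm (τ i) := dif_pos i.2

lemma InputListing.raw_x (L : InputListing T H) (τ : Fin n → T.Face) (i : Fin n) :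
    (L.raw τ).x i = T.pos i 0 := dif_pos i.2

lemma InputListing.raw_y (L : InputListing T H) (τ : Fin n → T.Face) (i : Fin n) :
    (L.raw τ).y i = T.pos i 1 := dif_pos i.2

lemma InputListing.raw_wt (L : InputListing T H) (τ : Fin n → T.Face) (a : Fin L.numEdges) :
    (L.raw τ).wt a = T.weight s((L.edge a).1, (L.edge a).2) := dif_pos a.2

variable {L : InputListing T H} {τ : Fin n → T.Face}

lemma Truss.Listing.cornerOf_val (L : T.Listing) (p : Fin 3) (t : Fin L.numFaces) :
    L.cornerOf p t = L.corner t p := by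
  simp [cornerOf, pad]

lemma InputListing.loaded (L : InputListing T H) (τ : Fin n → T.Face) :
    (L.raw τ).Loaded (L.initialStore τ) where
  n := rfl
  E := rfl
  F := rfl
  K := rfl
  e₁ := rfl
  e₂ := rfl
  cor p hp := by
    funext t
    interval_cases p <;> rfl
  l₁ := rfl
  l₂ := rfl
  tau := rfl
  x := rfl
  y := rfl
  wt := rfl

lemma InputListing.initialStore_word {a : ℕ} (ha : 9 ≤ a) : (L.initialStore τ).word a = 0 := by
  obtain ⟨b, rfl⟩ := Nat.exists_eq_add_of_le' ha
  rfl

lemma Truss.Listing.corner_mem (L : T.Listing) (t : Fin L.numFaces) (p : Fin 3) :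
    L.corner t p ∈ (L.face t).1 := by
  rw [L.face_eq]; exact Finset.mem_image_of_mem _ (Finset.mem_univ _)

lemma Truss.Listing.exists_corner (L : T.Listing) {f : T.Face} {i : Fin n} (hi : i ∈ f.1) :
    ∃ p, L.corner (L.face.symm f) p = i := by
  have : i ∈ (L.face (L.face.symm f)).1 := by simpa using hi
  rw [L.face_eq] at this
  simpa using this

lemma Truss.Listing.corner_injective (L : T.Listing) (t : Fin L.numFaces) :
    Function.Injective (L.corner t) := by
  have h := T.card_face (L.face t).2
  rw [L.face_eq] at h
  have : (Finset.univ.image (L.corner t)).card = (Finset.univ : Finset (Fin 3)).card := by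
    rw [h]; rfl
  exact fun a b hab => Finset.card_image_iff.1 this (by simp) (by simp) hab

end encoding

/-! ### From the output back to the cut truss -/

section decoding
variable {n : ℕ} {T : Truss n} {H : SimpleGraph T.Face} {L : InputListing T H} {τ : Fin n → T.Face}

lemma InputListing.link_flag (t t' : Fin L.numFaces) (p p' : Fin 3) :
    (L.raw τ).Link ((L.raw τ).flag t p) ((L.raw τ).flag t' p') ↔
      L.corner t p = L.corner t' p' ∧ H.Adj (L.face t) (L.face t') := by
  constructor
  · rintro ⟨a, ha, q, hq, q', hq', h, h'⟩
    have h1 : (L.raw τ).l₁ a = (L.link ⟨a, ha⟩).1 := L.raw_l₁ τ ⟨a, ha⟩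
    have h2 : (L.raw τ).l₂ a = (L.link ⟨a, ha⟩).2 := L.raw_l₂ τ ⟨a, ha⟩
    rw [h1, h2] at h h'
    have hadj : s(L.face (L.link ⟨a, ha⟩).1, L.face (L.link ⟨a, ha⟩).2) ∈ H.edgeSet :=
      L.range_link ▸ Set.mem_range_self _
    rw [SimpleGraph.mem_edgeSet] at hadj
    have hc : L.corner (L.link ⟨a, ha⟩).1 ⟨q, hq⟩ = L.corner (L.link ⟨a, ha⟩).2 ⟨q', hq'⟩ := by
      apply Fin.ext
      rw [← L.cornerOf_val, ← L.cornerOf_val]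
      exact h
    rcases h' with ⟨h3, h4⟩ | ⟨h3, h4⟩ <;>
      obtain ⟨h5, h6⟩ := Raw.flag_inj (D := L.raw τ) (Fin.is_lt _) (Fin.is_lt _) h3 <;>
      obtain ⟨h7, h8⟩ := Raw.flag_inj (D := L.raw τ) (Fin.is_lt _) (Fin.is_lt _) h4 <;>
      obtain rfl := Fin.ext h5 <;> obtain rfl := Fin.ext h7 <;> subst h6 <;> subst h8
    · exact ⟨hc, hadj⟩
    · exact ⟨hc.symm, hadj.symm⟩
  · rintro ⟨h1, h2⟩
    have : s(L.face t, L.face t') ∈ H.edgeSet := h2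
    rw [← L.range_link] at this
    obtain ⟨a, ha⟩ := this
    have e1 : (L.raw τ).l₁ a = (L.link a).1 := L.raw_l₁ τ a
    have e2 : (L.raw τ).l₂ a = (L.link a).2 := L.raw_l₂ τ a
    have hcor : ∀ (p : Fin 3) (t : Fin L.numFaces), (L.raw τ).cor p t = L.corner t p :=
      fun p t => L.cornerOf_val p t
    rcases Sym2.eq_iff.1 ha with ⟨h3, h4⟩ | ⟨h3, h4⟩
    · have h3 := L.face.injective h3
      have h4 := L.face.injective h4
      refine ⟨a, a.2, p, p.2, p', p'.2, ?_, Or.inl ⟨by rw [e1, h3], by rw [e2, h4]⟩⟩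
      rw [e1, e2, h3, h4, hcor, hcor, h1]
    · have h3 := L.face.injective h3
      have h4 := L.face.injective h4
      refine ⟨a, a.2, p', p'.2, p, p.2, ?_, Or.inr ⟨by rw [e2, h4], by rw [e1, h3]⟩⟩
      rw [e1, e2, h3, h4, hcor, hcor, h1]

lemma InputListing.exists_of_link {u v : ℕ} (h : (L.raw τ).Link u v) :
    ∃ (t t' : Fin L.numFaces) (p p' : Fin 3), u = (L.raw τ).flag t p ∧
      v = (L.raw τ).flag t' p' := by
  obtain ⟨a, ha, q, hq, q', hq', -, h'⟩ := h
  have h1 : (L.raw τ).l₁ a = (L.link ⟨a, ha⟩).1 := L.raw_l₁ τ ⟨a, ha⟩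
  have h2 : (L.raw τ).l₂ a = (L.link ⟨a, ha⟩).2 := L.raw_l₂ τ ⟨a, ha⟩
  rw [h1, h2] at h'
  rcases h' with ⟨h3, h4⟩ | ⟨h3, h4⟩
  · exact ⟨_, _, ⟨q, hq⟩, ⟨q', hq'⟩, h3, h4⟩
  · exact ⟨_, _, ⟨q', hq'⟩, ⟨q, hq⟩, h3, h4⟩

/-- The geometric content is in `deg`, where planarity enters through `Truss.eq_or_eq_of_adj`: a
face has at most two neighbours at a corner. -/
lemma InputListing.valid (hH : H ≤ T.rigidityGraph) (hτ : ∀ i, i ∈ (τ i).1) :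
    (L.raw τ).Valid where
  e₁_lt a ha := by
    have : (L.raw τ).e₁ a = (L.edge ⟨a, ha⟩).1 := L.raw_e₁ τ ⟨a, ha⟩
    rw [this]; exact Fin.is_lt _
  e₂_lt a ha := by
    have : (L.raw τ).e₂ a = (L.edge ⟨a, ha⟩).2 := L.raw_e₂ τ ⟨a, ha⟩
    rw [this]; exact Fin.is_lt _
  l₁_lt a ha := by
    have : (L.raw τ).l₁ a = (L.link ⟨a, ha⟩).1 := L.raw_l₁ τ ⟨a, ha⟩
    rw [this]; exact Fin.is_lt _
  l₂_lt a ha := by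
    have : (L.raw τ).l₂ a = (L.link ⟨a, ha⟩).2 := L.raw_l₂ τ ⟨a, ha⟩
    rw [this]; exact Fin.is_lt _
  tau_lt i hi := by
    have : (L.raw τ).tau i = L.face.symm (τ ⟨i, hi⟩) := L.raw_tau τ ⟨i, hi⟩
    rw [this]; exact Fin.is_lt _
  cor_lt p hp t ht := by
    have : (L.raw τ).cor p t = L.corner ⟨t, ht⟩ ⟨p, hp⟩ := L.cornerOf_val ⟨p, hp⟩ ⟨t, ht⟩
    rw [this]; exact Fin.is_lt _
  tau_cor i hi := by
    have h1 : (L.raw τ).tau i = L.face.symm (τ ⟨i, hi⟩) := L.raw_tau τ ⟨i, hi⟩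
    obtain ⟨p, hp⟩ := L.exists_corner (hτ ⟨i, hi⟩)
    refine ⟨p, p.2, ?_⟩
    rw [h1]
    exact (L.cornerOf_val p _).trans (congrArg Fin.val hp)
  deg x u v y hu hv hy := by
    obtain ⟨t, tu, p, pu, rfl, rfl⟩ := InputListing.exists_of_link hu
    obtain ⟨t', tv, p', pv, ht', rfl⟩ := InputListing.exists_of_link hv
    obtain ⟨t'', ty, p'', py, ht'', rfl⟩ := InputListing.exists_of_link hy
    rw [ht'] at hv
    rw [ht''] at hy
    obtain ⟨h1, h2⟩ := Raw.flag_inj (D := L.raw τ) (Fin.is_lt _) (Fin.is_lt _) ht'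
    obtain ⟨h3, h4⟩ := Raw.flag_inj (D := L.raw τ) (Fin.is_lt _) (Fin.is_lt _) ht''
    obtain rfl := Fin.ext h1
    obtain rfl := Fin.ext h2
    obtain rfl := Fin.ext h3
    obtain rfl := Fin.ext h4
    rw [InputListing.link_flag] at hu hv hy
    have key : ∀ {a b : Fin L.numFaces} {q q' : Fin 3}, L.corner t p = L.corner a q →
        L.corner t p = L.corner b q' → L.face a = L.face b →
        (L.raw τ).flag a q = (L.raw τ).flag b q' := by
      intro a b q q' h1 h2 h3
      obtain rfl := L.face.injective h3
      rw [L.corner_injective a (h1.symm.trans h2)]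
    by_contra! hne
    have hux : L.face tu ≠ L.face tv := fun h => hne.1 (key hu.1 hv.1 h)
    rcases Truss.eq_or_eq_of_adj (L.corner_mem t p) (hH hu.2)
      (by rw [hu.1]; exact L.corner_mem _ _) (hH hv.2) (by rw [hv.1]; exact L.corner_mem _ _) hux
      (hH hy.2) (by rw [hy.1]; exact L.corner_mem _ _) with h | h
    · exact hne.2.1 (key hu.1 hy.1 h.symm)
    · exact hne.2.2 (key hv.1 hy.1 h.symm)
  edge t ht p hp q hq hpq := by
    have hcor : ∀ (p : ℕ) (hp : p < 3), (L.raw τ).cor p t = L.corner ⟨t, ht⟩ ⟨p, hp⟩ :=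
      fun p hp => L.cornerOf_val ⟨p, hp⟩ ⟨t, ht⟩
    have hne : L.corner ⟨t, ht⟩ ⟨p, hp⟩ ≠ L.corner ⟨t, ht⟩ ⟨q, hq⟩ := fun h =>
      hpq (congrArg Fin.val (L.corner_injective _ h))
    have hadj := T.adj_of_mem_face (L.face ⟨t, ht⟩).2 (L.corner_mem _ ⟨p, hp⟩)
      (L.corner_mem _ ⟨q, hq⟩) hne
    rw [← SimpleGraph.mem_edgeSet, ← L.range_edge] at hadj
    obtain ⟨a, ha⟩ := hadj
    have e1 : (L.raw τ).e₁ a = (L.edge a).1 := L.raw_e₁ τ a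
    have e2 : (L.raw τ).e₂ a = (L.edge a).2 := L.raw_e₂ τ a
    refine ⟨a, a.2, ?_⟩
    rw [e1, e2, hcor p hp, hcor q hq]
    exact (Sym2.eq_iff.1 ha).imp (fun h => ⟨congrArg _ h.1, congrArg _ h.2⟩)
      fun h => ⟨congrArg _ h.1, congrArg _ h.2⟩

variable {lab : ℕ → ℕ} {m : ℕ}

/-- The number of vertex `i` among the corners of the face `f`. -/
noncomputable def InputListing.cornerIdx (L : InputListing T H) (f : T.Face) (i : Fin n) : Fin 3 :=
  open Classical in if h : i ∈ f.1 then (L.exists_corner h).choose else 0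

lemma InputListing.corner_cornerIdx {f : T.Face} {i : Fin n} (h : i ∈ f.1) :
    L.corner (L.face.symm f) (L.cornerIdx f i) = i := by
  rw [cornerIdx, dif_pos h]
  exact (L.exists_corner h).choose_spec

lemma InputListing.cornerIdx_corner (t : Fin L.numFaces) (p : Fin 3) :
    L.cornerIdx (L.face t) (L.corner t p) = p := by
  have h := InputListing.corner_cornerIdx (L := L) (L.corner_mem t p)
  rw [Equiv.symm_apply_apply] at h
  exact L.corner_injective t h

/-- Identifies the components found by the search with the components in the construction of the cut
truss. -/
lemma InputListing.reflTransGen_link_iff (t t' : Fin L.numFaces) (p p' : Fin 3) :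
    Relation.ReflTransGen (L.raw τ).Link ((L.raw τ).flag t p) ((L.raw τ).flag t' p') ↔
      L.corner t p = L.corner t' p' ∧ Conn H (L.corner t p) (L.face t) (L.face t') := by
  constructor
  · intro h
    suffices ∀ v, Relation.ReflTransGen (L.raw τ).Link ((L.raw τ).flag t p) v →
        ∃ (t' : Fin L.numFaces) (p' : Fin 3), v = (L.raw τ).flag t' p' ∧
          L.corner t p = L.corner t' p' ∧ Conn H (L.corner t p) (L.face t) (L.face t') by
      obtain ⟨t₁, p₁, h1, h2, h3⟩ := this _ h
      obtain ⟨h4, h5⟩ := Raw.flag_inj (D := L.raw τ) (Fin.is_lt _) (Fin.is_lt _) h1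
      obtain rfl := Fin.ext h4
      obtain rfl := Fin.ext h5
      exact ⟨h2, h3⟩
    intro v hv
    induction hv with
    | refl => exact ⟨t, p, rfl, rfl, Conn.refl _⟩
    | tail _ h ih =>
      obtain ⟨t₁, p₁, rfl, h2, h3⟩ := ih
      obtain ⟨t₁', t₂, p₁', p₂, h4, rfl⟩ := InputListing.exists_of_link h
      rw [h4] at h
      obtain ⟨h5, h6⟩ := Raw.flag_inj (D := L.raw τ) (Fin.is_lt _) (Fin.is_lt _) h4
      obtain rfl := Fin.ext h5
      obtain rfl := Fin.ext h6
      rw [InputListing.link_flag] at h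
      refine ⟨t₂, p₂, rfl, h2.trans h.1, h3.trans (Conn.of_adj h.2 ?_ ?_)⟩
      · rw [h2]; exact L.corner_mem _ _
      · rw [h2, h.1]; exact L.corner_mem _ _
  · rintro ⟨h1, h2⟩
    suffices ∀ g, Conn H (L.corner t p) (L.face t) g →
        ∃ p', L.corner (L.face.symm g) p' = L.corner t p ∧ Relation.ReflTransGen (L.raw τ).Link
          ((L.raw τ).flag t p) ((L.raw τ).flag (L.face.symm g) p') by
      obtain ⟨q, h3, h4⟩ := this _ h2
      rw [Equiv.symm_apply_apply] at h3 h4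
      rwa [L.corner_injective _ (h3.trans h1)] at h4
    intro g hg
    induction hg with
    | refl => exact ⟨p, by simp, by rw [Equiv.symm_apply_apply]⟩
    | @tail x y _ h ih =>
      obtain ⟨q, h3, h4⟩ := ih
      obtain ⟨r, hr⟩ := L.exists_corner h.2.2
      refine ⟨r, hr, h4.tail ?_⟩
      rw [InputListing.link_flag]
      exact ⟨h3.trans hr.symm, by simpa using h.1⟩

lemma Raw.Labels.pred_lt (hlab : (L.raw τ).Labels lab m) (t : Fin L.numFaces) (p : Fin 3) :
    lab ((L.raw τ).flag t p) - 1 < m := by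
  have h1 := hlab.ne_zero _ (Raw.flag_lt (D := L.raw τ) t.2 p.2)
  have h2 := hlab.le ((L.raw τ).flag t p)
  omega

/-- The labeling of corners by the vertices of the output. -/
noncomputable def Raw.Labels.labeling (hlab : (L.raw τ).Labels lab m) : Labeling H (Fin m) where
  -- Labels start from `1`, as `0` means unlabelled, and vertices start from `0`.
  lab f i := ⟨lab ((L.raw τ).flag (L.face.symm f) (L.cornerIdx f i)) - 1, hlab.pred_lt _ _⟩
  lab_eq {f g i j} hi hj := by
    have h1 := Raw.flag_lt (D := L.raw τ) (L.face.symm f).2 (L.cornerIdx f i).2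
    have h2 := Raw.flag_lt (D := L.raw τ) (L.face.symm g).2 (L.cornerIdx g j).2
    have h3 := hlab.ne_zero _ h1
    have h4 := hlab.ne_zero _ h2
    have h5 := hlab.eq_iff _ h1 _ h2
    rw [InputListing.reflTransGen_link_iff, InputListing.corner_cornerIdx hi,
      InputListing.corner_cornerIdx hj, Equiv.apply_symm_apply, Equiv.apply_symm_apply] at h5
    rw [← h5, Fin.ext_iff]
    simp only
    omega
  surj a := by
    obtain ⟨z, hz, h⟩ := hlab.surj a a.2
    obtain ⟨t, ht, p, hp, rfl⟩ := Raw.exists_flag hz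
    refine ⟨L.face ⟨t, ht⟩, L.corner ⟨t, ht⟩ ⟨p, hp⟩, L.corner_mem _ _, Fin.ext ?_⟩
    simp only [Equiv.symm_apply_apply, InputListing.cornerIdx_corner, h]
    omega

lemma Raw.Labels.labeling_corner (hlab : (L.raw τ).Labels lab m) (t : Fin L.numFaces)
    (p : Fin 3) : hlab.labeling.lab (L.face t) (L.corner t p) =
      ⟨lab ((L.raw τ).flag t p) - 1, hlab.pred_lt t p⟩ := by
  apply Fin.ext
  simp only [labeling, Equiv.symm_apply_apply, InputListing.cornerIdx_corner]

lemma Raw.Labels.labeling_original (hlab : (L.raw τ).Labels lab m) (hnm : n ≤ m) (i : Fin n) :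
    i ∈ (τ i).1 ∧ hlab.labeling.lab (τ i) i = Fin.castLE hnm i := by
  obtain ⟨p, hp, h1, h2⟩ := hlab.original i i.2
  have h3 : (L.raw τ).tau i = L.face.symm (τ i) := L.raw_tau τ i
  rw [h3] at h1 h2
  have h4 : L.corner (L.face.symm (τ i)) ⟨p, hp⟩ = i :=
    Fin.ext ((L.cornerOf_val ⟨p, hp⟩ _).symm.trans h1)
  have h5 := hlab.labeling_corner (L.face.symm (τ i)) ⟨p, hp⟩
  have h6 := L.corner_mem (L.face.symm (τ i)) ⟨p, hp⟩
  rw [h4, Equiv.apply_symm_apply] at h5 h6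
  refine ⟨h6, ?_⟩
  rw [h5]
  apply Fin.ext
  simp [h2]

variable (hT : T.StifflyConnected) (hH : H ≤ T.rigidityGraph) (hc : H.Connected)

lemma Raw.Labels.labeling_adj (hlab : (L.raw τ).Labels lab m) {u v : Fin m} :
    (hlab.labeling.truss hT hH hc).graph.Adj u v ↔ ∃ (t : Fin L.numFaces) (p q : Fin 3), p ≠ q ∧
      u = ⟨lab ((L.raw τ).flag t p) - 1, hlab.pred_lt t p⟩ ∧
      v = ⟨lab ((L.raw τ).flag t q) - 1, hlab.pred_lt t q⟩ := by
  constructor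
  · rintro ⟨f, i, j, hi, hj, hij, rfl, rfl⟩
    obtain ⟨p, rfl⟩ := L.exists_corner hi
    obtain ⟨q, rfl⟩ := L.exists_corner hj
    refine ⟨L.face.symm f, p, q, fun h => hij (by rw [h]), ?_, ?_⟩ <;>
      rw [← hlab.labeling_corner, Equiv.apply_symm_apply]
  · rintro ⟨t, p, q, hpq, rfl, rfl⟩
    exact ⟨L.face t, L.corner t p, L.corner t q, L.corner_mem t p, L.corner_mem t q,
      fun h => hpq (L.corner_injective t h), hlab.labeling_corner t p, hlab.labeling_corner t q⟩

variable {s : Store}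

lemma Raw.Result.edge_lt (h : (L.raw τ).Result lab m s) {j : ℕ} (hj : j < s.word 9 1) :
    s.word 10 j < m ∧ s.word 11 j < m := by
  obtain ⟨t, ht, p, hp, q, hq, -, h1, h2, -⟩ := h.edge_entry j hj
  rw [h1, h2]
  exact ⟨h.labels.pred_lt ⟨t, ht⟩ ⟨p, hp⟩, h.labels.pred_lt ⟨t, ht⟩ ⟨q, hq⟩⟩

/-- The listing of the cut truss that is in the output arrays. -/
noncomputable def Raw.Result.listing (h : (L.raw τ).Result lab m s) :
    (h.labels.labeling.truss hT hH hc).Listing where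
  numEdges := s.word 9 1
  edge j := (⟨s.word 10 j, (h.edge_lt j.2).1⟩, ⟨s.word 11 j, (h.edge_lt j.2).2⟩)
  edge_injective i j hij := by
    refine Fin.ext (h.edge_inj i i.2 j j.2 ?_)
    have := congrArg (Sym2.map Fin.val) hij
    simpa using this
  range_edge := by
    ext e
    induction e with
    | _ u v =>
    rw [SimpleGraph.mem_edgeSet, h.labels.labeling_adj hT hH hc]
    constructor
    · rintro ⟨j, hj⟩
      obtain ⟨t, ht, p, hp, q, hq, hpq, h1, h2, -⟩ := h.edge_entry j j.2
      rcases Sym2.eq_iff.1 hj with ⟨rfl, rfl⟩ | ⟨rfl, rfl⟩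
      · exact ⟨⟨t, ht⟩, ⟨p, hp⟩, ⟨q, hq⟩, by simpa using hpq, Fin.ext h1, Fin.ext h2⟩
      · exact ⟨⟨t, ht⟩, ⟨q, hq⟩, ⟨p, hp⟩, by simpa using hpq.symm, Fin.ext h2, Fin.ext h1⟩
    · rintro ⟨t, p, q, hpq, rfl, rfl⟩
      obtain ⟨j, hj, h1⟩ := h.edge_complete t t.2 p p.2 q q.2 fun h => hpq (Fin.ext h)
      refine ⟨⟨j, hj⟩, Sym2.eq_iff.2 ?_⟩
      simpa [Fin.ext_iff] using Sym2.eq_iff.1 h1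
  numFaces := L.numFaces
  face := L.face.trans (h.labels.labeling.faceEquiv hT hH hc).symm
  corner t p := h.labels.labeling.lab (L.face t) (L.corner t p)
  face_eq t := by
    rw [Equiv.trans_apply, Labeling.faceEquiv_symm_coe, Labeling.liftFace, L.face_eq,
      Finset.image_image]
    rfl

lemma Raw.Result.isOutput (h : (L.raw τ).Result lab m s) :
    (h.listing hT hH hc).IsOutput s := by
  have hcorner : ∀ (t : Fin L.numFaces) (p : Fin 3), s.word (12 + p) t =
      (h.labels.labeling.lab (L.face t) (L.corner t p) : Fin m) := by
    intro t p
    rw [(h.copied t t.2 p p.2).corner, h.labels.labeling_corner]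
  have hpos : ∀ (a : Fin m), s.real 3 a = (h.labels.labeling.truss hT hH hc).pos a 0 ∧
      s.real 4 a = (h.labels.labeling.truss hT hH hc).pos a 1 := by
    intro a
    obtain ⟨f, i, hi, rfl⟩ := h.labels.labeling.surj a
    obtain ⟨p, rfl⟩ := L.exists_corner hi
    obtain ⟨t, rfl⟩ := L.face.surjective f
    simp only [Equiv.symm_apply_apply] at hi ⊢
    have e1 := (h.copied t t.2 p p.2).x
    have e2 := (h.copied t t.2 p p.2).y
    have e3 : (L.raw τ).cor p t = L.corner t p := L.cornerOf_val p t
    have e4 : (h.labels.labeling.truss hT hH hc).pos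
        (h.labels.labeling.lab (L.face t) (L.corner t p)) = T.pos (L.corner t p) :=
      congrArg T.pos (h.labels.labeling.proj_lab hi)
    rw [e4, h.labels.labeling_corner]
    rw [e3] at e1 e2
    exact ⟨e1.trans (L.raw_x τ _), e2.trans (L.raw_y τ _)⟩
  constructor
  · exact h.num_vertices
  · rfl
  · exact h.num_faces
  · exact fun _ => rfl
  · exact fun _ => rfl
  · exact fun t => hcorner t 0
  · exact fun t => hcorner t 1
  · exact fun t => hcorner t 2
  · exact fun a => (hpos a).1
  · exact fun a => (hpos a).2
  · intro j
    obtain ⟨t, ht, p, hp, q, hq, hpq, h1, h2, a, ha, h3, h4⟩ := h.edge_entry j j.2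
    have e0 : ∀ (p : ℕ) (hp : p < 3), (L.raw τ).cor p t = L.corner ⟨t, ht⟩ ⟨p, hp⟩ :=
      fun p hp => L.cornerOf_val ⟨p, hp⟩ ⟨t, ht⟩
    have e1 : (L.raw τ).e₁ a = (L.edge ⟨a, ha⟩).1 := L.raw_e₁ τ ⟨a, ha⟩
    have e2 : (L.raw τ).e₂ a = (L.edge ⟨a, ha⟩).2 := L.raw_e₂ τ ⟨a, ha⟩
    have e3 : (L.raw τ).wt a = T.weight s((L.edge ⟨a, ha⟩).1, (L.edge ⟨a, ha⟩).2) :=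
      L.raw_wt τ ⟨a, ha⟩
    have e4 : ((h.listing hT hH hc).edge j).1 =
        h.labels.labeling.lab (L.face ⟨t, ht⟩) (L.corner ⟨t, ht⟩ ⟨p, hp⟩) := by
      rw [h.labels.labeling_corner]; exact Fin.ext h1
    have e5 : ((h.listing hT hH hc).edge j).2 =
        h.labels.labeling.lab (L.face ⟨t, ht⟩) (L.corner ⟨t, ht⟩ ⟨q, hq⟩) := by
      rw [h.labels.labeling_corner]; exact Fin.ext h2
    rw [h3, e3, e4, e5]
    change _ = T.weight (Sym2.map _ _)
    rw [Sym2.map_mk, Labeling.proj_lab _ (L.corner_mem _ _),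
      Labeling.proj_lab _ (L.corner_mem _ _)]
    congr 1
    rw [e1, e2, e0 p hp, e0 q hq] at h4
    exact Sym2.eq_iff.2 (by simpa [Fin.ext_iff] using h4)

end decoding
end Fretsaw

namespace Fretsaw

/-- The bound is quadratic in the size, and `c * size ^ c` exceeds every quadratic bound with
coefficient at most `c` as soon as `c ≥ 2`. -/
lemma InputListing.bound_raw_le {n : ℕ} {T : Truss n} {H : SimpleGraph T.Face}
    (L : InputListing T H) (τ : Fin n → T.Face) (h : 1 ≤ L.size) {c : ℕ} (hc : 100 ≤ c) :
    (L.raw τ).bound ≤ c * L.size ^ c := by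
  have h1 : L.size ^ 2 ≤ L.size ^ c := Nat.pow_le_pow_right h (by omega)
  have h2 : (L.raw τ).bound ≤ 100 * L.size ^ 2 := by
    unfold Raw.bound
    change (n + 3 * L.numFaces) * (n + 3 * L.numFaces) + (n + 3 * L.numFaces) + 6 * L.numFaces +
      L.numEdges + L.numLinks + 10 ≤ _
    unfold InputListing.size at h ⊢
    nlinarith [Nat.zero_le n, Nat.zero_le L.numFaces, Nat.zero_le L.numEdges,
      Nat.zero_le L.numLinks]
  exact h2.trans (Nat.mul_le_mul hc h1)

end Fretsaw

theorem mainTheorem3 :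
    ∃ (fretsaw : Fretsaw.Prog) (c : ℕ),
      ∀ (n : ℕ) (T : Fretsaw.Truss n), T.StifflyConnected →
      ∀ H : SimpleGraph T.Face, H ≤ T.rigidityGraph → H.Connected →
      ∀ τ : Fin n → T.Face, (∀ i, i ∈ (τ i).1) →
      ∀ L : Fretsaw.InputListing T H,
      ∃ (t : ℕ) (s : Fretsaw.Store) (m : ℕ) (T' : Fretsaw.Truss m) (L' : T'.Listing)
        (ρ : T'.Face ≃ T.Face) (π : Fin m → Fin n)
        (hext : Fretsaw.IsFretsawExtension T T' ρ π),
        -- the program halts after linearly many steps, using words of logarithmic length,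
        -- with output `T'` and `ρ` (the order of the faces of `T'` is that of their images)
        Fretsaw.Exec (c * L.size ^ c) fretsaw (L.initialStore τ) t s ∧
        t ≤ c * L.size ∧
        L'.IsOutput s ∧
        (∀ (a : Fin L'.numFaces) (b : Fin L.numFaces),
          (a : ℕ) = b → ρ (L'.face a) = L.face b) ∧
        -- the properties of the output
        T'.StifflyConnected ∧
        (∀ i : Fin n, Fin.castLE hext.le i ∈ (ρ.symm (τ i)).1) ∧
        H.comap ρ ≤ T'.rigidityGraph ∧
        ∀ k : ℕ, (H.comap ρ).edgeSet.ncard + 1 = T.faces.card + k →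
          (T'.rigidityGraph.edgeSet \ (H.comap ρ).edgeSet).ncard ≤ k := by
  -- The running time is at most `4000 * size + 1000`. The input has at least one face, so `size ≥
  -- 1` absorbs the constant term.
  refine ⟨Fretsaw.Raw.fretsawProg, 5000, ?_⟩
  intro n T hT H hH hc τ hτ L
  have hsize : 1 ≤ L.size := by
    obtain ⟨f⟩ := hT.1.nonempty
    have := (L.face.symm f).2
    unfold Fretsaw.InputListing.size
    omega
  obtain ⟨t, s, hexec, ht, lab, m, h⟩ := Fretsaw.Raw.runs_fretsawProg (L.valid hH hτ) (L.loaded τ)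
    (fun a ha => Fretsaw.InputListing.initialStore_word ha) (L.bound_raw_le τ hsize (c := 5000) (by norm_num))
  have hnm : n ≤ m := h.labels.n_le
  have horig := h.labels.labeling_original hnm
  have ht' : t ≤ 4000 * L.size + 1000 := ht
  refine ⟨t, s, m, h.labels.labeling.truss hT hH hc, h.listing hT hH hc,
    h.labels.labeling.faceEquiv hT hH hc, h.labels.labeling.proj,
    h.labels.labeling.isFretsawExtension hT hH hc hnm fun i => ⟨τ i, horig i⟩, hexec, by omega,
    h.isOutput hT hH hc, fun a b hab => ?_, h.labels.labeling.truss_stifflyConnected hT hH hc,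
    fun i => ?_, h.labels.labeling.comap_le_rigidityGraph hT hH hc, fun k hk =>
    h.labels.labeling.ncard_sdiff_le hT hH hc hk⟩
  · obtain rfl : a = b := Fin.ext hab
    exact Equiv.apply_symm_apply _ _
  · exact (h.labels.labeling.mem_liftFace).2 ⟨i, (horig i).1, (horig i).2⟩
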